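/- Let $p$ be a prime and let $F$ be a non-archimedean local field with finite residue field $k$ of characteristic $p$ and cardinality $q=p^f$. Let $v:F^\times\to\mathbf Z$ be the normalized valuation; if $\operatorname{char}F=0$, let $e=v(p)$ be the absolute ramification index. Fix an algebraic closure $\Omega$ of $F$ and let $\mathcal T_p(F)$ be the set of separable totally ramified extensions $E$ of $F$ of degree $p$ in $\Omega$. For $E\in\mathcal T_p(F)$ with discriminant $\delta_{E|F}$ put $c(E)=v(\delta_{E|F})-(p-1)$; call $E$ *très ramifiée* if $p\mid c(E)$. Let $K=F(\sqrt[p-1]{F^\times})\subset\Omega$ and $G=\operatorname{Gal}(K|F)$. If $\operatorname{char}F=0$, let $\omega:G\to\mathbf F_p^\times$ be the cyclotomic character giving the action of $G$ on the $p$-th roots of unity (which lie in $K$); if $\operatorname{char}F=p$, let $\omega=1$. The perfect pairing $G\times F^\times/F^{\times(p-1)}\to\mathbf F_p^\times$, $(\sigma,\bar a)\mapsto\sigma(\alpha)/\alpha$ with $\alpha^{p-1}=a$ (the $(p-1)$-th roots of unity of $F$ being identified with $\mathbf F_p^\times$ by reduction), identifies $\operatorname{Hom}(G,\mathbf F_p^\times)$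 with $F^\times/F^{\times(p-1)}$; for a character $\chi$ corresponding to $\bar a$ write $\bar v(\chi)\in\mathbf Z/(p-1)\mathbf Z$ for the class of $v(a)$. For $i\in\mathbf N$ let $j_{\chi,i}\in\{1,\dots,p-1\}$ be the integer with $\bar v(\chi)\equiv\bar v(\omega)-(i+j_{\chi,i})\pmod{p-1}$. Write $\wp(x)=x^p-x$. For $E\in\mathcal T_p(F)$ and a character $\chi:G\to\mathbf F_p^\times$, write $E\mapsto\chi$ if there is an $\mathbf F_p$-line $D\subset K^\times/K^{\times p}$ with $EK=K(\sqrt[p]{D})$ (if $\operatorname{char}F=0$), respectively $D\subset K/\wp(K)$ with $EK=K(\wp^{-1}(D))$ (if $\operatorname{char}F=p$), which is $G$-stable and on which $G$ acts through $\chi$. Then for every $E\in\mathcal T_p(F)$ there is exactly one character $\chi:G\to\mathbf F_p^\times$ with $E\mapsto\chi$. Moreover, let $\chi:G\to\mathbf F_p^\times$ be a character. (a) If $\operatorname{char}F=p$, then $$\sum_{E\mapsto\chi}q^{-c(E)}=\frac{p(q-1)}{p-1}\sum_{i\in\mathbf N}q^{\,i-(ip+j_{\chi,i})},$$ both series being convergent.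 (b) If $\operatorname{char}F=0$ and $\chi\neq1$, then $$\sum_{E\mapsto\chi}q^{-c(E)}=\frac{p(q-1)}{p-1}\sum_{0\le i<e}q^{\,i-(ip+j_{\chi,i})}.$$ (c) If $\operatorname{char}F=0$ and $\chi=1$, then $$\sum_{E\mapsto1}q^{-c(E)}=\frac{p(q-1)}{p-1}\sum_{0\le i<e}q^{\,i-(ip+j_{1,i})}+\frac{p}{q^{(p-1)e}},$$ and the très ramifiées extensions $E\mapsto1$ contribute exactly the last term: $\sum_{E\mapsto1,\;p\mid c(E)}q^{-c(E)}=p/q^{(p-1)e}$. -/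

import Mathlib

open ValuativeRel Module

namespace MassFormula

noncomputable section

section LocalField

variable (F : Type*) [Field F] [ValuativeRel F] [TopologicalSpace F]
  [IsNonarchimedeanLocalField F]

/-- The normalized valuation `v : Fˣ → ℤ` (with value `0` at `0`). -/
def val (x : F) : ℤ :=
  -WithZero.log (IsNonarchimedeanLocalField.valueGroupWithZeroIsoInt F (valuation F x))

/-- The absolute ramification index `e = v(p)`, used when `F` has characteristic `0` and residue
characteristic `p`. -/
def absRamificationIdx (p : ℕ) : ℕ := (val F (p : F)).toNat

end LocalField

section Extension

variable {F : Type*} [Field F] [ValuativeRel F]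
variable {Ω : Type*} [Field Ω] [Algebra F Ω]

/-- `E|F` is totally ramified: the maximal ideal of the ring of integers of `F` becomes the
`[E : F]`-th power of a maximal ideal of the ring of integers of `E`. -/
def IsTotallyRamified (E : IntermediateField F Ω) : Prop :=
  ∃ P : Ideal (integralClosure 𝒪[F] E), P.IsMaximal ∧
    Ideal.map (algebraMap 𝒪[F] (integralClosure 𝒪[F] E)) 𝓂[F] = P ^ finrank F E

variable (F Ω) in
/-- The set `𝒯_p(F)` of the separable totally ramified extensions of degree `p` of `F`
inside `Ω`. -/
def ramifiedExtensions (p : ℕ) : Set (IntermediateField F Ω) :=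
  {E | Algebra.IsSeparable F E ∧ finrank F E = p ∧ IsTotallyRamified E}

/-- The discriminant ideal of `E|F`: it is generated by the discriminants of all families of
`[E : F]` integers of `E`. -/
def discrIdeal (E : IntermediateField F Ω) : Ideal 𝒪[F] :=
  Ideal.span {d | ∃ b : Fin (finrank F E) → integralClosure 𝒪[F] E,
    (d : F) = Algebra.discr F (fun i => (b i : E))}

/-- Serre's invariant `c(E) = v(δ) - ([E : F] - 1)`, where `δ` is the discriminant of `E|F`. -/
def serreC (E : IntermediateField F Ω) : ℤ :=
  (multiplicity 𝓂[F] (discrIdeal E) : ℤ) - ((finrank F E : ℤ) - 1)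

end Extension

section Characters

variable (F : Type*) [Field F]
variable (Ω : Type*) [Field Ω] [Algebra F Ω]
variable (p : ℕ)

/-- The extension `K` of `F` generated by all `(p - 1)`-th roots of elements of `Fˣ`. -/
def kummerField : IntermediateField F Ω :=
  IntermediateField.adjoin F {x | ∃ a : F, a ≠ 0 ∧ x ^ (p - 1) = algebraMap F Ω a}

/-- The group of characters `χ : Gal(K|F) → 𝔽_pˣ`. -/
abbrev Character := Gal(kummerField F Ω p/F) →* (ZMod p)ˣ

open Classical in
/-- The cyclotomic character `ω`: the action of `Gal(K|F)` on the `p`-th roots of unity of `K` if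
there are `p` of them (as is always the case for local fields of characteristic `0`), and `ω = 1`
otherwise (in characteristic `p`). -/
def cyclotomicChar [NeZero p] : Character F Ω p :=
  if h : Nat.card (rootsOfUnity p (kummerField F Ω p)) = p then
    (modularCyclotomicCharacter (kummerField F Ω p) h).comp
      { toFun := fun σ => (σ : kummerField F Ω p ≃+* kummerField F Ω p)
        map_one' := rfl
        map_mul' := fun _ _ => rfl }
  else 1

variable {F Ω p}

/-- The field `E` corresponds to the character `χ` in characteristic `0`: there is an `𝔽_p`-line
`D` (a subgroup of order `p`) in `Kˣ/Kˣᵖ` such that `EK = K(ᵖ√D)` and such that `Gal(K|F)` acts on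
`D` through `χ`. -/
def HasKummerCharacter (E : IntermediateField F Ω) (χ : Character F Ω p) : Prop :=
  ∃ D : Subgroup ((kummerField F Ω p)ˣ ⧸ (powMonoidHom p : (kummerField F Ω p)ˣ →* _).range),
    Nat.card D = p ∧
    E ⊔ kummerField F Ω p =
      (IntermediateField.adjoin (kummerField F Ω p)
        {x : Ω | ∃ a : (kummerField F Ω p)ˣ, QuotientGroup.mk a ∈ D ∧
          x ^ p = algebraMap (kummerField F Ω p) Ω a}).restrictScalars F ∧
    ∀ (σ : Gal(kummerField F Ω p/F)) (a : (kummerField F Ω p)ˣ),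
      (QuotientGroup.mk a : (kummerField F Ω p)ˣ ⧸ (powMonoidHom p).range) ∈ D →
      (QuotientGroup.mk (Units.map (σ : kummerField F Ω p →* kummerField F Ω p) a) :
        (kummerField F Ω p)ˣ ⧸ (powMonoidHom p).range) =
        QuotientGroup.mk a ^ (χ σ : ZMod p).val

/-- The additive map `℘ : x ↦ x ^ p - x` of a field of characteristic `p`. -/
def wp (L : Type*) [Field L] (p : ℕ) [Fact p.Prime] [CharP L p] : L →+ L :=
  (frobenius L p : L →+ L) - AddMonoidHom.id L

instance [CharP F p] : CharP (kummerField F Ω p) p :=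
  charP_of_injective_algebraMap (algebraMap F (kummerField F Ω p)).injective p

/-- The field `E` corresponds to the character `χ` in characteristic `p`: there is an `𝔽_p`-line
`D` (a subgroup of order `p`) in `K/℘(K)` such that `EK = K(℘⁻¹(D))` and such that `Gal(K|F)` acts
on `D` through `χ`. -/
def HasArtinSchreierCharacter [Fact p.Prime] [CharP F p] (E : IntermediateField F Ω)
    (χ : Character F Ω p) : Prop :=
  ∃ D : AddSubgroup (kummerField F Ω p ⧸ (wp (kummerField F Ω p) p).range),
    Nat.card D = p ∧
    E ⊔ kummerField F Ω p =
      (IntermediateField.adjoin (kummerField F Ω p)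
        {x : Ω | ∃ a : kummerField F Ω p, QuotientAddGroup.mk a ∈ D ∧
          x ^ p - x = algebraMap (kummerField F Ω p) Ω a}).restrictScalars F ∧
    ∀ (σ : Gal(kummerField F Ω p/F)) (a : kummerField F Ω p),
      (QuotientAddGroup.mk a : kummerField F Ω p ⧸ (wp (kummerField F Ω p) p).range) ∈ D →
      (QuotientAddGroup.mk (σ a) : kummerField F Ω p ⧸ (wp (kummerField F Ω p) p).range) =
        (χ σ : ZMod p).val • QuotientAddGroup.mk a

/-- The relation `E ↦ χ`. -/
def HasCharacter [Fact p.Prime] (E : IntermediateField F Ω) (χ : Character F Ω p) : Prop :=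
  (CharZero F ∧ HasKummerCharacter E χ) ∨ ∃ _ : CharP F p, HasArtinSchreierCharacter E χ

end Characters

section Valuation

variable {F : Type*} [Field F] [ValuativeRel F]
variable {Ω : Type*} [Field Ω] [Algebra F Ω]
variable {p : ℕ} [CharP 𝓀[F] p]

/-- The class of `a ∈ Fˣ` corresponds to `χ` under the Kummer pairing
`Gal(K|F) × Fˣ/Fˣᵖ⁻¹ → 𝔽_pˣ`, `(σ, a) ↦ σ(α)/α` with `αᵖ⁻¹ = a`, where the `(p - 1)`-th roots of
unity of `F` are identified with the elements of `𝔽_pˣ` by reduction. -/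
def KummerDual (χ : Character F Ω p) (a : Fˣ) : Prop :=
  ∀ (σ : Gal(kummerField F Ω p/F)) (α : kummerField F Ω p),
    α ^ (p - 1) = algebraMap F (kummerField F Ω p) a →
    ∃ ζ : 𝒪[F], σ α = algebraMap F (kummerField F Ω p) ζ * α ∧
      IsLocalRing.residue 𝒪[F] ζ = ZMod.castHom dvd_rfl 𝓀[F] (χ σ : ZMod p)

variable [TopologicalSpace F] [IsNonarchimedeanLocalField F]

open Classical in
/-- The "valuation" `v̄(χ) ∈ ℤ/(p-1)ℤ`: the class of `v(a)` for any `a ∈ Fˣ` whose class in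
`Fˣ/Fˣᵖ⁻¹` corresponds to `χ`. (The pairing is perfect, so there is such an `a`, and it is unique
modulo `(p - 1)`-th powers.) -/
def valBar (χ : Character F Ω p) : ZMod (p - 1) :=
  if h : ∃ a : Fˣ, KummerDual χ a then ((val F (h.choose : F) : ℤ) : ZMod (p - 1)) else 0

/-- The integer `j_{χ,i} ∈ [1, p[` with `v̄(χ) = v̄(ω) - (i + j_{χ,i})` in `ℤ/(p-1)ℤ`
(see `jIndex_spec`). -/
def jIndex [NeZero p] (χ : Character F Ω p) (i : ℕ) : ℕ :=
  (valBar (cyclotomicChar F Ω p) - valBar χ - (i : ZMod (p - 1)) - 1).val + 1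

/-- `j_{χ,i}` satisfies its defining condition, and it is the only integer that does. -/
theorem jIndex_spec [Fact p.Prime] (χ : Character F Ω p) (i j : ℕ) :
    (1 ≤ j ∧ j < p ∧
      valBar χ = valBar (cyclotomicChar F Ω p) - ((i + j : ℕ) : ZMod (p - 1))) ↔
    j = jIndex χ i := by
  have hp : 2 ≤ p := (Fact.out : p.Prime).two_le
  have : NeZero (p - 1) := ⟨by omega⟩
  unfold jIndex
  constructor
  · rintro ⟨h1, h2, h⟩
    obtain ⟨k, rfl⟩ : ∃ k, j = k + 1 := ⟨j - 1, by omega⟩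
    rw [h]
    have : valBar (cyclotomicChar F Ω p) - (valBar (cyclotomicChar F Ω p) -
        ((i + (k + 1) : ℕ) : ZMod (p - 1))) - (i : ZMod (p - 1)) - 1 = (k : ZMod (p - 1)) := by
      push_cast
      ring
    rw [this, ZMod.val_natCast_of_lt (by omega)]
  · rintro rfl
    refine ⟨by omega, ?_, ?_⟩
    · have := ZMod.val_lt
        (valBar (cyclotomicChar F Ω p) - valBar χ - (i : ZMod (p - 1)) - 1)
      omega
    · push_cast
      rw [ZMod.natCast_zmod_val]
      ring

/-- The term `q ^ (i - (ip + j_{χ,i}))`, where `q` is the cardinality of the residue field. -/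
def massTerm [NeZero p] (χ : Character F Ω p) (i : ℕ) : ℝ :=
  (Nat.card 𝓀[F] : ℝ) ^ ((i : ℤ) - ((i : ℤ) * (p : ℤ) + (jIndex χ i : ℤ)))

end Valuation

end

end MassFormula

/-! The method is Serre's. A totally ramified extension of degree p is generated by a root of an
Eisenstein polynomial, so masses of extensions become counts of polynomials modulo a power of a
uniformizer ϖ. What has to be added is a way to read the character χ off the coefficients. Below, ≈
means "has the same leading term as".

Let f = X^p + a_{p-1} X^{p-1} + ... + a_0 be separable Eisenstein with root π generating E. In π
f'(π) = ∑ l a_l π^l the nonzero terms with 1 ≤ l ≤ p have exponents in distinct classes modulo p, so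
a single term j a_j π^j dominates (`IsEisensteinPoly.exists_hasType`). If v(j a_j) = i + 1, then
c(E) = ip + j with 1 ≤ j ≤ p (`HasType.serreC_eq`). Any other root π' satisfies (π' - π)^(p-1) ≈
-f'(π) (`IsEisensteinPoly.sub_pow_near`), hence ((π' - π) π^(j-1))^(p-1) ≈ b with b = -(j
a_j)(-a_0)^(j-1) in F. Ratios of these normalized differences therefore have residues in 𝔽_p, the
roots of f are indexed by 𝔽_p, and Galois permutes them by affine maps whose linear part is the
character ψ dual to b (`IsEisensteinPoly.exists_affineSystem`). As [K : F] is prime to p, EK is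
cyclic of degree p over K and Gal(K|F) acts on its translations through ψ. Kummer theory or
Artin-Schreier theory turns this into the unique character χ = ωψ⁻¹
(`IsAffineSystem.hasCharacter_iff`).

Now v(b) = i + j. If j < p, this congruence is the definition of j_{χ,i}. If j = p, then a_p = 1 and
v(p) = i + 1, so F has characteristic 0 and i + 1 = e; moreover b is -p times a (p-1)-th power, and
-p is dual to ω because (1 - ζ)^(p-1) ≈ -p for a primitive p-th root of unity ζ, so χ = 1. These are
the très ramifiées extensions. In all cases v(p) ≥ i + 1, whence the range i < e in characteristic 0
(`exists_type_of_hasCharacter`).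

For fixed χ and i, Krasner's lemma matches the Eisenstein polynomials of the right type with -a_0 ≈
ϖ, taken modulo ϖ^N, with the uniformizers x satisfying x^p ≈ ϖ in the fields to be counted, taken
modulo a small ball. Counting roots in two ways gives the number of fields
(`finite_and_ncard_mul_eq`). The coefficient a_j runs through a single class modulo (p-1)-th powers
of units, which gives p (q-1)/(p-1) q^i extensions for j < p; for j = p this constraint is absent
and there are p q^e extensions. Multiplying by q^(-c) and summing over i yields the formula. -/

namespace MassFormula

open scoped NNReal

set_option linter.unusedSectionVars false

/-! ### The absolute value on the algebraic closure. -/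

section ExtendedValuation

variable {F : Type*} [Field F] [ValuativeRel F] {Ω : Type*} [Field Ω] [Algebra F Ω]

/-- A real valuation on `Ω` which extends that of `F`, is invariant under automorphisms, and
whose ring of integers is the integral closure of the integers of `F`. -/
structure IsExtendedValuation (F : Type*) [Field F] [ValuativeRel F] {Ω : Type*} [Field Ω]
    [Algebra F Ω] (w : Valuation Ω ℝ≥0) : Prop where
  lt_iff (x y : F) : w (algebraMap F Ω x) < w (algebraMap F Ω y) ↔ valuation F x < valuation F y
  map_algEquiv (σ : Gal(Ω/F)) (x : Ω) : w (σ x) = w x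
  le_one_iff (x : Ω) : w x ≤ 1 ↔ IsIntegral 𝒪[F] x

/-- The spectral norm over the complete field `F` does this. It is computed from the coefficients of
the minimal polynomial, hence is invariant under automorphisms, and it is at most 1 exactly when
these coefficients are integral. -/
theorem exists_isExtendedValuation (F : Type*) [Field F] [ValuativeRel F] [TopologicalSpace F]
    [IsNonarchimedeanLocalField F] (Ω : Type*) [Field Ω] [Algebra F Ω] [Algebra.IsAlgebraic F Ω] :
    ∃ w : Valuation Ω ℝ≥0, IsExtendedValuation F w := by
  let := IsTopologicalAddGroup.rightUniformSpace F
  have := isUniformAddGroup_of_addCommGroup (G := F)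
  let : (Valued.v (R := F) (Γ₀ := ValueGroupWithZero F)).RankOne :=
  { hom' := IsRankLeOne.nonempty.some.emb (R := F).comp MonoidWithZeroHom.ValueGroup₀.embedding
    strictMono' := IsRankLeOne.nonempty.some.strictMono.comp
        MonoidWithZeroHom.ValueGroup₀.embedding_strictMono }
  let : NontriviallyNormedField F := Valued.toNontriviallyNormedField F (ValueGroupWithZero F)
  have : IsUltrametricDist F := Valued.instIsUltrametricDist F (ValueGroupWithZero F)
  have : CompleteSpace F := inferInstance
  have hnorm (x y : F) : ‖x‖ ≤ ‖y‖ ↔ valuation F x ≤ valuation F y :=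
    Valued.toNormedField.norm_le_iff
  let w : Valuation Ω ℝ≥0 :=
  { toFun := fun x => ⟨spectralNorm F Ω x, spectralNorm_nonneg x⟩
    map_zero' := by ext; exact spectralNorm_zero
    map_one' := by ext; exact spectralNorm_one
    map_mul' := fun x y => by ext; exact spectralAlgNorm_mul x y
    map_add_le_max' := fun x y => by
      rcases le_max_iff.1 (isNonarchimedean_spectralNorm (K := F) x y) with h | h
      · exact le_max_of_le_left h
      · exact le_max_of_le_right h }
  have hw (x : Ω) : (w x : ℝ) = spectralNorm F Ω x := rfl
  refine ⟨w, ⟨fun x y => ?_, fun σ x => ?_, fun x => ?_⟩⟩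
  · rw [← NNReal.coe_lt_coe, hw, hw, spectralNorm_extends, spectralNorm_extends, ← not_le, hnorm,
      not_le]
  · rw [← NNReal.coe_inj, hw, hw]
    exact (spectralNorm_eq_of_equiv σ x).symm
  · have hx : IsIntegral F x := Algebra.IsIntegral.isIntegral x
    rw [← NNReal.coe_le_coe, hw, spectralNorm, NNReal.coe_one,
      spectralValue_le_one_iff (minpoly.monic hx)]
    have h1 : ∀ a : F, ‖a‖ ≤ 1 ↔ a ∈ 𝒪[F] := fun a => by
      have := hnorm a 1
      rw [norm_one, map_one] at this
      exact this
    simp_rw [h1]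
    constructor
    · intro h
      have hl : minpoly F x ∈ Polynomial.lifts (algebraMap 𝒪[F] F) := by
        rw [Polynomial.lifts_iff_coeff_lifts]
        exact fun n => ⟨⟨_, h n⟩, rfl⟩
      obtain ⟨g, hg, -, hgm⟩ := Polynomial.lifts_and_natDegree_eq_and_monic hl (minpoly.monic hx)
      refine ⟨g, hgm, ?_⟩
      rw [IsScalarTower.algebraMap_eq 𝒪[F] F Ω, ← Polynomial.eval₂_map, hg]
      exact minpoly.aeval F x
    · intro h n
      rw [minpoly.isIntegrallyClosed_eq_field_fractions' F h, Polynomial.coeff_map]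
      exact ((minpoly 𝒪[F] x).coeff n).2

end ExtendedValuation

/-! ### The normalized valuation and its comparison with the absolute value. -/

section LocalField

variable (F : Type*) [Field F] [ValuativeRel F] [TopologicalSpace F]
  [IsNonarchimedeanLocalField F]

variable {F} in
theorem val_mul {x y : F} (hx : x ≠ 0) (hy : y ≠ 0) : val F (x * y) = val F x + val F y := by
  unfold val
  rw [map_mul, map_mul, WithZero.log_mul (by simpa using hx) (by simpa using hy)]
  ring

@[simp] theorem val_one : val F (1 : F) = 0 := by simp [val]

variable {F} in
theorem val_inv (x : F) : val F x⁻¹ = -val F x := by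
  unfold val
  rw [map_inv₀, map_inv₀, WithZero.log_inv]

variable {F} in
theorem val_pow {x : F} (n : ℕ) : val F (x ^ n) = n * val F x := by
  unfold val
  rw [map_pow, map_pow, WithZero.log_pow]
  simp

variable {F} in
theorem val_lt_val_iff {x y : F} (hx : x ≠ 0) (hy : y ≠ 0) :
    val F x < val F y ↔ valuation F y < valuation F x := by
  unfold val
  rw [neg_lt_neg_iff, WithZero.log_lt_log (by simpa using hy) (by simpa using hx)]
  exact map_lt_map_iff (IsNonarchimedeanLocalField.valueGroupWithZeroIsoInt F)

theorem exists_val_eq_one : ∃ x : F, x ≠ 0 ∧ val F x = 1 := by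
  obtain ⟨x, hx⟩ := ValuativeRel.valuation_surjective
    ((IsNonarchimedeanLocalField.valueGroupWithZeroIsoInt F).symm (WithZero.exp (-1)))
  refine ⟨x, ?_, ?_⟩
  · rintro rfl
    rw [map_zero, eq_comm] at hx
    simp at hx
  · simp [val, hx]

variable {F} in
theorem mem_integer_iff_val {x : F} (hx : x ≠ 0) : x ∈ 𝒪[F] ↔ 0 ≤ val F x := by
  rw [← not_lt, ← val_one F, val_lt_val_iff hx one_ne_zero, map_one, not_lt]
  rfl

variable {F} in
theorem residue_eq_zero_iff_valuation (x : 𝒪[F]) :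
    IsLocalRing.residue 𝒪[F] x = 0 ↔ valuation F (x : F) < 1 := by
  rw [IsLocalRing.residue_eq_zero_iff]
  exact Valuation.mem_maximalIdeal_iff F (valuation F)

variable {F} {Ω : Type*} [Field Ω] [Algebra F Ω] {w : Valuation Ω ℝ≥0}

namespace IsExtendedValuation

theorem le_iff (hw : IsExtendedValuation F w) (x y : F) :
    w (algebraMap F Ω x) ≤ w (algebraMap F Ω y) ↔ valuation F x ≤ valuation F y := by
  rw [← not_lt, hw.lt_iff, not_lt]

theorem algebraMap_le_one_iff (hw : IsExtendedValuation F w) (x : F) : w (algebraMap F Ω x) ≤ 1 ↔ x ∈ 𝒪[F] := by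
  have := hw.le_iff x 1
  rw [map_one, map_one, map_one] at this
  exact this

theorem algebraMap_lt_one_iff (hw : IsExtendedValuation F w) (x : F) : w (algebraMap F Ω x) < 1 ↔ valuation F x < 1 := by
  have := hw.lt_iff x 1
  rwa [map_one, map_one, map_one] at this

theorem residue_eq_zero_iff (hw : IsExtendedValuation F w) (x : 𝒪[F]) :
    IsLocalRing.residue 𝒪[F] x = 0 ↔ w (algebraMap F Ω x) < 1 := by
  rw [residue_eq_zero_iff_valuation, hw.algebraMap_lt_one_iff]

theorem residue_eq_iff (hw : IsExtendedValuation F w) (x y : 𝒪[F]) :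
    IsLocalRing.residue 𝒪[F] x = IsLocalRing.residue 𝒪[F] y ↔
      w (algebraMap F Ω x - algebraMap F Ω y) < 1 := by
  rw [← sub_eq_zero, ← map_sub, hw.residue_eq_zero_iff, ← map_sub]
  rfl

theorem algebraMap_eq_one_iff (hw : IsExtendedValuation F w) {x : F} (hx : x ≠ 0) : w (algebraMap F Ω x) = 1 ↔ val F x = 0 := by
  rw [le_antisymm_iff, hw.algebraMap_le_one_iff, ← not_lt, hw.algebraMap_lt_one_iff,
    mem_integer_iff_val hx, ← map_one (valuation F), ← val_lt_val_iff one_ne_zero hx, val_one]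
  omega

/-- Division by the appropriate power of ϖ leaves a unit, of absolute value 1. Comparisons of
absolute values thus become comparisons of integral exponents. -/
theorem eq_zpow (hw : IsExtendedValuation F w) {ϖ : F} (h0 : ϖ ≠ 0) (hϖ : val F ϖ = 1) {x : F} (hx : x ≠ 0) :
    w (algebraMap F Ω x) = w (algebraMap F Ω ϖ) ^ val F x := by
  have hv (n : ℤ) : val F (ϖ ^ n) = n := by
    rcases n with n | n
    · simp [val_pow, hϖ]
    · simp [val_inv, val_pow, hϖ]
      omega
  have h2 : x * (ϖ ^ val F x)⁻¹ ≠ 0 := mul_ne_zero hx (inv_ne_zero (zpow_ne_zero _ h0))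
  have h1 := (hw.algebraMap_eq_one_iff h2).2 (by
    rw [val_mul hx (inv_ne_zero (zpow_ne_zero _ h0)), val_inv, hv]; ring)
  rw [map_mul, map_inv₀, map_mul, map_inv₀, map_zpow₀, map_zpow₀] at h1
  exact (mul_inv_eq_one₀ (zpow_ne_zero _ (by simpa using h0))).1 h1

theorem uniformizer_lt_one (hw : IsExtendedValuation F w) {ϖ : F} (h0 : ϖ ≠ 0) (hϖ : val F ϖ = 1) : w (algebraMap F Ω ϖ) < 1 := by
  rw [hw.algebraMap_lt_one_iff, ← map_one (valuation F), ← val_lt_val_iff one_ne_zero h0, hϖ,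
    val_one]
  exact one_pos

end IsExtendedValuation

theorem uniformizer_mem {ϖ : F} (h0 : ϖ ≠ 0) (hϖ : val F ϖ = 1) : ϖ ∈ 𝒪[F] :=
  (mem_integer_iff_val h0).2 (by omega)

theorem maximalIdeal_eq_span {ϖ : F} (h0 : ϖ ≠ 0) (hϖ : val F ϖ = 1) :
    𝓂[F] = Ideal.span {⟨ϖ, uniformizer_mem h0 hϖ⟩} := by
  ext x
  rw [Ideal.mem_span_singleton, ← IsLocalRing.residue_eq_zero_iff, residue_eq_zero_iff_valuation]
  by_cases hx : x = 0
  · simp [hx]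
  have hx' : (x : F) ≠ 0 := by simpa using hx
  rw [← map_one (valuation F), ← val_lt_val_iff one_ne_zero hx', val_one]
  constructor
  · intro h
    have hy : (x : F) * ϖ⁻¹ ∈ 𝒪[F] := by
      rw [mem_integer_iff_val (mul_ne_zero hx' (inv_ne_zero h0)), val_mul hx' (inv_ne_zero h0),
        val_inv]
      omega
    refine ⟨⟨_, hy⟩, ?_⟩
    ext
    change (x : F) = ϖ * (x * ϖ⁻¹)
    field_simp
  · rintro ⟨y, rfl⟩
    have hy : (y : F) ≠ 0 := by
      intro h
      have hy0 : y = 0 := Subtype.ext h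
      exact hx (by rw [hy0, mul_zero])
    have := (mem_integer_iff_val hy).1 y.2
    change 0 < val F (ϖ * y)
    rw [val_mul h0 hy]
    omega

theorem IsExtendedValuation.mem_maximalIdeal_pow_iff (hw : IsExtendedValuation F w) {ϖ : F}
    (h0 : ϖ ≠ 0) (hϖ : val F ϖ = 1) (n : ℕ) (x : 𝒪[F]) :
    x ∈ 𝓂[F] ^ n ↔ w (algebraMap F Ω x) ≤ w (algebraMap F Ω ϖ) ^ n := by
  rw [maximalIdeal_eq_span h0 hϖ, Ideal.span_singleton_pow, Ideal.mem_span_singleton]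
  constructor
  · rintro ⟨y, rfl⟩
    have := (hw.algebraMap_le_one_iff y).2 y.2
    change w (algebraMap F Ω (ϖ ^ n * y)) ≤ _
    rw [map_mul, map_mul, map_pow, map_pow]
    exact mul_le_of_le_one_right' this
  · intro h
    have hy : (x : F) * (ϖ ^ n)⁻¹ ∈ 𝒪[F] := by
      rw [← hw.algebraMap_le_one_iff, map_mul, map_inv₀, map_mul, map_inv₀, map_pow, map_pow]
      exact mul_inv_le_one_of_le₀ h zero_le
    refine ⟨⟨_, hy⟩, ?_⟩
    ext
    change (x : F) = ϖ ^ n * (x * (ϖ ^ n)⁻¹)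
    field_simp

end LocalField

/-! ### Elements whose residue lies in the prime field. -/

section Reduction

variable {F : Type*} [Field F] [ValuativeRel F] [TopologicalSpace F]
  [IsNonarchimedeanLocalField F] {Ω : Type*} [Field Ω] [Algebra F Ω] {w : Valuation Ω ℝ≥0}
  {p : ℕ}

/-- The element `z` of `Ω` is integral and its residue is `s ∈ 𝔽_p`. -/
def Reduces (w : Valuation Ω ℝ≥0) (z : Ω) (s : ZMod p) : Prop := w (z - (s.val : Ω)) < 1

theorem IsExtendedValuation.intCast_le_one (w : Valuation Ω ℝ≥0) (n : ℤ) : w (n : Ω) ≤ 1 := by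
  have : (n : Ω) ∈ w.valuationSubring := intCast_mem _ n
  exact this

theorem IsExtendedValuation.natCast_le_one (w : Valuation Ω ℝ≥0) (n : ℕ) : w (n : Ω) ≤ 1 := by
  exact_mod_cast IsExtendedValuation.intCast_le_one w n

variable [CharP 𝓀[F] p]

theorem IsExtendedValuation.intCast_lt_one_iff (hw : IsExtendedValuation F w) (n : ℤ) :
    w (n : Ω) < 1 ↔ (p : ℤ) ∣ n := by
  have h := hw.residue_eq_zero_iff (n : 𝒪[F])
  rw [map_intCast, CharP.intCast_eq_zero_iff 𝓀[F] p] at h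
  rw [h]
  simp

theorem IsExtendedValuation.natCast_lt_one_iff (hw : IsExtendedValuation F w) (n : ℕ) :
    w (n : Ω) < 1 ↔ p ∣ n := by
  have := hw.intCast_lt_one_iff (p := p) (n : ℤ)
  rw [Int.natCast_dvd_natCast] at this
  exact_mod_cast this

theorem IsExtendedValuation.natCast_eq_one (hw : IsExtendedValuation F w) {n : ℕ} (hn : ¬ p ∣ n) :
    w (n : Ω) = 1 := by
  rw [← hw.natCast_lt_one_iff, not_lt] at hn
  exact le_antisymm (IsExtendedValuation.natCast_le_one w n) hn

variable [Fact p.Prime]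

/-- Integers congruent modulo p differ by an element of absolute value less than 1, so the
representative `s.val` used in the definition is immaterial. -/
theorem IsExtendedValuation.reduces_iff_int (hw : IsExtendedValuation F w) {z : Ω} {s : ZMod p}
    {n : ℤ} (hn : (n : ZMod p) = s) : Reduces w z s ↔ w (z - n) < 1 := by
  have h1 : w ((n : Ω) - (s.val : Ω)) < 1 := by
    have := (hw.intCast_lt_one_iff (p := p) (n - s.val)).2 (by
      rw [← ZMod.intCast_zmod_eq_zero_iff_dvd]; simp [hn])
    exact_mod_cast this
  unfold Reduces
  constructor
  · intro h
    have := w.map_sub_lt h h1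
    rwa [sub_sub_sub_cancel_right] at this
  · intro h
    have := w.map_add_lt h h1
    rwa [sub_add_sub_cancel] at this

theorem IsExtendedValuation.reduces_intCast (hw : IsExtendedValuation F w) (n : ℤ) :
    Reduces w (n : Ω) (n : ZMod p) := by
  rw [hw.reduces_iff_int rfl]
  simp

theorem IsExtendedValuation.reduces_natCast (hw : IsExtendedValuation F w) (n : ℕ) :
    Reduces w (n : Ω) (n : ZMod p) := by
  exact_mod_cast hw.reduces_intCast (p := p) n

theorem IsExtendedValuation.reduces_one (hw : IsExtendedValuation F w) :
    Reduces w (1 : Ω) (1 : ZMod p) := by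
  exact_mod_cast hw.reduces_natCast (p := p) 1

theorem IsExtendedValuation.reduces_one_iff (hw : IsExtendedValuation F w) {z : Ω} :
    Reduces w z (1 : ZMod p) ↔ w (z - 1) < 1 := by
  rw [hw.reduces_iff_int (n := 1) (by simp), Int.cast_one]

theorem IsExtendedValuation.reduces_zero_iff (hw : IsExtendedValuation F w) {z : Ω} :
    Reduces w z (0 : ZMod p) ↔ w z < 1 := by
  rw [hw.reduces_iff_int (n := 0) (by simp), Int.cast_zero, sub_zero]

theorem Reduces.le_one {z : Ω} {s : ZMod p} (h : Reduces w z s) : w z ≤ 1 := by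
  have := w.map_add_le h.le (IsExtendedValuation.natCast_le_one w s.val)
  rwa [sub_add_cancel] at this

theorem Reduces.unique (hw : IsExtendedValuation F w) {z : Ω} {s t : ZMod p}
    (h : Reduces w z s) (h' : Reduces w z t) : s = t := by
  have := w.map_sub_lt h' h
  rw [sub_sub_sub_cancel_left] at this
  have h2 := (hw.intCast_lt_one_iff (p := p) (s.val - t.val)).1 (by exact_mod_cast this)
  rw [← ZMod.intCast_zmod_eq_zero_iff_dvd] at h2
  simpa [sub_eq_zero] using h2

theorem Reduces.eq_one (hw : IsExtendedValuation F w) {z : Ω} {s : ZMod p}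
    (h : Reduces w z s) (hs : s ≠ 0) : w z = 1 := by
  refine le_antisymm h.le_one (not_lt.1 fun h1 => hs ?_)
  exact h.unique hw (hw.reduces_zero_iff.2 h1)

theorem Reduces.add (hw : IsExtendedValuation F w) {z z' : Ω} {s t : ZMod p}
    (h : Reduces w z s) (h' : Reduces w z' t) : Reduces w (z + z') (s + t) := by
  rw [hw.reduces_iff_int (n := s.val + t.val) (by simp)]
  have := w.map_add_lt h h'
  push_cast
  rwa [add_sub_add_comm]

theorem Reduces.neg (hw : IsExtendedValuation F w) {z : Ω} {s : ZMod p}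
    (h : Reduces w z s) : Reduces w (-z) (-s) := by
  rw [hw.reduces_iff_int (n := -(s.val : ℤ)) (by simp)]
  have : w (-(z - (s.val : Ω))) < 1 := by rw [w.map_neg]; exact h
  push_cast
  convert this using 2
  ring

theorem Reduces.sub (hw : IsExtendedValuation F w) {z z' : Ω} {s t : ZMod p}
    (h : Reduces w z s) (h' : Reduces w z' t) : Reduces w (z - z') (s - t) := by
  rw [sub_eq_add_neg, sub_eq_add_neg]
  exact h.add hw (h'.neg hw)

theorem Reduces.mul (hw : IsExtendedValuation F w) {z z' : Ω} {s t : ZMod p}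
    (h : Reduces w z s) (h' : Reduces w z' t) : Reduces w (z * z') (s * t) := by
  rw [hw.reduces_iff_int (n := s.val * t.val) (by simp)]
  have h1 : w (z * (z' - (t.val : Ω))) < 1 := by
    rw [map_mul]; exact mul_lt_one_of_nonneg_of_lt_one_right h.le_one zero_le h'
  have h2 : w ((z - (s.val : Ω)) * t.val) < 1 := by
    rw [map_mul]
    exact mul_lt_one_of_nonneg_of_lt_one_left zero_le h (IsExtendedValuation.natCast_le_one w _)
  have := w.map_add_lt h1 h2
  push_cast
  convert this using 2
  ring

theorem Reduces.pow (hw : IsExtendedValuation F w) {z : Ω} {s : ZMod p}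
    (h : Reduces w z s) (n : ℕ) : Reduces w (z ^ n) (s ^ n) := by
  induction n with
  | zero => simpa using hw.reduces_one (p := p)
  | succ n ih => rw [pow_succ, pow_succ]; exact ih.mul hw h

theorem Reduces.sum (hw : IsExtendedValuation F w) {ι : Type*} (S : Finset ι) {z : ι → Ω}
    {s : ι → ZMod p} (h : ∀ i ∈ S, Reduces w (z i) (s i)) :
    Reduces w (∑ i ∈ S, z i) (∑ i ∈ S, s i) := by
  classical
  induction S using Finset.induction_on with
  | empty => rw [Finset.sum_empty, Finset.sum_empty, hw.reduces_zero_iff]; simp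
  | insert a S ha ih =>
    rw [Finset.sum_insert ha, Finset.sum_insert ha]
    exact (h a (by simp)).add hw (ih fun i hi => h i (by simp [hi]))

theorem Reduces.prod (hw : IsExtendedValuation F w) {ι : Type*} (S : Finset ι) {z : ι → Ω}
    {s : ι → ZMod p} (h : ∀ i ∈ S, Reduces w (z i) (s i)) :
    Reduces w (∏ i ∈ S, z i) (∏ i ∈ S, s i) := by
  classical
  induction S using Finset.induction_on with
  | empty => rw [Finset.prod_empty, Finset.prod_empty]; exact hw.reduces_one
  | insert a S ha ih =>
    rw [Finset.prod_insert ha, Finset.prod_insert ha]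
    exact (h a (by simp)).mul hw (ih fun i hi => h i (by simp [hi]))

/-- The residue is witnessed by an integer, which every automorphism fixes, and `w` is invariant.
Hence Galois acts trivially on residues in 𝔽_p, which is what makes approximate computations of
characters possible. -/
theorem Reduces.map (hw : IsExtendedValuation F w) {z : Ω} {s : ZMod p} (h : Reduces w z s)
    (τ : Gal(Ω/F)) : Reduces w (τ z) s := by
  have := hw.map_algEquiv τ (z - (s.val : Ω))
  rw [map_sub, map_natCast] at this
  unfold Reduces
  rwa [this]

theorem IsExtendedValuation.residue_eq_cast_iff (hw : IsExtendedValuation F w) (x : 𝒪[F])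
    (s : ZMod p) : IsLocalRing.residue 𝒪[F] x = ZMod.castHom dvd_rfl 𝓀[F] s ↔
      Reduces w (algebraMap F Ω x) s := by
  have : ZMod.castHom dvd_rfl 𝓀[F] s = IsLocalRing.residue 𝒪[F] (s.val : 𝒪[F]) := by
    rw [map_natCast, ZMod.castHom_apply, ZMod.cast_eq_val]
  rw [this, hw.residue_eq_iff]
  unfold Reduces
  rw [SubringClass.coe_natCast, map_natCast]

/-- An element of `Ω` whose `(p-1)`-th power is a principal unit has its residue in `𝔽_pˣ`. -/
theorem IsExtendedValuation.exists_reduces (hw : IsExtendedValuation F w) {z : Ω}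
    (hz : w (z ^ (p - 1) - 1) < 1) : ∃ s : (ZMod p)ˣ, Reduces w z (s : ZMod p) := by
  have hp : p.Prime := Fact.out
  have hp1 : p - 1 ≠ 0 := by have := hp.two_le; omega
  have hz1 : w (z ^ (p - 1)) = 1 := by
    have := w.map_one_add_of_lt hz
    rwa [add_sub_cancel] at this
  have hz2 : w z = 1 := by
    rw [map_pow] at hz1
    exact (pow_eq_one_iff.1 hz1).resolve_right hp1
  let A := w.valuationSubring
  have hchar : CharP (IsLocalRing.ResidueField A) p := by
    refine ⟨fun n => ?_⟩
    rw [← map_natCast (IsLocalRing.residue A), IsLocalRing.residue_eq_zero_iff,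
      Valuation.mem_maximalIdeal_iff, ← hw.natCast_lt_one_iff (p := p)]
    rfl
  let y : A := ⟨z, hz2.le⟩
  have hy : IsLocalRing.residue A y ^ p = IsLocalRing.residue A y := by
    have h1 : IsLocalRing.residue A (y ^ (p - 1)) = IsLocalRing.residue A 1 := by
      rw [← sub_eq_zero, ← map_sub, IsLocalRing.residue_eq_zero_iff,
        Valuation.mem_maximalIdeal_iff]
      exact hz
    rw [map_pow, map_one] at h1
    conv_lhs => rw [show p = p - 1 + 1 by omega, pow_succ, h1, one_mul]
  -- In a field of characteristic p the solutions of y^p = y form the prime field.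
  rw [← Subfield.mem_bot_iff_pow_eq_self, mem_bot_iff_intCast p] at hy
  obtain ⟨n, hn⟩ := hy
  have hzn : w (z - n) < 1 := by
    rw [← map_intCast (IsLocalRing.residue A), eq_comm, ← sub_eq_zero, ← map_sub,
      IsLocalRing.residue_eq_zero_iff, Valuation.mem_maximalIdeal_iff] at hn
    exact_mod_cast hn
  have hred : Reduces w z (n : ZMod p) := (hw.reduces_iff_int rfl).2 hzn
  have hn0 : (n : ZMod p) ≠ 0 := by
    intro h
    rw [h, hw.reduces_zero_iff, hz2] at hred
    exact lt_irrefl _ hred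
  exact ⟨Units.mk0 _ hn0, hred⟩

/-- The geometric sum 1 + z + ... + z^(p-2) reduces to p - 1 = -1, so it is nonzero; its product
with z - 1 vanishes. A (p-1)-th root of unity is therefore determined by its residue. -/
theorem IsExtendedValuation.eq_one_of_pow_eq_one (hw : IsExtendedValuation F w) {z : Ω}
    (hz : w (z - 1) < 1) (h : z ^ (p - 1) = 1) : z = 1 := by
  have hp : p.Prime := Fact.out
  have hz' : Reduces w z (1 : ZMod p) := hw.reduces_one_iff.2 hz
  have h1 : Reduces w (∑ i ∈ Finset.range (p - 1), z ^ i) (-1 : ZMod p) := by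
    have := Reduces.sum (s := fun _ => (1 : ZMod p)) hw (Finset.range (p - 1))
      (fun i _ => by simpa using hz'.pow hw i)
    simpa [Nat.cast_sub hp.one_le] using this
  have h2 : (∑ i ∈ Finset.range (p - 1), z ^ i) ≠ 0 := by
    intro h0
    have := h1.eq_one hw (by simp)
    rw [h0] at this
    simp at this
  have h3 := geom_sum_mul z (p - 1)
  rw [h, sub_self] at h3
  simpa [h2, sub_eq_zero] using h3

end Reduction

/-! ### Hensel's lemma and Teichmüller representatives. -/

section Hensel

variable {F : Type*} [Field F] [ValuativeRel F] [TopologicalSpace F]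
  [IsNonarchimedeanLocalField F] {p : ℕ} [CharP 𝓀[F] p] [Fact p.Prime]

theorem natCast_pred_isUnit : IsUnit ((p - 1 : ℕ) : 𝒪[F]) := by
  have hp : p.Prime := Fact.out
  rw [← IsLocalRing.residue_ne_zero_iff_isUnit, map_natCast]
  rw [Ne, CharP.cast_eq_zero_iff 𝓀[F] p]
  intro h
  have := Nat.le_of_dvd (by have := hp.two_le; omega) h
  have := hp.two_le
  omega

/-- Hensel's lemma for `(p-1)`-th roots of units. -/
theorem exists_pow_eq_of_residue {u a : 𝒪[F]} (hu : IsUnit u)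
    (h : IsLocalRing.residue 𝒪[F] a ^ (p - 1) = IsLocalRing.residue 𝒪[F] u) :
    ∃ z : 𝒪[F], z ^ (p - 1) = u ∧ IsLocalRing.residue 𝒪[F] z = IsLocalRing.residue 𝒪[F] a := by
  have hp : p.Prime := Fact.out
  have hp1 : p - 1 ≠ 0 := by have := hp.two_le; omega
  let := IsTopologicalAddGroup.rightUniformSpace F
  have := isUniformAddGroup_of_addCommGroup (G := F)
  have hens := IsAdicComplete.henselianRing 𝒪[F] 𝓂[F]
  have ha : IsUnit a := by
    rw [← IsLocalRing.residue_ne_zero_iff_isUnit]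
    intro h0
    rw [h0, zero_pow hp1, eq_comm, ← not_ne_iff, IsLocalRing.residue_ne_zero_iff_isUnit] at h
    exact h hu
  obtain ⟨z, hz, hza⟩ := hens.is_henselian (Polynomial.X ^ (p - 1) - Polynomial.C u)
    (Polynomial.monic_X_pow_sub_C u hp1) a (by
      rw [← IsLocalRing.residue_eq_zero_iff]
      simp [h]) (by
      refine IsUnit.map _ ?_
      simp only [Polynomial.derivative_sub, Polynomial.derivative_X_pow, Polynomial.derivative_C,
        sub_zero, Polynomial.eval_mul, Polynomial.eval_pow, Polynomial.eval_X, Polynomial.eval_C]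
      exact (natCast_pred_isUnit).mul (ha.pow _))
  refine ⟨z, ?_, ?_⟩
  · simpa [Polynomial.IsRoot, sub_eq_zero] using hz
  · rw [← sub_eq_zero, ← map_sub, IsLocalRing.residue_eq_zero_iff]
    exact hza

/-- Teichmüller representatives: s^(p-1) = 1 in 𝔽_p, and Hensel's lemma lifts this solution to 𝒪[F].
-/
theorem exists_rootOfUnity_reduces {Ω : Type*} [Field Ω] [Algebra F Ω] {w : Valuation Ω ℝ≥0}
    (hw : IsExtendedValuation F w) (s : (ZMod p)ˣ) :
    ∃ z : 𝒪[F], z ^ (p - 1) = 1 ∧ Reduces w (algebraMap F Ω z) (s : ZMod p) := by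
  obtain ⟨z, hz, hz'⟩ := exists_pow_eq_of_residue (p := p) (u := (1 : 𝒪[F]))
    (a := ((s : ZMod p).val : 𝒪[F])) isUnit_one (by
      have : IsLocalRing.residue 𝒪[F] ((s : ZMod p).val : 𝒪[F]) =
          ZMod.castHom dvd_rfl 𝓀[F] (s : ZMod p) := by
        rw [map_natCast, ZMod.castHom_apply, ZMod.cast_eq_val]
      rw [this, ← map_pow, ← Units.val_pow_eq_pow_val, ZMod.units_pow_card_sub_one_eq_one]
      simp)
  refine ⟨z, hz, ?_⟩
  rw [← hw.residue_eq_cast_iff, hz', map_natCast, ZMod.castHom_apply, ZMod.cast_eq_val]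

/-- The `(p-1)`-th roots of unity lie in `F`. -/
theorem IsExtendedValuation.exists_algebraMap_eq {Ω : Type*} [Field Ω] [Algebra F Ω]
    {w : Valuation Ω ℝ≥0} (hw : IsExtendedValuation F w) {ζ : Ω} (hζ : ζ ^ (p - 1) = 1) :
    ∃ (z : 𝒪[F]) (s : (ZMod p)ˣ), algebraMap F Ω z = ζ ∧ z ^ (p - 1) = 1 ∧
      Reduces w (algebraMap F Ω z) (s : ZMod p) := by
  obtain ⟨s, hs⟩ := hw.exists_reduces (p := p) (z := ζ) (by rw [hζ]; simp)
  obtain ⟨z, hz, hzs⟩ := exists_rootOfUnity_reduces hw s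
  refine ⟨z, s, ?_, hz, hzs⟩
  have h1 := hzs.eq_one hw s.ne_zero
  have h0 : algebraMap F Ω z ≠ 0 := by
    intro h; rw [h] at h1; simp at h1
  have h2 : ζ / algebraMap F Ω z = 1 := by
    refine hw.eq_one_of_pow_eq_one (p := p) ?_ ?_
    · rw [div_sub_one h0, map_div₀, h1, div_one, ← hw.reduces_zero_iff (p := p), ← sub_self (s : ZMod p)]
      exact hs.sub hw hzs
    · rw [div_pow, hζ, ← map_pow, ← SubmonoidClass.coe_pow, hz]
      simp
  rw [div_eq_one_iff_eq h0] at h2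
  exact h2.symm

end Hensel

/-! ### Inverses and quotients of residues. -/

section ReductionExtra

variable {F : Type*} [Field F] [ValuativeRel F] [TopologicalSpace F]
  [IsNonarchimedeanLocalField F] {Ω : Type*} [Field Ω] [Algebra F Ω] {w : Valuation Ω ℝ≥0}
  {p : ℕ} [CharP 𝓀[F] p] [Fact p.Prime]

theorem Reduces.ne_zero (hw : IsExtendedValuation F w) {z : Ω} {s : ZMod p}
    (h : Reduces w z s) (hs : s ≠ 0) : z ≠ 0 := by
  rintro rfl
  have := h.eq_one hw hs
  simp at this

theorem Reduces.inv (hw : IsExtendedValuation F w) {z : Ω} {s : ZMod p}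
    (h : Reduces w z s) (hs : s ≠ 0) : Reduces w z⁻¹ s⁻¹ := by
  have hz := h.ne_zero hw hs
  have h1 : Reduces w (z * (s⁻¹.val : Ω)) (1 : ZMod p) := by
    have := h.mul hw (hw.reduces_natCast (p := p) s⁻¹.val)
    rwa [ZMod.natCast_zmod_val, mul_inv_cancel₀ hs] at this
  rw [hw.reduces_one_iff] at h1
  have h2 : z⁻¹ - (s⁻¹.val : Ω) = z⁻¹ * (1 - z * (s⁻¹.val : Ω)) := by
    field_simp
  unfold Reduces
  rwa [h2, map_mul, map_inv₀, h.eq_one hw hs, inv_one, one_mul, w.map_sub_swap]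

theorem Reduces.div (hw : IsExtendedValuation F w) {z z' : Ω} {s t : ZMod p}
    (h : Reduces w z s) (h' : Reduces w z' t) (ht : t ≠ 0) : Reduces w (z / z') (s / t) := by
  rw [div_eq_mul_inv, div_eq_mul_inv]
  exact h.mul hw (h'.inv hw ht)

theorem Reduces.map_div_self (hw : IsExtendedValuation F w) {z : Ω} {s : ZMod p}
    (h : Reduces w z s) (hs : s ≠ 0) (τ : Gal(Ω/F)) : Reduces w (τ z / z) (1 : ZMod p) := by
  have := (h.map hw τ).div hw h hs
  rwa [div_self hs] at this

end ReductionExtra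

/-! ### The field K is finite Galois of degree prime to p. -/

section KummerField

variable {F : Type*} [Field F] {Ω : Type*} [Field Ω] [Algebra F Ω] [IsAlgClosure F Ω] {p : ℕ}

instance : Normal F (kummerField F Ω p) := by
  have : Normal F Ω := IsAlgClosure.normal F Ω
  rw [IntermediateField.normal_iff_forall_map_le']
  intro σ
  unfold kummerField
  rw [IntermediateField.adjoin_map, IntermediateField.adjoin_le_iff]
  rintro _ ⟨x, ⟨a, ha, hx⟩, rfl⟩
  refine IntermediateField.subset_adjoin _ _ ⟨a, ha, ?_⟩
  change (σ x) ^ (p - 1) = _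
  rw [← map_pow, hx, AlgEquiv.commutes]

theorem exists_kummerField_root [Fact p.Prime] {a : F} (ha : a ≠ 0) :
    ∃ α : kummerField F Ω p, α ≠ 0 ∧ α ^ (p - 1) = algebraMap F (kummerField F Ω p) a := by
  have hp : p.Prime := Fact.out
  have : IsAlgClosed Ω := IsAlgClosure.isAlgClosed F
  have hp1 : 0 < p - 1 := by have := hp.two_le; omega
  obtain ⟨x, hx⟩ := IsAlgClosed.exists_pow_nat_eq (algebraMap F Ω a) hp1
  refine ⟨⟨x, IntermediateField.subset_adjoin _ _ ⟨a, ha, hx⟩⟩, ?_, ?_⟩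
  · intro h
    have hx0 : x = 0 := congrArg Subtype.val h
    rw [hx0, zero_pow hp1.ne', eq_comm, map_eq_zero] at hx
    exact ha hx
  · ext
    exact hx

theorem mem_kummerField {a : F} (ha : a ≠ 0) {x : Ω} (hx : x ^ (p - 1) = algebraMap F Ω a) :
    x ∈ kummerField F Ω p :=
  IntermediateField.subset_adjoin _ _ ⟨a, ha, hx⟩

variable [ValuativeRel F] [TopologicalSpace F] [IsNonarchimedeanLocalField F] [CharP 𝓀[F] p]
  [Fact p.Prime]

theorem natCast_pred_ne_zero : ((p - 1 : ℕ) : F) ≠ 0 := by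
  have := (natCast_pred_isUnit (F := F) (p := p)).ne_zero
  intro h
  apply this
  ext
  simpa using h

instance : Algebra.IsSeparable F (kummerField F Ω p) := by
  have : Algebra.IsAlgebraic F Ω := IsAlgClosure.isAlgebraic
  unfold kummerField
  rw [IntermediateField.isSeparable_adjoin_iff_isSeparable]
  rintro x ⟨a, ha, hx⟩
  refine Polynomial.Separable.of_dvd
    (Polynomial.separable_X_pow_sub_C a (natCast_pred_ne_zero (F := F) (p := p)) ha) ?_
  apply minpoly.dvd
  simp [hx]

instance : IsGalois F (kummerField F Ω p) where

/-- The classes of `Fˣ` modulo `(p-1)`-th powers are finite in number. -/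
theorem exists_finite_representatives (F : Type*) [Field F] [ValuativeRel F] [TopologicalSpace F]
    [IsNonarchimedeanLocalField F] (p : ℕ) [CharP 𝓀[F] p] [Fact p.Prime] :
    ∃ T : Set F, T.Finite ∧ ∀ a : F, a ≠ 0 → ∃ t ∈ T, ∃ c : F, t ≠ 0 ∧ c ≠ 0 ∧ a = t * c ^ (p - 1) := by
  have hp : p.Prime := Fact.out
  have hp1 : 0 < p - 1 := by have := hp.two_le; omega
  obtain ⟨ϖ, h0, hϖ⟩ := exists_val_eq_one F
  obtain ⟨g, hg⟩ := (IsLocalRing.residue_surjective (R := 𝒪[F])).hasRightInverse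
  refine ⟨Set.range fun x : Fin (p - 1) × 𝓀[F] => ϖ ^ (x.1 : ℕ) * (g x.2 : F),
    Set.finite_range _, fun a ha => ?_⟩
  set n := val F a with hn
  have hv (n : ℤ) : val F (ϖ ^ n) = n := by
    rcases n with n | n
    · simp [val_pow, hϖ]
    · simp [val_inv, val_pow, hϖ]
      omega
  have hu0 : a * (ϖ ^ n)⁻¹ ≠ 0 := mul_ne_zero ha (inv_ne_zero (zpow_ne_zero _ h0))
  have huv : val F (a * (ϖ ^ n)⁻¹) = 0 := by
    rw [val_mul ha (inv_ne_zero (zpow_ne_zero _ h0)), val_inv, hv]; omega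
  let u : 𝒪[F] := ⟨a * (ϖ ^ n)⁻¹, (mem_integer_iff_val hu0).2 huv.ge⟩
  have hur : IsLocalRing.residue 𝒪[F] u ≠ 0 := by
    rw [Ne, residue_eq_zero_iff_valuation, ← map_one (valuation F),
      ← val_lt_val_iff one_ne_zero hu0, val_one, huv]
    exact lt_irrefl _
  have huu := (IsLocalRing.residue_ne_zero_iff_isUnit u).1 hur
  set u0 := g (IsLocalRing.residue 𝒪[F] u) with hu0def
  have hgu : IsLocalRing.residue 𝒪[F] u0 = IsLocalRing.residue 𝒪[F] u := hg _
  have hu0u : IsUnit u0 := (IsLocalRing.residue_ne_zero_iff_isUnit _).1 (by rw [hgu]; exact hur)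
  obtain ⟨u0', hu0'⟩ := hu0u
  -- The quotient of u by the chosen unit with the same residue has residue 1, hence is a (p-1)-th
  -- power.
  obtain ⟨z, hz, hz1⟩ := exists_pow_eq_of_residue (p := p) (u := u * ↑(u0'⁻¹)) (a := 1)
    (huu.mul (Units.isUnit _)) (by
      have : IsLocalRing.residue 𝒪[F] (↑u0' * ↑u0'⁻¹) = 1 := by simp
      rw [map_mul, hu0', hgu] at this
      rw [map_mul, map_one, one_pow, this])
  have hz0 : (z : F) ≠ 0 := by
    intro h
    have : z = 0 := Subtype.ext h
    rw [this, map_zero, map_one] at hz1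
    exact zero_ne_one hz1
  have hp1' : ((p - 1 : ℕ) : ℤ) ≠ 0 := by exact_mod_cast hp1.ne'
  have hmod := Int.emod_nonneg n hp1'
  have hlt := Int.emod_lt_of_pos n (b := ((p - 1 : ℕ) : ℤ)) (by exact_mod_cast hp1)
  refine ⟨_, ⟨(⟨(n % ((p - 1 : ℕ) : ℤ)).toNat, by omega⟩, IsLocalRing.residue 𝒪[F] u), rfl⟩,
    ϖ ^ (n / ((p - 1 : ℕ) : ℤ)) * z, ?_, mul_ne_zero (zpow_ne_zero _ h0) hz0, ?_⟩
  · refine mul_ne_zero (pow_ne_zero _ h0) ?_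
    change ((g (IsLocalRing.residue 𝒪[F] u) : 𝒪[F]) : F) ≠ 0
    rw [← hu0def, ← hu0']
    simp
  · change a = ϖ ^ (n % ((p - 1 : ℕ) : ℤ)).toNat * ((g (IsLocalRing.residue 𝒪[F] u) : 𝒪[F]) : F) *
      (ϖ ^ (n / ((p - 1 : ℕ) : ℤ)) * z) ^ (p - 1)
    rw [← hu0def, ← hu0', mul_pow]
    have hz2 : (z : F) ^ (p - 1) = a * (ϖ ^ n)⁻¹ * ((u0'⁻¹ : (𝒪[F])ˣ) : 𝒪[F]) := by
      have := congrArg (fun x : 𝒪[F] => (x : F)) hz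
      simpa [u] using this
    have hu1 : ((u0' : 𝒪[F]) : F) * (((u0'⁻¹ : (𝒪[F])ˣ) : 𝒪[F]) : F) = 1 := by
      exact congrArg Subtype.val u0'.mul_inv
    have hϖn : ϖ ^ (n % ((p - 1 : ℕ) : ℤ)).toNat * (ϖ ^ (n / ((p - 1 : ℕ) : ℤ))) ^ (p - 1) =
        ϖ ^ n := by
      rw [← zpow_natCast, Int.toNat_of_nonneg hmod, ← zpow_natCast, ← zpow_mul, ← zpow_add₀ h0,
        mul_comm, Int.emod_add_mul_ediv]
    rw [hz2]
    have h3 : ϖ ^ n ≠ 0 := zpow_ne_zero _ h0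
    calc a = (ϖ ^ n) * (((u0' : 𝒪[F]) : F) * (((u0'⁻¹ : (𝒪[F])ˣ) : 𝒪[F]) : F)) *
          (a * (ϖ ^ n)⁻¹) := by rw [hu1]; field_simp
      _ = _ := by rw [← hϖn]; ring

/-- Up to a factor in F, every generator is a (p-1)-th root of one of the finitely many class
representatives, so finitely many integral elements generate K. -/
theorem finiteDimensional_kummerField : FiniteDimensional F (kummerField F Ω p) := by
  have hp : p.Prime := Fact.out
  have hp1 : 0 < p - 1 := by have := hp.two_le; omega
  have : Algebra.IsAlgebraic F Ω := IsAlgClosure.isAlgebraic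
  classical
  obtain ⟨T, hT, hTa⟩ := exists_finite_representatives F p
  let S : Set Ω := ⋃ t ∈ T, ((Polynomial.nthRoots (p - 1) (algebraMap F Ω t)).toFinset : Set Ω)
  have hS : S.Finite := hT.biUnion fun t _ => Finset.finite_toSet _
  have : Finite S := hS
  have hle : kummerField F Ω p ≤ IntermediateField.adjoin F S := by
    unfold kummerField
    rw [IntermediateField.adjoin_le_iff]
    rintro x ⟨a, ha, hx⟩
    obtain ⟨t, ht, c, ht0, hc, rfl⟩ := hTa a ha
    have hc' : algebraMap F Ω c ≠ 0 := by simpa using hc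
    have h1 : x / algebraMap F Ω c ∈ IntermediateField.adjoin F S := by
      refine IntermediateField.subset_adjoin _ _ (Set.mem_biUnion ht ?_)
      rw [Finset.mem_coe, Multiset.mem_toFinset, Polynomial.mem_nthRoots hp1, div_pow, hx, map_mul,
        map_pow]
      field_simp
    have h2 := mul_mem h1 ((IntermediateField.adjoin F S).algebraMap_mem c)
    rwa [div_mul_cancel₀ _ hc'] at h2
  have := IntermediateField.finiteDimensional_adjoin (K := F) (S := S)
    fun x _ => Algebra.IsIntegral.isIntegral x
  exact FiniteDimensional.of_injective (IntermediateField.inclusion hle).toLinearMap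
    (IntermediateField.inclusion hle).injective

/-- A lift of σ multiplies each generator by a (p-1)-th root of unity. That root of unity lies in F
and is itself fixed, so p - 1 iterations give the identity. -/
theorem pow_eq_one_of_kummerField (σ : Gal(kummerField F Ω p/F)) : σ ^ (p - 1) = 1 := by
  have : Algebra.IsAlgebraic F Ω := IsAlgClosure.isAlgebraic
  have : Normal F Ω := IsAlgClosure.normal F Ω
  obtain ⟨w, hw⟩ := exists_isExtendedValuation F Ω
  set τ := (σ.liftNormal Ω) with hτ
  have key : ∀ x ∈ kummerField F Ω p, (τ ^ (p - 1)) x = x := by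
    have hle : kummerField F Ω p ≤ IntermediateField.fixedField (Subgroup.zpowers (τ ^ (p - 1))) := by
      unfold kummerField
      rw [IntermediateField.adjoin_le_iff]
      rintro x ⟨a, ha, hx⟩
      have hx0 : x ≠ 0 := by
        rintro rfl
        rw [zero_pow (by have := (Fact.out : p.Prime).two_le; omega), eq_comm, map_eq_zero] at hx
        exact ha hx
      obtain ⟨z, s, hz, hz1, -⟩ := hw.exists_algebraMap_eq (p := p) (ζ := τ x / x) (by
        rw [div_pow, ← map_pow, hx, AlgEquiv.commutes, div_self (by simpa using ha)])
      rw [eq_div_iff hx0] at hz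
      have hpow (n : ℕ) : (τ ^ n) x = algebraMap F Ω z ^ n * x := by
        induction n with
        | zero => simp
        | succ n ih =>
          rw [pow_succ, AlgEquiv.mul_apply, ← hz, map_mul, AlgEquiv.commutes, ih]
          ring
      have hfix : (τ ^ (p - 1)) x = x := by
        rw [hpow, ← map_pow, ← SubmonoidClass.coe_pow, hz1]
        simp
      rintro ⟨g, hg⟩
      have : τ ^ (p - 1) ∈ MulAction.stabilizer Gal(Ω/F) x := hfix
      exact (Subgroup.zpowers_le.2 this) hg
    intro x hx
    exact hle hx ⟨_, Subgroup.mem_zpowers _⟩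
  ext x
  have h1 := key x x.2
  have h2 : (AlgEquiv.restrictNormalHom (kummerField F Ω p) τ) = σ :=
    AlgEquiv.restrict_liftNormal Ω σ
  have h3 := AlgEquiv.restrictNormal_commutes (τ ^ (p - 1)) (kummerField F Ω p) x
  have h4 : (τ ^ (p - 1)).restrictNormal (kummerField F Ω p) = σ ^ (p - 1) := by
    rw [← h2, ← map_pow]; rfl
  rw [h4] at h3
  exact h3.trans h1

/-- By Cauchy's theorem p would otherwise be the order of an automorphism, contradicting the
exponent p - 1. Consequently no element of degree p over F lies in K. -/
theorem not_dvd_finrank_kummerField : ¬ p ∣ finrank F (kummerField F Ω p) := by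
  have hp : p.Prime := Fact.out
  have := finiteDimensional_kummerField (F := F) (Ω := Ω) (p := p)
  rw [← IsGalois.card_aut_eq_finrank]
  intro h
  obtain ⟨σ, hσ⟩ := exists_prime_orderOf_dvd_card' p h
  have h1 := orderOf_dvd_of_pow_eq_one (pow_eq_one_of_kummerField σ)
  rw [hσ] at h1
  have := Nat.le_of_dvd (by have := hp.two_le; omega) h1
  have := hp.two_le
  omega

end KummerField

/-! ### The perfect pairing between Gal(K|F) and the classes modulo (p-1)-th powers. -/

section KummerPairing

variable {F : Type*} [Field F] [ValuativeRel F] [TopologicalSpace F]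
  [IsNonarchimedeanLocalField F] {Ω : Type*} [Field Ω] [Algebra F Ω] [IsAlgClosure F Ω]
  {w : Valuation Ω ℝ≥0} {p : ℕ} [CharP 𝓀[F] p] [Fact p.Prime]

/-- Restriction of automorphisms from `Ω` to the Kummer field. -/
noncomputable def resK (F Ω : Type*) [Field F] [Field Ω] [Algebra F Ω] [IsAlgClosure F Ω] (p : ℕ) :
    Gal(Ω/F) →* Gal(kummerField F Ω p/F) :=
  AlgEquiv.restrictNormalHom (kummerField F Ω p)

theorem resK_apply (τ : Gal(Ω/F)) (x : kummerField F Ω p) :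
    ((resK F Ω p τ x : kummerField F Ω p) : Ω) = τ x :=
  AlgEquiv.restrictNormal_commutes τ (kummerField F Ω p) x

theorem resK_surjective : Function.Surjective (resK F Ω p) := by
  have : Normal F Ω := IsAlgClosure.normal F Ω
  exact fun σ => ⟨σ.liftNormal Ω, AlgEquiv.restrict_liftNormal Ω σ⟩

theorem ne_zero_of_pow_eq {a : F} (ha : a ≠ 0) {x : Ω} (hx : x ^ (p - 1) = algebraMap F Ω a) :
    x ≠ 0 := by
  have hp : p.Prime := Fact.out
  rintro rfl
  rw [zero_pow (by have := hp.two_le; omega), eq_comm, map_eq_zero] at hx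
  exact ha hx

/-- The quotient τ(x)/x is a (p-1)-th root of unity, hence lies in F and is determined by its
residue. In this form duality is expressed by approximations in Ω. -/
theorem IsExtendedValuation.kummerDual_iff (hw : IsExtendedValuation F w)
    (χ : Character F Ω p) (a : Fˣ) :
    KummerDual χ a ↔ ∀ (τ : Gal(Ω/F)) (x : Ω), x ^ (p - 1) = algebraMap F Ω a →
      Reduces w (τ x / x) (χ (resK F Ω p τ) : ZMod p) := by
  constructor
  · intro h τ x hx
    have hx0 := ne_zero_of_pow_eq a.ne_zero hx
    let α : kummerField F Ω p := ⟨x, mem_kummerField a.ne_zero hx⟩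
    obtain ⟨ζ, hζ, hζ'⟩ := h (resK F Ω p τ) α (by ext; exact hx)
    rw [hw.residue_eq_cast_iff] at hζ'
    have h1 : τ x = algebraMap F Ω ζ * x := by
      rw [← show ((resK F Ω p τ α : kummerField F Ω p) : Ω) = τ x from resK_apply τ α, hζ]
      rfl
    rwa [h1, mul_div_cancel_right₀ _ hx0]
  · intro h σ α hα
    obtain ⟨τ, rfl⟩ := resK_surjective σ
    have hx : (α : Ω) ^ (p - 1) = algebraMap F Ω a := congrArg Subtype.val hα
    have hx0 := ne_zero_of_pow_eq a.ne_zero hx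
    obtain ⟨z, s, hz, hz1, hzs⟩ := hw.exists_algebraMap_eq (p := p) (ζ := τ α / α) (by
      rw [div_pow, ← map_pow, hx, AlgEquiv.commutes, div_self (by simp)])
    refine ⟨z, ?_, ?_⟩
    · ext
      rw [resK_apply]
      change τ α = algebraMap F Ω z * α
      rw [hz, div_mul_cancel₀ _ hx0]
    · rw [hw.residue_eq_cast_iff, hz]
      exact h τ α hx

/-- It is enough that x^(p-1) approximates b. If α is a true root, x/α has a residue in 𝔽_pˣ, which
Galois fixes, so x and α are multiplied by the same residue. Differences of conjugate roots, and 1 -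
ζ, are only such approximate roots. -/
theorem IsExtendedValuation.reduces_of_kummerDual (hw : IsExtendedValuation F w)
    {χ : Character F Ω p} {b : Fˣ} (h : KummerDual χ b) {x : Ω}
    (hx : w (x ^ (p - 1) - algebraMap F Ω b) < w (algebraMap F Ω b)) (τ : Gal(Ω/F)) :
    Reduces w (τ x / x) (χ (resK F Ω p τ) : ZMod p) := by
  obtain ⟨α, hα0, hα⟩ := exists_kummerField_root (Ω := Ω) (p := p) b.ne_zero
  have hα' : (α : Ω) ^ (p - 1) = algebraMap F Ω b := congrArg Subtype.val hα
  have hα0' : (α : Ω) ≠ 0 := by simpa using hα0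
  have hb : algebraMap F Ω b ≠ 0 := by simp
  obtain ⟨s, hs⟩ := hw.exists_reduces (p := p) (z := x / α) (by
    rw [div_pow, hα', div_sub_one hb, map_div₀]
    exact (div_lt_one₀ (by simp [zero_lt_iff])).2 hx)
  have hx0 : x ≠ 0 := by
    rintro rfl
    exact hs.ne_zero hw s.ne_zero (by simp)
  have h1 := hs.map_div_self hw s.ne_zero τ
  have h2 := (hw.kummerDual_iff χ b).1 h τ α hα'
  have h3 := h1.mul hw h2
  rw [one_mul] at h3
  convert h3 using 1
  rw [map_div₀]
  have : τ α ≠ 0 := by simpa using hα0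
  field_simp

/-- The residue of σ(α)/α is multiplicative in σ because the roots of unity involved lie in F and
are fixed. Another choice of α differs by such a root of unity and gives the same residues. -/
theorem exists_kummerDual (Ω : Type*) [Field Ω] [Algebra F Ω] [IsAlgClosure F Ω] (b : Fˣ) :
    ∃ χ : Character F Ω p, KummerDual χ b := by
  have : Algebra.IsAlgebraic F Ω := IsAlgClosure.isAlgebraic
  obtain ⟨w, hw⟩ := exists_isExtendedValuation F Ω
  obtain ⟨α, hα0, hα⟩ := exists_kummerField_root (Ω := Ω) (p := p) b.ne_zero
  have hα' : (α : Ω) ^ (p - 1) = algebraMap F Ω b := congrArg Subtype.val hα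
  have key (σ : Gal(kummerField F Ω p/F)) : ∃ (z : 𝒪[F]) (s : (ZMod p)ˣ),
      σ α = algebraMap F (kummerField F Ω p) z * α ∧
      Reduces w (algebraMap F Ω z) (s : ZMod p) := by
    obtain ⟨z, s, hz, hz1, hzs⟩ := hw.exists_algebraMap_eq (p := p) (ζ := ((σ α / α :) : Ω)) (by
      have : (σ α / α) ^ (p - 1) = 1 := by
        rw [div_pow, ← map_pow, hα, AlgEquiv.commutes, div_self (by simp)]
      exact_mod_cast congrArg Subtype.val this)
    refine ⟨z, s, ?_, hzs⟩
    have h1 : algebraMap F (kummerField F Ω p) z = σ α / α := by ext; exact hz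
    rw [h1, div_mul_cancel₀ _ hα0]
  choose z s hz hs using key
  have hval (σ : Gal(kummerField F Ω p/F)) (x : Ω) :
      x * α = (σ α : kummerField F Ω p) → x = algebraMap F Ω (z σ) := by
    intro h
    rw [hz] at h
    exact mul_right_cancel₀ (by simpa using hα0) h
  let χ : Character F Ω p :=
    MonoidHom.mk' s fun σ τ => by
      ext
      refine (hs (σ * τ)).unique hw ?_
      have := (hs σ).mul hw (hs τ)
      rw [Units.val_mul]
      convert this
      symm
      apply hval
      rw [AlgEquiv.mul_apply, hz τ, map_mul, AlgEquiv.commutes, hz σ]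
      change _ = algebraMap F Ω (z τ) * (algebraMap F Ω (z σ) * α)
      ring
  refine ⟨χ, (hw.kummerDual_iff χ b).2 fun τ x hx => ?_⟩
  have hx0 := ne_zero_of_pow_eq b.ne_zero hx
  have hα0' : (α : Ω) ≠ 0 := by simpa using hα0
  obtain ⟨z', s', hz', -, hzs'⟩ := hw.exists_algebraMap_eq (p := p) (ζ := x / α) (by
    rw [div_pow, hx, hα', div_self (by simp)])
  rw [eq_div_iff hα0'] at hz'
  have h1 : τ x / x = algebraMap F Ω (z (resK F Ω p τ)) := by
    apply hval
    rw [resK_apply, ← hz', map_mul, AlgEquiv.commutes]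
    have : algebraMap F Ω z' ≠ 0 := hzs'.ne_zero hw s'.ne_zero
    field_simp
  rw [h1]
  exact hs _

theorem kummerDual_unique {χ χ' : Character F Ω p} {b : Fˣ} (h : KummerDual χ b)
    (h' : KummerDual χ' b) : χ = χ' := by
  have : Algebra.IsAlgebraic F Ω := IsAlgClosure.isAlgebraic
  obtain ⟨w, hw⟩ := exists_isExtendedValuation F Ω
  obtain ⟨α, hα0, hα⟩ := exists_kummerField_root (Ω := Ω) (p := p) b.ne_zero
  have hα' : (α : Ω) ^ (p - 1) = algebraMap F Ω b := congrArg Subtype.val hα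
  ext σ
  obtain ⟨τ, rfl⟩ := resK_surjective σ
  exact ((hw.kummerDual_iff χ b).1 h τ α hα').unique hw ((hw.kummerDual_iff χ' b).1 h' τ α hα')

theorem IsExtendedValuation.kummerDual_of_reduces (hw : IsExtendedValuation F w)
    {χ : Character F Ω p} {b : Fˣ} {x : Ω}
    (hx : w (x ^ (p - 1) - algebraMap F Ω b) < w (algebraMap F Ω b))
    (h : ∀ τ : Gal(Ω/F), Reduces w (τ x / x) (χ (resK F Ω p τ) : ZMod p)) : KummerDual χ b := by
  obtain ⟨χ', h'⟩ := exists_kummerDual (p := p) Ω b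
  have : χ = χ' := by
    ext σ
    obtain ⟨τ, rfl⟩ := resK_surjective σ
    exact (h τ).unique hw (hw.reduces_of_kummerDual h' hx τ)
  rwa [this]

theorem IsExtendedValuation.kummerDual_of_pow_eq (hw : IsExtendedValuation F w)
    {χ : Character F Ω p} {b : Fˣ} {x : Ω} (hx : x ^ (p - 1) = algebraMap F Ω b)
    (h : ∀ τ : Gal(Ω/F), Reduces w (τ x / x) (χ (resK F Ω p τ) : ZMod p)) : KummerDual χ b :=
  hw.kummerDual_of_reduces (by rw [hx]; simp [zero_lt_iff]) h

theorem KummerDual.mul {χ χ' : Character F Ω p} {b b' : Fˣ} (h : KummerDual χ b)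
    (h' : KummerDual χ' b') : KummerDual (χ * χ') (b * b') := by
  have : Algebra.IsAlgebraic F Ω := IsAlgClosure.isAlgebraic
  obtain ⟨w, hw⟩ := exists_isExtendedValuation F Ω
  obtain ⟨α, hα0, hα⟩ := exists_kummerField_root (Ω := Ω) (p := p) b.ne_zero
  have hα' : (α : Ω) ^ (p - 1) = algebraMap F Ω b := congrArg Subtype.val hα
  obtain ⟨β, hβ0, hβ⟩ := exists_kummerField_root (Ω := Ω) (p := p) b'.ne_zero
  have hβ' : (β : Ω) ^ (p - 1) = algebraMap F Ω b' := congrArg Subtype.val hβ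
  refine hw.kummerDual_of_pow_eq (x := α * β) ?_ fun τ => ?_
  · rw [mul_pow, hα', hβ', Units.val_mul, map_mul]
  · have := ((hw.kummerDual_iff χ b).1 h τ α hα').mul hw
      ((hw.kummerDual_iff χ' b').1 h' τ β hβ')
    rw [map_mul, mul_div_mul_comm]
    exact this

theorem KummerDual.inv {χ : Character F Ω p} {b : Fˣ} (h : KummerDual χ b) :
    KummerDual χ⁻¹ b⁻¹ := by
  have : Algebra.IsAlgebraic F Ω := IsAlgClosure.isAlgebraic
  obtain ⟨w, hw⟩ := exists_isExtendedValuation F Ω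
  obtain ⟨α, hα0, hα⟩ := exists_kummerField_root (Ω := Ω) (p := p) b.ne_zero
  have hα' : (α : Ω) ^ (p - 1) = algebraMap F Ω b := congrArg Subtype.val hα
  refine hw.kummerDual_of_pow_eq (x := (α : Ω)⁻¹) ?_ fun τ => ?_
  · rw [inv_pow, hα', Units.val_inv_eq_inv_val, map_inv₀]
  · have := ((hw.kummerDual_iff χ b).1 h τ α hα').inv hw (Units.ne_zero _)
    have h2 : τ (α : Ω)⁻¹ / (α : Ω)⁻¹ = (τ (α : Ω) / α)⁻¹ := by
      rw [map_inv₀, div_inv_eq_mul, inv_div, div_eq_mul_inv, mul_comm]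
    rw [h2, MonoidHom.inv_apply, Units.val_inv_eq_inv_val]
    exact this

theorem kummerDual_one_pow (c : Fˣ) : KummerDual (1 : Character F Ω p) (c ^ (p - 1)) := by
  have : Algebra.IsAlgebraic F Ω := IsAlgClosure.isAlgebraic
  obtain ⟨w, hw⟩ := exists_isExtendedValuation F Ω
  refine hw.kummerDual_of_pow_eq (x := algebraMap F Ω c) ?_ fun τ => ?_
  · simp
  · rw [AlgEquiv.commutes, div_self (by simp)]
    simpa using hw.reduces_one

theorem IsExtendedValuation.kummerDual_of_near (hw : IsExtendedValuation F w)
    {χ : Character F Ω p} {b b' : Fˣ} (h : KummerDual χ b)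
    (hb : w (algebraMap F Ω b' - algebraMap F Ω b) < w (algebraMap F Ω b)) :
    KummerDual χ b' := by
  obtain ⟨α, hα0, hα⟩ := exists_kummerField_root (Ω := Ω) (p := p) b'.ne_zero
  have hα' : (α : Ω) ^ (p - 1) = algebraMap F Ω b' := congrArg Subtype.val hα
  exact hw.kummerDual_of_pow_eq hα'
    fun τ => hw.reduces_of_kummerDual h (by rw [hα']; exact hb) τ

/-- Nondegeneracy: if the residues are all 1, each σ(α)/α is a (p-1)-th root of unity congruent to
1, hence equal to 1, and α lies in F. -/
theorem KummerDual.exists_pow {b : Fˣ} (h : KummerDual (1 : Character F Ω p) b) :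
    ∃ c : Fˣ, b = c ^ (p - 1) := by
  have := finiteDimensional_kummerField (F := F) (Ω := Ω) (p := p)
  have : Algebra.IsAlgebraic F Ω := IsAlgClosure.isAlgebraic
  obtain ⟨w, hw⟩ := exists_isExtendedValuation F Ω
  obtain ⟨α, hα0, hα⟩ := exists_kummerField_root (Ω := Ω) (p := p) b.ne_zero
  have hα' : (α : Ω) ^ (p - 1) = algebraMap F Ω b := congrArg Subtype.val hα
  have hfix : α ∈ (⊥ : IntermediateField F (kummerField F Ω p)) := by
    rw [IsGalois.mem_bot_iff_fixed]
    intro σ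
    obtain ⟨τ, rfl⟩ := resK_surjective σ
    have h1 := (hw.kummerDual_iff _ b).1 h τ α hα'
    rw [MonoidHom.one_apply, Units.val_one, hw.reduces_one_iff] at h1
    have h2 := hw.eq_one_of_pow_eq_one (p := p) h1 (by
      rw [div_pow, ← map_pow, hα', AlgEquiv.commutes, div_self (by simp)])
    rw [div_eq_one_iff_eq (by simpa using hα0)] at h2
    ext
    rw [resK_apply, h2]
  rw [IntermediateField.mem_bot] at hfix
  obtain ⟨c, rfl⟩ := hfix
  have hc : c ≠ 0 := by rintro rfl; simp at hα0
  refine ⟨Units.mk0 c hc, ?_⟩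
  ext
  rw [← map_pow] at hα
  exact ((algebraMap F (kummerField F Ω p)).injective hα).symm

theorem KummerDual.exists_eq_mul_pow {χ : Character F Ω p} {b b' : Fˣ} (h : KummerDual χ b)
    (h' : KummerDual χ b') : ∃ c : Fˣ, b' = b * c ^ (p - 1) := by
  have h1 := h.inv.mul h'
  rw [show χ⁻¹ * χ = 1 by ext σ; simp] at h1
  obtain ⟨c, hc⟩ := h1.exists_pow
  exact ⟨c, by rw [← hc, mul_inv_cancel_left]⟩

theorem KummerDual.mul_pow {χ : Character F Ω p} {b : Fˣ} (h : KummerDual χ b) (c : Fˣ) :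
    KummerDual χ (b * c ^ (p - 1)) := by
  have := h.mul (kummerDual_one_pow c)
  rwa [show χ * 1 = χ by ext σ; simp] at this

/-- Hilbert's Theorem 90: the Teichmüller lift of χ takes values in F, so it is a cocycle; it has
the form σ(β)/β with β in K, and β^(p-1) is fixed by Galois. -/
theorem exists_kummerDual_right (χ : Character F Ω p) : ∃ b : Fˣ, KummerDual χ b := by
  have := finiteDimensional_kummerField (F := F) (Ω := Ω) (p := p)
  have : Algebra.IsAlgebraic F Ω := IsAlgClosure.isAlgebraic
  obtain ⟨w, hw⟩ := exists_isExtendedValuation F Ω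
  choose z hz hzs using exists_rootOfUnity_reduces (p := p) (F := F) hw
  have hz0 (s) : (z s : F) ≠ 0 := by
    have := (hzs s).ne_zero hw s.ne_zero
    simpa using this
  have hzmul (s t) : (z (s * t) : F) = z s * z t := by
    -- Both sides are (p-1)-th roots of unity with the same residue, so the Teichmüller lift is
    -- multiplicative.
    have h1 : algebraMap F Ω (z (s * t)) / algebraMap F Ω (z s * z t) = 1 := by
      refine hw.eq_one_of_pow_eq_one (p := p) ?_ ?_
      · rw [← hw.reduces_one_iff (p := p), map_mul]
        have := (hzs (s * t)).div hw ((hzs s).mul hw (hzs t)) (by simp)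
        rwa [Units.val_mul, div_self (by simp)] at this
      · have hz' (s) : (z s : F) ^ (p - 1) = 1 := congrArg Subtype.val (hz s)
        rw [div_pow, ← map_pow, ← map_pow, _root_.mul_pow, hz', hz', hz']
        simp
    have h2 : algebraMap F Ω (z s * z t) ≠ 0 := by
      rw [map_mul]; simp [hz0]
    rw [div_eq_one_iff_eq h2] at h1
    exact (algebraMap F Ω).injective h1
  let f : Gal(kummerField F Ω p/F) → (kummerField F Ω p)ˣ := fun σ =>
    Units.mk0 (algebraMap F (kummerField F Ω p) (z (χ σ))) (by simp [hz0])
  obtain ⟨β, hβ⟩ := groupCohomology.isMulCoboundary₁_of_isMulCocycle₁_of_aut_to_units f (by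
    intro σ τ
    ext
    simp [f, hzmul]
    ring)
  have hβ' (σ : Gal(kummerField F Ω p/F)) :
      σ (β : kummerField F Ω p) = algebraMap F (kummerField F Ω p) (z (χ σ)) * β := by
    have := congrArg Units.val (hβ σ)
    simp only [Units.val_div_eq_div_val, f, Units.val_mk0] at this
    rw [← this, div_mul_cancel₀ _ β.ne_zero]
    rfl
  have hfix : (β : kummerField F Ω p) ^ (p - 1) ∈
      (⊥ : IntermediateField F (kummerField F Ω p)) := by
    rw [IsGalois.mem_bot_iff_fixed]
    intro σ
    rw [map_pow, hβ', _root_.mul_pow, ← map_pow, ← SubmonoidClass.coe_pow, hz]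
    simp
  rw [IntermediateField.mem_bot] at hfix
  obtain ⟨b, hb⟩ := hfix
  have hb0 : b ≠ 0 := by
    rintro rfl
    rw [map_zero, eq_comm] at hb
    exact pow_ne_zero _ β.ne_zero hb
  refine ⟨Units.mk0 b hb0, hw.kummerDual_of_pow_eq (x := ((β : kummerField F Ω p) : Ω))
    (congrArg Subtype.val hb.symm) fun τ => ?_⟩
  rw [← resK_apply, hβ']
  have h1 : ((β : kummerField F Ω p) : Ω) ≠ 0 := by simp
  have h2 : ((algebraMap F (kummerField F Ω p) (z (χ (resK F Ω p τ))) * β :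
      kummerField F Ω p) : Ω) / ((β : kummerField F Ω p) : Ω) =
      algebraMap F Ω (z (χ (resK F Ω p τ))) := by
    rw [div_eq_iff h1]
    rfl
  rw [h2]
  exact hzs _

/-- Two elements dual to χ differ by a (p-1)-th power, so the choice made in `valBar` does not
affect the class of the valuation modulo p - 1. -/
theorem KummerDual.valBar_eq {χ : Character F Ω p} {b : Fˣ} (h : KummerDual χ b) :
    valBar χ = ((val F (b : F) : ℤ) : ZMod (p - 1)) := by
  unfold valBar
  have hex : ∃ a : Fˣ, KummerDual χ a := ⟨b, h⟩
  rw [dif_pos hex]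
  obtain ⟨c, hc⟩ := h.exists_eq_mul_pow hex.choose_spec
  rw [hc, Units.val_mul, Units.val_pow_eq_pow_val, val_mul (by simp) (by simp), val_pow]
  simp

end KummerPairing

/-! ### The p-th roots of unity and the class dual to ω. -/

section Cyclotomic

variable {F : Type*} [Field F] [ValuativeRel F] [TopologicalSpace F]
  [IsNonarchimedeanLocalField F] {Ω : Type*} [Field Ω] [Algebra F Ω] [IsAlgClosure F Ω]
  {w : Valuation Ω ℝ≥0} {p : ℕ} [CharP 𝓀[F] p] [Fact p.Prime]

/-- Ω need not be separable over F, so the Galois correspondence is used for separable elements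
only: outside L such an x has a second conjugate over L, reached by an automorphism. -/
theorem mem_of_forall_fixed {F : Type*} [Field F] {Ω : Type*} [Field Ω] [Algebra F Ω]
    [IsAlgClosure F Ω] (L : IntermediateField F Ω) {x : Ω} (hx : IsSeparable F x)
    (h : ∀ τ : Gal(Ω/F), (∀ y ∈ L, τ y = y) → τ x = x) : x ∈ L := by
  have : IsAlgClosed Ω := IsAlgClosure.isAlgClosed F
  have : Normal F Ω := IsAlgClosure.normal F Ω
  have : Normal L Ω := Normal.tower_top_of_normal F _ Ω
  have hx' : IsSeparable L x := hx.tower_top _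
  by_contra hmem
  have h1 := (notMem_iff_exists_ne_and_isConjRoot hx' (IsAlgClosed.splits _)).1 (by
    rw [Algebra.mem_bot]
    rintro ⟨y, rfl⟩
    exact hmem y.2)
  obtain ⟨y, hxy, hc⟩ := h1
  obtain ⟨σ, hσ⟩ := isConjRoot_iff_exists_algEquiv.1 hc.symm
  have h2 := h (σ.restrictScalars F) (fun z hz => σ.commutes ⟨z, hz⟩)
  exact hxy (h2.symm.trans hσ)

theorem resK_eq_one_iff {τ : Gal(Ω/F)} :
    resK F Ω p τ = 1 ↔ ∀ y ∈ kummerField F Ω p, τ y = y := by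
  constructor
  · intro h y hy
    have := resK_apply τ (⟨y, hy⟩ : kummerField F Ω p)
    rw [h] at this
    exact this.symm
  · intro h
    ext z
    rw [resK_apply]
    exact h z z.2

theorem mem_kummerField_of_fixed {x : Ω} (hx : IsSeparable F x)
    (h : ∀ τ : Gal(Ω/F), resK F Ω p τ = 1 → τ x = x) : x ∈ kummerField F Ω p :=
  mem_of_forall_fixed _ hx fun τ hτ => h τ (resK_eq_one_iff.2 hτ)

/-- With l = ζ - 1, expanding (1 + l)^p = 1 gives l^p = -p l r with r integral, so |l|^p ≤ |p| < 1.
-/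
theorem IsExtendedValuation.sub_one_lt_one (hw : IsExtendedValuation F w) {ζ : Ω}
    (hζ : ζ ^ p = 1) : w (ζ - 1) < 1 := by
  have hp : p.Prime := Fact.out
  have hw1 : w ζ = 1 := by
    have := congrArg w hζ
    rw [map_pow, map_one] at this
    exact (pow_eq_one_iff.1 this).resolve_right hp.ne_zero
  have hl : w (ζ - 1) ≤ 1 := w.map_sub_le hw1.le (by simp)
  let l : w.valuationSubring := ⟨ζ - 1, hl⟩
  obtain ⟨r, hr⟩ := exists_add_pow_prime_eq hp l 1
  have h1 : ζ ^ p = (ζ - 1) ^ p + 1 + p * ((ζ - 1) * (r : Ω)) := by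
    have := congrArg Subtype.val hr
    simp only [mul_assoc] at this
    simpa [l] using this
  rw [hζ] at h1
  have h2 : (ζ - 1) ^ p = -(p * ((ζ - 1) * (r : Ω))) := by linear_combination -h1
  have h3 : w ((ζ - 1) ^ p) < 1 := by
    rw [h2, w.map_neg, map_mul, map_mul]
    refine mul_lt_one_of_nonneg_of_lt_one_left zero_le
      ((hw.natCast_lt_one_iff (p := p) p).2 dvd_rfl) (mul_le_one' hl r.2)
  rw [map_pow] at h3
  exact (pow_lt_one_iff hp.ne_zero).1 h3

/-- The `p`-th power roots of unity satisfy `(1 - ζ)^(p-1) ≈ -p`. -/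
theorem IsExtendedValuation.one_sub_pow_near [CharZero F] (hw : IsExtendedValuation F w) {ζ : Ω}
    (hζ : IsPrimitiveRoot ζ p) :
    w ((1 - ζ) ^ (p - 1) - algebraMap F Ω (-(p : F))) < w (algebraMap F Ω (-(p : F))) := by
  have hp : p.Prime := Fact.out
  have : CharZero Ω := charZero_of_injective_algebraMap (algebraMap F Ω).injective
  have hp0 : (p : Ω) ≠ 0 := by exact_mod_cast hp.ne_zero
  have hred : Reduces w ζ (1 : ZMod p) :=
    hw.reduces_one_iff.2 (hw.sub_one_lt_one (p := p) hζ.pow_eq_one)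
  obtain ⟨n, rfl⟩ : ∃ n, p = n + 1 := ⟨p - 1, by have := hp.two_le; omega⟩
  have h1 := hζ.prod_one_sub_pow_eq_order
  set u := ∏ k ∈ Finset.range n, ∑ i ∈ Finset.range (k + 1), ζ ^ i with hu
  have h2 : (1 - ζ) ^ n * u = ((n + 1 : ℕ) : Ω) := by
    push_cast
    rw [← h1, hu, ← Finset.card_range n, ← Finset.prod_const, Finset.card_range,
      ← Finset.prod_mul_distrib]
    refine Finset.prod_congr rfl fun k _ => ?_
    rw [mul_neg_geom_sum]
  -- Each factor 1 + ζ + ... + ζ^k reduces to k + 1, so the product reduces to (p-1)! = -1 by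
  -- Wilson's theorem.
  have h3 : Reduces w u (-1 : ZMod (n + 1)) := by
    have := Reduces.prod (s := fun k => ((k + 1 : ℕ) : ZMod (n + 1))) hw (Finset.range n)
      (z := fun k => ∑ i ∈ Finset.range (k + 1), ζ ^ i) (fun k _ => by
        have := Reduces.sum (s := fun _ => (1 : ZMod (n + 1))) hw (Finset.range (k + 1))
          (z := fun i => ζ ^ i) (fun i _ => by simpa using hred.pow hw i)
        simpa using this)
    rw [← Nat.cast_prod, Finset.prod_range_add_one_eq_factorial] at this
    have hwil := ZMod.wilsons_lemma (n + 1)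
    rw [Nat.add_sub_cancel] at hwil
    rwa [hwil] at this
  have hu1 := h3.eq_one hw (by simp)
  have hu0 := h3.ne_zero hw (by simp)
  rw [Nat.add_sub_cancel, map_neg, map_natCast, w.map_neg, sub_neg_eq_add]
  have h4 : (1 - ζ) ^ n + ((n + 1 : ℕ) : Ω) = ((n + 1 : ℕ) : Ω) * ((u + 1) / u) := by
    rw [← h2]
    field_simp
    ring
  rw [h4, map_mul, map_div₀, hu1, div_one]
  have h5 := h3.add hw (hw.reduces_one)
  rw [neg_add_cancel, hw.reduces_zero_iff] at h5
  exact mul_lt_of_lt_one_right (by simpa [zero_lt_iff] using hp0) h5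

/-- The quotient is a geometric sum of k terms, each of residue 1. -/
theorem IsExtendedValuation.reduces_one_sub_pow_div (hw : IsExtendedValuation F w) {ζ : Ω}
    (hζ : ζ ^ p = 1) (hζ1 : ζ ≠ 1) (k : ℕ) :
    Reduces w ((1 - ζ ^ k) / (1 - ζ)) (k : ZMod p) := by
  have hred : Reduces w ζ (1 : ZMod p) := hw.reduces_one_iff.2 (hw.sub_one_lt_one (p := p) hζ)
  rw [← mul_neg_geom_sum, mul_div_cancel_left₀ _ (sub_ne_zero.2 hζ1.symm)]
  have := Reduces.sum (s := fun _ => (1 : ZMod p)) hw (Finset.range k)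
    (z := fun i => ζ ^ i) (fun i _ => by simpa using hred.pow hw i)
  simpa using this

-- Since (1 - ζ)^(p-1) ≈ -p, the residue of τ(1 - ζ)/(1 - ζ) depends on τ only through K. If τ is
-- trivial on K, this residue is 1; if τ(ζ) = ζ^k, it is k. Hence τ fixes ζ.
variable (F Ω p) in
theorem exists_primitiveRoot_kummerField [CharZero F] :
    ∃ ζ : kummerField F Ω p, IsPrimitiveRoot ζ p := by
  have hp : p.Prime := Fact.out
  have : CharZero Ω := charZero_of_injective_algebraMap (algebraMap F Ω).injective
  have : Algebra.IsAlgebraic F Ω := IsAlgClosure.isAlgebraic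
  have : IsAlgClosed Ω := IsAlgClosure.isAlgClosed F
  obtain ⟨w, hw⟩ := exists_isExtendedValuation F Ω
  have : NeZero (p : Ω) := ⟨by exact_mod_cast hp.ne_zero⟩
  obtain ⟨ζ, hζ⟩ := HasEnoughRootsOfUnity.exists_primitiveRoot Ω p
  have hp0 : -(p : F) ≠ 0 := by simpa using hp.ne_zero
  obtain ⟨χ, hχ⟩ := exists_kummerDual (p := p) Ω (Units.mk0 _ hp0)
  have hmem : ζ ∈ kummerField F Ω p := by
    refine mem_kummerField_of_fixed (Algebra.IsSeparable.isSeparable F ζ) fun τ hτ => ?_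
    have h1 := hw.reduces_of_kummerDual hχ (hw.one_sub_pow_near hζ) τ
    obtain ⟨k, hk, hkτ⟩ := hζ.eq_pow_of_pow_eq_one (ξ := τ ζ) (by
      rw [← map_pow, hζ.pow_eq_one, map_one])
    have h2 := hw.reduces_one_sub_pow_div hζ.pow_eq_one (hζ.ne_one hp.one_lt) k
    rw [map_sub, map_one, ← hkτ, hτ, map_one] at h1
    have h3 := h1.unique hw h2
    rw [Units.val_one, ← Nat.cast_one, ZMod.natCast_eq_natCast_iff'] at h3
    rw [Nat.mod_eq_of_lt hk, Nat.mod_eq_of_lt hp.one_lt] at h3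
    rw [← hkτ, ← h3, pow_one]
  exact ⟨⟨ζ, hmem⟩, IsPrimitiveRoot.coe_submonoidClass_iff.1 hζ⟩

theorem apply_primitiveRoot {ζ : kummerField F Ω p} (hζ : IsPrimitiveRoot ζ p)
    (τ : Gal(Ω/F)) :
    τ (ζ : Ω) = (ζ : Ω) ^ (cyclotomicChar F Ω p (resK F Ω p τ) : ZMod p).val := by
  have hp : p.Prime := Fact.out
  have hcard : Nat.card (rootsOfUnity p (kummerField F Ω p)) = p := hζ.card_rootsOfUnity
  have hspec := modularCyclotomicCharacter.spec (kummerField F Ω p) hcard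
    ((resK F Ω p τ : Gal(kummerField F Ω p/F)) : kummerField F Ω p ≃+* kummerField F Ω p)
    (t := (hζ.isUnit hp.ne_zero).unit) (by
      rw [mem_rootsOfUnity]; ext1; exact hζ.pow_eq_one)
  rw [← resK_apply]
  have := congrArg Subtype.val hspec
  unfold cyclotomicChar
  rw [dif_pos hcard]
  exact this

/-- The element 1 - ζ is an approximate (p-1)-th root of -p, and τ multiplies it by an element of
residue ω(τ). -/
theorem kummerDual_cyclotomicChar [CharZero F] {b : Fˣ} (hb : (b : F) = -(p : F)) :
    KummerDual (cyclotomicChar F Ω p) b := by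
  have hp : p.Prime := Fact.out
  have : Algebra.IsAlgebraic F Ω := IsAlgClosure.isAlgebraic
  obtain ⟨w, hw⟩ := exists_isExtendedValuation F Ω
  obtain ⟨ζ, hζ⟩ := exists_primitiveRoot_kummerField F Ω p
  have hζ' : IsPrimitiveRoot (ζ : Ω) p := IsPrimitiveRoot.coe_submonoidClass_iff.2 hζ
  refine hw.kummerDual_of_reduces (x := 1 - (ζ : Ω)) (by rw [hb]; exact hw.one_sub_pow_near hζ')
    fun τ => ?_
  rw [map_sub, map_one, apply_primitiveRoot hζ]
  have := hw.reduces_one_sub_pow_div hζ'.pow_eq_one (hζ'.ne_one hp.one_lt)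
    (cyclotomicChar F Ω p (resK F Ω p τ) : ZMod p).val
  rwa [ZMod.natCast_zmod_val] at this

theorem cyclotomicChar_eq_one [CharP F p] : cyclotomicChar F Ω p = 1 := by
  have hp : p.Prime := Fact.out
  unfold cyclotomicChar
  rw [dif_neg]
  intro h
  obtain ⟨ζ, hζ⟩ := card_rootsOfUnity_eq_iff_exists_isPrimitiveRoot.1 h
  have h1 : (ζ - 1) ^ p = 0 := by
    rw [sub_pow_char, hζ.pow_eq_one, one_pow, sub_self]
  exact hζ.ne_one hp.one_lt (sub_eq_zero.1 (pow_eq_zero_iff hp.ne_zero |>.1 h1))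

end Cyclotomic

/-! ### Families of conjugates permuted by affine maps of 𝔽_p. -/

section AffineSystem

variable {F : Type*} [Field F] [ValuativeRel F] [TopologicalSpace F]
  [IsNonarchimedeanLocalField F] {Ω : Type*} [Field Ω] [Algebra F Ω] [IsAlgClosure F Ω]
  {p : ℕ} [CharP 𝓀[F] p] [Fact p.Prime]

/-- A family of elements of `Ω` indexed by `𝔽_p`, outside the Kummer field, permuted by `Gal(Ω|F)`
through affine transformations of `𝔽_p` with linear part `ψ`. -/
structure IsAffineSystem (ψ : Character F Ω p) (c : ZMod p → Ω) : Prop where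
  injective : Function.Injective c
  separable (s : ZMod p) : IsSeparable F (c s)
  exists_translation (τ : Gal(Ω/F)) :
    ∃ t : ZMod p, ∀ s, τ (c s) = c ((ψ (resK F Ω p τ) : ZMod p) * s + t)
  notMem : c 0 ∉ kummerField F Ω p

namespace IsAffineSystem

variable {ψ : Character F Ω p} {c : ZMod p → Ω}

theorem exists_translation_of_resK (hc : IsAffineSystem ψ c) {ρ : Gal(Ω/F)}
    (hρ : resK F Ω p ρ = 1) : ∃ t : ZMod p, ∀ s, ρ (c s) = c (s + t) := by
  obtain ⟨t, ht⟩ := hc.exists_translation ρ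
  refine ⟨t, fun s => ?_⟩
  rw [ht, hρ, map_one, Units.val_one, one_mul]

/-- As c 0 is separable and outside K, some automorphism over K moves it. It acts as a nonzero
translation, and its powers give all translations because p is prime. -/
theorem exists_resK_translation (hc : IsAffineSystem ψ c) (t : ZMod p) :
    ∃ ρ : Gal(Ω/F), resK F Ω p ρ = 1 ∧ ∀ s, ρ (c s) = c (s + t) := by
  have h1 : ∃ ρ : Gal(Ω/F), resK F Ω p ρ = 1 ∧ ρ (c 0) ≠ c 0 := by
    by_contra! h
    exact hc.notMem (mem_kummerField_of_fixed (hc.separable 0) h)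
  obtain ⟨ρ, hρ, hρ0⟩ := h1
  obtain ⟨u, hu⟩ := hc.exists_translation_of_resK hρ
  have hu0 : u ≠ 0 := by
    rintro rfl
    exact hρ0 (by rw [hu, add_zero])
  have hpow (n : ℕ) (s : ZMod p) : (ρ ^ n) (c s) = c (s + n * u) := by
    induction n with
    | zero => simp
    | succ n ih =>
      rw [pow_succ', AlgEquiv.mul_apply, ih, hu]
      congr 1
      push_cast
      ring
  refine ⟨ρ ^ (t / u).val, by rw [map_pow, hρ, one_pow], fun s => ?_⟩
  rw [hpow, ZMod.natCast_zmod_val, div_mul_cancel₀ _ hu0]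

/-- Conjugation by an affine map multiplies a translation by a power ±1 of its linear part. This is
the origin of ψ⁻¹ in the character of the extension. -/
theorem conj_translation (hc : IsAffineSystem ψ c) {τ ρ : Gal(Ω/F)} {t : ZMod p}
    (hρ : ∀ s, ρ (c s) = c (s + t)) (s : ZMod p) :
    (τ⁻¹ * ρ * τ) (c s) = c (s + (ψ (resK F Ω p τ) : ZMod p)⁻¹ * t) := by
  obtain ⟨u, hu⟩ := hc.exists_translation τ
  rw [AlgEquiv.mul_apply, AlgEquiv.mul_apply, AlgEquiv.aut_inv, AlgEquiv.symm_apply_eq, hu, hu, hρ]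
  congr 1
  field_simp
  ring

/-- An automorphism over K acts by a translation; if it fixes c 0 the translation is zero, so it
fixes every c s. -/
theorem mem_sup_of_fixed (hc : IsAffineSystem ψ c) {E : IntermediateField F Ω}
    (hE : E = IntermediateField.adjoin F {c 0}) {x : Ω} (hx : IsSeparable F x)
    (h : ∀ ρ : Gal(Ω/F), resK F Ω p ρ = 1 → (∀ s, ρ (c s) = c s) → ρ x = x) :
    x ∈ E ⊔ kummerField F Ω p := by
  refine mem_of_forall_fixed _ hx fun τ hτ => ?_
  have hτK : resK F Ω p τ = 1 :=
    resK_eq_one_iff.2 fun y hy => hτ y ((le_sup_right : _ ≤ E ⊔ kummerField F Ω p) hy)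
  refine h τ hτK fun s => ?_
  obtain ⟨t, ht⟩ := hc.exists_translation_of_resK hτK
  have h0 : τ (c 0) = c 0 := hτ _ ((le_sup_left : E ≤ E ⊔ kummerField F Ω p) (by
    rw [hE]; exact IntermediateField.mem_adjoin_simple_self F _))
  have ht0 : t = 0 := by
    rw [ht] at h0
    simpa using hc.injective h0
  rw [ht, ht0, add_zero]

/-- An element of `E K` is fixed by the automorphisms over `K` which fix all the `c s`. -/
theorem fixed_of_mem_sup {E : IntermediateField F Ω}
    (hE : E = IntermediateField.adjoin F {c 0}) {x : Ω} (hx : x ∈ E ⊔ kummerField F Ω p)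
    {ρ : Gal(Ω/F)} (hρ : resK F Ω p ρ = 1) (h0 : ρ (c 0) = c 0) : ρ x = x := by
  have hle : E ⊔ kummerField F Ω p ≤ IntermediateField.fixedField (Subgroup.zpowers ρ) := by
    have key : ∀ y : Ω, ρ y = y → y ∈ IntermediateField.fixedField (Subgroup.zpowers ρ) := by
      rintro y hy ⟨g, hg⟩
      have : ρ ∈ MulAction.stabilizer Gal(Ω/F) y := hy
      exact (Subgroup.zpowers_le.2 this) hg
    refine sup_le ?_ fun y hy => key y (resK_eq_one_iff.1 hρ y hy)
    rw [hE, IntermediateField.adjoin_simple_le_iff]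
    exact key _ h0
  exact hle hx ⟨ρ, Subgroup.mem_zpowers ρ⟩

/-- The c s are distinct, so a Vandermonde determinant is nonzero and not all these power sums
vanish. This provides nonvanishing resolvents. -/
theorem exists_sum_ne_zero (hc : IsAffineSystem ψ c) {v : ZMod p → Ω} (hv : v 0 ≠ 0) :
    ∃ k : ℕ, ∑ s, v s * c s ^ k ≠ 0 := by
  by_contra! h
  let e : Fin p ≃ ZMod p := (ZMod.finEquiv p).toEquiv
  have h1 := Matrix.eq_zero_of_forall_pow_sum_mul_pow_eq_zero (f := fun j => c (e j))
    (v := fun j => v (e j)) (hc.injective.comp e.injective) (fun i => by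
      rw [← h i]
      exact e.sum_comp fun s => v s * c s ^ (i : ℕ))
  have h2 := congrFun h1 (e.symm 0)
  simp at h2
  exact hv h2

end IsAffineSystem
end AffineSystem

/-! ### Kummer theory: the character in characteristic 0. -/

section KummerTheory

variable {F : Type*} [Field F] [ValuativeRel F] [TopologicalSpace F]
  [IsNonarchimedeanLocalField F] {Ω : Type*} [Field Ω] [Algebra F Ω] [IsAlgClosure F Ω]
  {p : ℕ} [CharP 𝓀[F] p] [Fact p.Prime]

theorem rootPow_add {M : Type*} [Field M] {ζ : M} (hζ : ζ ^ p = 1) (s t : ZMod p) :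
    ζ ^ (s + t).val = ζ ^ s.val * ζ ^ t.val := by
  rw [ZMod.val_add, ← pow_add, ← pow_mod_orderOf, ← pow_mod_orderOf ζ (s.val + t.val),
    Nat.mod_mod_of_dvd _ (orderOf_dvd_of_pow_eq_one hζ)]

theorem rootPow_mul {M : Type*} [Field M] {ζ : M} (hζ : ζ ^ p = 1) (s t : ZMod p) :
    ζ ^ (s * t).val = (ζ ^ s.val) ^ t.val := by
  rw [ZMod.val_mul, ← pow_mul, ← pow_mod_orderOf, ← pow_mod_orderOf ζ (s.val * t.val),
    Nat.mod_mod_of_dvd _ (orderOf_dvd_of_pow_eq_one hζ)]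

theorem rootPow_injective {M : Type*} [Field M] {ζ : M} (hζ : IsPrimitiveRoot ζ p)
    {s t : ZMod p} (h : ζ ^ s.val = ζ ^ t.val) : s = t :=
  ZMod.val_injective p (hζ.pow_inj (ZMod.val_lt s) (ZMod.val_lt t) h)

theorem exists_rootPow_eq {M : Type*} [Field M] {ζ : M} (hζ : IsPrimitiveRoot ζ p) {z : M}
    (hz : z ^ p = 1) : ∃ s : ZMod p, z = ζ ^ s.val := by
  obtain ⟨i, hi, rfl⟩ := hζ.eq_pow_of_pow_eq_one hz
  exact ⟨(i : ZMod p), by rw [ZMod.val_natCast_of_lt hi]⟩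

/-- If an automorphism sends a to a^m y^n and u to c, then it sends a^i u^n to its m-th power up to
an n-th power; the left-hand side exhibits that n-th power. -/
theorem commGroup_pow_aux {A : Type*} [CommGroup A] (a y c u : A) (i : ℤ) (m n : ℕ) :
    ((y ^ i)⁻¹ * c⁻¹ * u ^ m) ^ n = ((a ^ m * y ^ n) ^ i * c ^ n)⁻¹ * (a ^ i * u ^ n) ^ m := by
  have hcomm (x : A) (k : ℕ) : (x ^ k) ^ i = (x ^ i) ^ k := by
    rw [← zpow_natCast, ← zpow_natCast, ← zpow_mul, ← zpow_mul, mul_comm]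
  have h3 : (u ^ n) ^ m = (u ^ m) ^ n := by rw [← pow_mul, ← pow_mul, mul_comm]
  rw [eq_inv_mul_iff_mul_eq, mul_zpow, mul_pow, mul_pow, mul_pow, hcomm, hcomm, h3, inv_pow,
    inv_pow]
  generalize (a ^ i) ^ m = A', (y ^ i) ^ n = Y, c ^ n = C, (u ^ m) ^ n = U
  calc A' * Y * C * (Y⁻¹ * C⁻¹ * U) = A' * U * (Y * Y⁻¹) * (C * C⁻¹) := by ac_rfl
    _ = A' * U := by simp

theorem apply_rootPow {ζ : kummerField F Ω p} (hζ : IsPrimitiveRoot ζ p)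
    (τ : Gal(Ω/F)) (s : ZMod p) :
    τ ((ζ : Ω) ^ s.val) = (ζ : Ω) ^ ((cyclotomicChar F Ω p (resK F Ω p τ) : ZMod p) * s).val := by
  rw [map_pow, apply_primitiveRoot hζ, rootPow_mul]
  exact_mod_cast congrArg Subtype.val hζ.pow_eq_one

namespace IsAffineSystem

variable {ψ : Character F Ω p} {c : ZMod p → Ω}

/-- The Lagrange resolvent. -/
theorem exists_resolvent [CharZero F] (hc : IsAffineSystem ψ c) {ζ : kummerField F Ω p}
    (hζ : IsPrimitiveRoot ζ p) :
    ∃ x : Ω, x ≠ 0 ∧ ∀ (ρ : Gal(Ω/F)) (t : ZMod p), resK F Ω p ρ = 1 →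
      (∀ s, ρ (c s) = c (s + t)) → ρ x = (ζ : Ω) ^ t.val * x := by
  have hζp : (ζ : Ω) ^ p = 1 := by exact_mod_cast congrArg Subtype.val hζ.pow_eq_one
  obtain ⟨k, hk⟩ := hc.exists_sum_ne_zero (v := fun s => (ζ : Ω) ^ (-s).val) (by simp)
  refine ⟨_, hk, fun ρ t hρ ht => ?_⟩
  rw [map_sum, Finset.mul_sum]
  rw [← Equiv.sum_comp (Equiv.addRight t)
    (fun s => (ζ : Ω) ^ t.val * ((ζ : Ω) ^ (-s).val * c s ^ k))]
  refine Finset.sum_congr rfl fun s _ => ?_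
  rw [map_mul, apply_rootPow hζ, hρ, map_one, Units.val_one, one_mul, map_pow, ht,
    Equiv.coe_addRight, ← mul_assoc, ← rootPow_add hζp]
  congr 3
  ring

/-- Conjugating the character by which `Gal(Ω|K)` acts on a Kummer generator. -/
theorem apply_apply_generator (hc : IsAffineSystem ψ c) {ζ : kummerField F Ω p}
    (hζ : IsPrimitiveRoot ζ p) {x : Ω} {j : ZMod p}
    (hx : ∀ (ρ : Gal(Ω/F)) (t : ZMod p), resK F Ω p ρ = 1 →
      (∀ s, ρ (c s) = c (s + t)) → ρ x = (ζ : Ω) ^ (j * t).val * x)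
    (τ : Gal(Ω/F)) {ρ : Gal(Ω/F)} {t : ZMod p} (hρ : resK F Ω p ρ = 1)
    (ht : ∀ s, ρ (c s) = c (s + t)) :
    ρ (τ x) = (ζ : Ω) ^ ((cyclotomicChar F Ω p (resK F Ω p τ) : ZMod p) *
      (j * ((ψ (resK F Ω p τ) : ZMod p)⁻¹ * t))).val * τ x := by
  have h1 := hx (τ⁻¹ * ρ * τ) _ (by simp [hρ]) (hc.conj_translation ht)
  have h2 : ρ (τ x) = τ ((τ⁻¹ * ρ * τ) x) := by
    rw [← AlgEquiv.mul_apply, ← AlgEquiv.mul_apply]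
    congr 1
    group
  rw [h2, h1, map_mul, apply_rootPow hζ]

/-- Let x be the resolvent: an automorphism over K acting by the translation t multiplies x by ζ^t,
so x^p lies in K and its class generates D. Conjugation by τ twists ζ by ω(τ) and t by ψ(τ)⁻¹, so
τ(x) equals x^m up to a factor in K, where m = ω(τ)ψ(τ)⁻¹. -/
theorem hasKummerCharacter [CharZero F] (hc : IsAffineSystem ψ c) {E : IntermediateField F Ω}
    (hE : E = IntermediateField.adjoin F {c 0}) :
    HasKummerCharacter E (cyclotomicChar F Ω p * ψ⁻¹) := by
  have hp : p.Prime := Fact.out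
  have : Algebra.IsAlgebraic F Ω := IsAlgClosure.isAlgebraic
  set K := kummerField F Ω p with hK
  obtain ⟨ζ, hζ⟩ := exists_primitiveRoot_kummerField F Ω p
  have hζ' : IsPrimitiveRoot (ζ : Ω) p := IsPrimitiveRoot.coe_submonoidClass_iff.2 hζ
  have hζp := hζ'.pow_eq_one
  obtain ⟨x, hx0, hx⟩ := hc.exists_resolvent hζ
  have hsep (y : Ω) : IsSeparable F y := Algebra.IsSeparable.isSeparable F y
  have haK : x ^ p ∈ K := by
    refine mem_kummerField_of_fixed (hsep _) fun ρ hρ => ?_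
    obtain ⟨t, ht⟩ := hc.exists_translation_of_resK hρ
    rw [map_pow, hx ρ t hρ ht, mul_pow, ← pow_mul, mul_comm t.val, pow_mul, hζp, one_pow, one_mul]
  have hxK : ∀ i : ℕ, ¬ ((i : ZMod p) ≠ 0 ∧ x ^ i ∈ K) := by
    rintro i ⟨hi, hiK⟩
    obtain ⟨ρ, hρ, hρ1⟩ := hc.exists_resK_translation 1
    have h1 := resK_eq_one_iff.1 hρ _ hiK
    rw [map_pow, hx ρ 1 hρ hρ1, mul_pow, ZMod.val_one, pow_one] at h1
    have h2 : (ζ : Ω) ^ i = 1 := mul_right_cancel₀ (pow_ne_zero i hx0) (by rw [h1, one_mul])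
    rw [hζ'.pow_eq_one_iff_dvd] at h2
    exact hi ((ZMod.natCast_eq_zero_iff _ _).2 h2)
  let a : Kˣ := Units.mk0 ⟨x ^ p, haK⟩ (by
    intro h; exact pow_ne_zero p hx0 (congrArg Subtype.val h))
  have ha : ((a : K) : Ω) = x ^ p := rfl
  let qa : Kˣ ⧸ (powMonoidHom p : Kˣ →* Kˣ).range := QuotientGroup.mk a
  have hroot : ∀ y z : Ω, z ≠ 0 → y ^ p = z ^ p → ∃ s : ZMod p, y = (ζ : Ω) ^ s.val * z := by
    intro y z hz h
    obtain ⟨s, hs⟩ := exists_rootPow_eq hζ' (z := y / z) (by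
      rw [div_pow, h, div_self (pow_ne_zero _ hz)])
    exact ⟨s, (div_eq_iff hz).1 hs⟩
  have hmem : ∀ b : Kˣ, (QuotientGroup.mk b : Kˣ ⧸ (powMonoidHom p : Kˣ →* Kˣ).range) ∈
      Subgroup.zpowers qa → ∃ (i : ℤ) (y : Kˣ), b = a ^ i * y ^ p := by
    rintro b ⟨i, hi⟩
    change qa ^ i = _ at hi
    rw [← QuotientGroup.mk_zpow, QuotientGroup.eq] at hi
    obtain ⟨y, hy⟩ := hi
    refine ⟨i, y, ?_⟩
    rw [show y ^ p = (a ^ i)⁻¹ * b from hy, mul_inv_cancel_left]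
  refine ⟨Subgroup.zpowers qa, ?_, ?_, ?_⟩
  · rw [Nat.card_zpowers]
    refine orderOf_eq_prime ?_ ?_
    · rw [← QuotientGroup.mk_pow, QuotientGroup.eq_one_iff]
      exact ⟨a, rfl⟩
    · rw [Ne, QuotientGroup.eq_one_iff]
      rintro ⟨y, hy⟩
      have hy' : ((y : K) : Ω) ^ p = x ^ p := congrArg (fun u : Kˣ => ((u : K) : Ω)) hy
      obtain ⟨s, hs⟩ := hroot x (y : K) (by simp) hy'.symm
      refine hxK 1 ⟨by simp, ?_⟩
      rw [pow_one, hs]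
      exact mul_mem (pow_mem ζ.2 _) (y : K).2
  · have hKle : K ≤ E ⊔ K := le_sup_right
    apply le_antisymm
    · refine sup_le ?_ ?_
      · rw [hE, IntermediateField.adjoin_simple_le_iff]
        refine mem_of_forall_fixed _ (hc.separable 0) fun τ hτ => ?_
        have hτK : resK F Ω p τ = 1 := resK_eq_one_iff.2 fun y hy => hτ y (by
          rw [IntermediateField.mem_restrictScalars]
          exact (IntermediateField.adjoin K _).algebraMap_mem ⟨y, hy⟩)
        have hτx : τ x = x := hτ x (by
          rw [IntermediateField.mem_restrictScalars]
          exact IntermediateField.subset_adjoin _ _ ⟨a, Subgroup.mem_zpowers _, rfl⟩)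
        obtain ⟨t, ht⟩ := hc.exists_translation_of_resK hτK
        rw [hx τ t hτK ht] at hτx
        have h2 : (ζ : Ω) ^ t.val = (ζ : Ω) ^ (0 : ZMod p).val :=
          mul_right_cancel₀ hx0 (by rw [hτx]; simp)
        rw [ht, rootPow_injective hζ' h2, add_zero]
      · intro y hy
        rw [IntermediateField.mem_restrictScalars]
        exact (IntermediateField.adjoin K _).algebraMap_mem ⟨y, hy⟩
    · have hle : IntermediateField.adjoin K {y : Ω | ∃ b : Kˣ,
          (QuotientGroup.mk b : Kˣ ⧸ (powMonoidHom p : Kˣ →* Kˣ).range) ∈ Subgroup.zpowers qa ∧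
          y ^ p = algebraMap K Ω b} ≤ IntermediateField.extendScalars hKle := by
        rw [IntermediateField.adjoin_le_iff]
        rintro y ⟨b, hb, hy⟩
        obtain ⟨i, u, rfl⟩ := hmem b hb
        have h1 : y ^ p = (x ^ i * ((u : K) : Ω)) ^ p := by
          have hcomm : (x ^ i) ^ p = (x ^ p) ^ i := by
            rw [← zpow_natCast, ← zpow_natCast, ← zpow_mul, ← zpow_mul, mul_comm]
          rw [hy, mul_pow, hcomm]
          simp only [Units.val_mul, Units.val_zpow_eq_zpow_val, Units.val_pow_eq_pow_val, map_mul,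
            map_zpow₀, map_pow]
          rfl
        obtain ⟨s, hs⟩ := hroot y _ (mul_ne_zero (zpow_ne_zero _ hx0) (by simp)) h1
        have hxL : x ∈ E ⊔ K := hc.mem_sup_of_fixed hE (hsep x) fun ρ hρ h => by
          have := hx ρ 0 hρ (fun s => by rw [h, add_zero])
          simpa using this
        have : y ∈ E ⊔ K := by
          rw [hs]
          exact mul_mem (pow_mem (hKle ζ.2) _) (mul_mem (zpow_mem hxL _) (hKle (u : K).2))
        exact this
      intro y hy
      exact hle hy
  · intro σ b hb
    obtain ⟨τ, rfl⟩ := resK_surjective σ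
    set m := ((cyclotomicChar F Ω p * ψ⁻¹) (resK F Ω p τ) : ZMod p) with hm
    have hyK : τ x / x ^ m.val ∈ K := by
      refine mem_kummerField_of_fixed (hsep _) fun ρ hρ => ?_
      obtain ⟨t, ht⟩ := hc.exists_translation_of_resK hρ
      rw [map_div₀, map_pow, hc.apply_apply_generator hζ (j := 1)
        (fun ρ t hρ ht => by rw [one_mul]; exact hx ρ t hρ ht) τ hρ ht, hx ρ t hρ ht, mul_pow,
        ← rootPow_mul hζp]
      have : (cyclotomicChar F Ω p (resK F Ω p τ) : ZMod p) *
          (1 * ((ψ (resK F Ω p τ) : ZMod p)⁻¹ * t)) = t * m := by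
        rw [hm, MonoidHom.mul_apply, MonoidHom.inv_apply, Units.val_mul, Units.val_inv_eq_inv_val]
        ring
      rw [this, mul_div_mul_left]
      exact pow_ne_zero _ (hζ'.ne_zero hp.ne_zero)
    have hy0 : τ x / x ^ m.val ≠ 0 := div_ne_zero (by simpa using hx0) (pow_ne_zero _ hx0)
    let y : Kˣ := Units.mk0 ⟨_, hyK⟩ (by intro h; exact hy0 (congrArg Subtype.val h))
    have hact : Units.map (resK F Ω p τ : K →* K) a = a ^ m.val * y ^ p := by
      ext
      change ((resK F Ω p τ (a : K) : K) : Ω) = (x ^ p) ^ m.val * (τ x / x ^ m.val) ^ p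
      rw [resK_apply, ha, map_pow, div_pow, ← pow_mul, ← pow_mul, mul_comm p m.val]
      field_simp
    obtain ⟨i, u, rfl⟩ := hmem b hb
    rw [← QuotientGroup.mk_pow, QuotientGroup.eq, map_mul, map_zpow, hact]
    refine ⟨(y ^ i)⁻¹ * (Units.map (resK F Ω p τ : K →* K) u)⁻¹ * u ^ m.val, ?_⟩
    rw [powMonoidHom_apply, map_pow]
    exact commGroup_pow_aux a y _ u i m.val p

/-- An arbitrary generator x of EK coming from D satisfies ρ(x) = ζ^(jt) x for a fixed j ≠ 0. The
action of ρ on τ(x) is computed once by conjugation and once from τ(x) = x^m y up to a p-th root of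
unity; comparing exponents gives jm = jωψ⁻¹. -/
theorem eq_of_hasKummerCharacter [CharZero F] (hc : IsAffineSystem ψ c)
    {E : IntermediateField F Ω} (hE : E = IntermediateField.adjoin F {c 0})
    {χ : Character F Ω p} (h : HasKummerCharacter E χ) : χ = cyclotomicChar F Ω p * ψ⁻¹ := by
  have hp : p.Prime := Fact.out
  have : Algebra.IsAlgebraic F Ω := IsAlgClosure.isAlgebraic
  have : IsAlgClosed Ω := IsAlgClosure.isAlgClosed F
  set K := kummerField F Ω p with hK
  obtain ⟨ζ, hζ⟩ := exists_primitiveRoot_kummerField F Ω p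
  have hζ' : IsPrimitiveRoot (ζ : Ω) p := IsPrimitiveRoot.coe_submonoidClass_iff.2 hζ
  have hζp := hζ'.pow_eq_one
  have hsep (y : Ω) : IsSeparable F y := Algebra.IsSeparable.isSeparable F y
  obtain ⟨D, hD, hDE, hDact⟩ := h
  have hroot : ∀ y z : Ω, z ≠ 0 → y ^ p = z ^ p → ∃ s : ZMod p, y = (ζ : Ω) ^ s.val * z := by
    intro y z hz h
    obtain ⟨s, hs⟩ := exists_rootPow_eq hζ' (z := y / z) (by
      rw [div_pow, h, div_self (pow_ne_zero _ hz)])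
    exact ⟨s, (div_eq_iff hz).1 hs⟩
  have hDne : ∃ d ∈ D, d ≠ 1 := by
    by_contra! hcon
    have : D = ⊥ := (Subgroup.eq_bot_iff_forall D).2 hcon
    rw [this, Subgroup.card_bot] at hD
    exact hp.one_lt.ne hD
  obtain ⟨d, hdD, hd1⟩ := hDne
  obtain ⟨a, rfl⟩ := QuotientGroup.mk_surjective d
  obtain ⟨x, hx⟩ := IsAlgClosed.exists_pow_nat_eq ((a : K) : Ω) hp.pos
  have hx0 : x ≠ 0 := by
    rintro rfl
    rw [zero_pow hp.ne_zero] at hx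
    exact a.ne_zero (by ext; exact hx.symm)
  have hxL : x ∈ E ⊔ K := by
    rw [hDE, IntermediateField.mem_restrictScalars]
    exact IntermediateField.subset_adjoin _ _ ⟨a, hdD, hx⟩
  obtain ⟨ρ₁, hρ₁, hρ₁c⟩ := hc.exists_resK_translation 1
  have hfix (ρ : Gal(Ω/F)) (hρ : resK F Ω p ρ = 1) : ρ ((a : K) : Ω) = ((a : K) : Ω) :=
    resK_eq_one_iff.1 hρ _ (a : K).2
  obtain ⟨j, hj⟩ := hroot (ρ₁ x) x hx0 (by rw [← map_pow, hx, hfix ρ₁ hρ₁])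
  have hζfix (ρ : Gal(Ω/F)) (hρ : resK F Ω p ρ = 1) (n : ℕ) : ρ ((ζ : Ω) ^ n) = (ζ : Ω) ^ n :=
    resK_eq_one_iff.1 hρ _ (pow_mem ζ.2 n)
  have hpow (n : ℕ) : (ρ₁ ^ n) x = ((ζ : Ω) ^ j.val) ^ n * x ∧
      ∀ s, (ρ₁ ^ n) (c s) = c (s + n) := by
    induction n with
    | zero => simp
    | succ n ih =>
      refine ⟨?_, fun s => ?_⟩
      · rw [pow_succ', AlgEquiv.mul_apply, ih.1, map_mul, map_pow, hζfix _ hρ₁, hj]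
        ring
      · rw [pow_succ', AlgEquiv.mul_apply, ih.2, hρ₁c]
        push_cast
        rw [add_assoc]
  -- The automorphisms ρ and ρ₁^t agree on K and at c 0, hence on EK, which contains x.
  have hgen : ∀ (ρ : Gal(Ω/F)) (t : ZMod p), resK F Ω p ρ = 1 →
      (∀ s, ρ (c s) = c (s + t)) → ρ x = (ζ : Ω) ^ (j * t).val * x := by
    intro ρ t hρ ht
    have h1 := fixed_of_mem_sup (p := p) hE hxL (ρ := (ρ₁ ^ t.val)⁻¹ * ρ) (by simp [hρ, hρ₁]) (by
      rw [AlgEquiv.mul_apply, AlgEquiv.aut_inv, AlgEquiv.symm_apply_eq, (hpow _).2, ht,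
        ZMod.natCast_zmod_val])
    rw [AlgEquiv.mul_apply, AlgEquiv.aut_inv, AlgEquiv.symm_apply_eq, (hpow _).1] at h1
    rw [h1, rootPow_mul hζp]
  -- For j = 0 the element x would be fixed over K, so the chosen class in D would be trivial.
  have hj0 : j ≠ 0 := by
    rintro rfl
    have hxK : x ∈ K := mem_kummerField_of_fixed (hsep x) fun ρ hρ => by
      obtain ⟨t, ht⟩ := hc.exists_translation_of_resK hρ
      rw [hgen ρ t hρ ht]
      simp
    apply hd1
    rw [QuotientGroup.eq_one_iff]
    refine ⟨Units.mk0 ⟨x, hxK⟩ (by intro h; exact hx0 (congrArg Subtype.val h)), ?_⟩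
    ext
    exact hx
  ext σ
  obtain ⟨τ, rfl⟩ := resK_surjective σ
  have h1 := hDact (resK F Ω p τ) a hdD
  set m := (χ (resK F Ω p τ) : ZMod p) with hm
  rw [eq_comm, ← QuotientGroup.mk_pow, QuotientGroup.eq] at h1
  obtain ⟨y, hy⟩ := h1
  have hy' : Units.map (resK F Ω p τ : K →* K) a = a ^ m.val * y ^ p := by
    rw [show y ^ p = _ from hy, mul_inv_cancel_left]
  have hy'' : τ ((a : K) : Ω) = ((a : K) : Ω) ^ m.val * ((y : K) : Ω) ^ p := by
    rw [← resK_apply]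
    exact congrArg (fun u : Kˣ => ((u : K) : Ω)) hy'
  obtain ⟨s, hs⟩ := hroot (τ x) (x ^ m.val * ((y : K) : Ω))
    (mul_ne_zero (pow_ne_zero _ hx0) (by simp)) (by
      rw [← map_pow, hx, hy'', mul_pow, ← pow_mul, mul_comm m.val, pow_mul, hx])
  have h2 := hc.apply_apply_generator hζ hgen τ hρ₁ hρ₁c
  have h3 : ρ₁ (τ x) = (ζ : Ω) ^ (j * m).val * τ x := by
    rw [hs, map_mul, map_mul, hζfix _ hρ₁, map_pow, hj,
      resK_eq_one_iff.1 hρ₁ _ (y : K).2, rootPow_mul hζp]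
    ring
  rw [h3] at h2
  have h4 := rootPow_injective hζ' (mul_right_cancel₀ (by simpa using hx0) h2)
  rw [MonoidHom.mul_apply, MonoidHom.inv_apply, Units.val_mul, Units.val_inv_eq_inv_val]
  refine mul_left_cancel₀ hj0 ?_
  rw [h4]
  ring

end IsAffineSystem

end KummerTheory

/-! ### Artin-Schreier theory: the character in characteristic p. -/

section ArtinSchreier

variable {F : Type*} [Field F] [ValuativeRel F] [TopologicalSpace F]
  [IsNonarchimedeanLocalField F] {Ω : Type*} [Field Ω] [Algebra F Ω] [IsAlgClosure F Ω]
  {p : ℕ} [CharP 𝓀[F] p] [Fact p.Prime]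

theorem natCast_val_add {M : Type*} [Field M] [CharP M p] (s t : ZMod p) :
    ((s + t).val : M) = s.val + t.val := by
  have := map_add (ZMod.castHom (dvd_refl p) M) s t
  simpa only [ZMod.castHom_apply, ZMod.cast_eq_val] using this

theorem natCast_val_mul {M : Type*} [Field M] [CharP M p] (s t : ZMod p) :
    ((s * t).val : M) = s.val * t.val := by
  have := map_mul (ZMod.castHom (dvd_refl p) M) s t
  simpa only [ZMod.castHom_apply, ZMod.cast_eq_val] using this

theorem natCast_val_injective {M : Type*} [Field M] [CharP M p] {s t : ZMod p}
    (h : (s.val : M) = t.val) : s = t := by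
  apply (ZMod.castHom (dvd_refl p) M).injective
  rwa [ZMod.castHom_apply, ZMod.castHom_apply, ZMod.cast_eq_val, ZMod.cast_eq_val]

theorem natCast_pow_char {M : Type*} [Field M] [CharP M p] (n : ℕ) : (n : M) ^ p = n := by
  rw [← Nat.cast_pow, CharP.cast_eq_iff_mod_eq M p]
  exact (ZMod.natCast_eq_natCast_iff' _ _ _).1 (by simp)

theorem exists_val_eq_of_pow_sub {M : Type*} [Field M] [CharP M p] {z : M}
    (hz : z ^ p - z = 0) : ∃ s : ZMod p, z = s.val := by
  rw [sub_eq_zero, ← Subfield.mem_bot_iff_pow_eq_self, mem_bot_iff_intCast p] at hz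
  obtain ⟨n, rfl⟩ := hz
  refine ⟨(n : ZMod p), ?_⟩
  have := map_intCast (ZMod.castHom (dvd_refl p) M) n
  rw [ZMod.castHom_apply, ZMod.cast_eq_val] at this
  exact this.symm

namespace IsAffineSystem

variable {ψ : Character F Ω p} {c : ZMod p → Ω}

/-- The additive resolvent. -/
theorem exists_additive_resolvent [CharP Ω p] (hc : IsAffineSystem ψ c) :
    ∃ x : Ω, IsSeparable F x ∧ ∀ (ρ : Gal(Ω/F)) (t : ZMod p), 
      (∀ s, ρ (c s) = c (s + t)) → ρ x = x + t.val := by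
  obtain ⟨k, hk⟩ := hc.exists_sum_ne_zero (v := fun s => (1 : Ω)) (by simp)
  set T := ∑ s, 1 * c s ^ k with hT
  have hsepmem (y : Ω) : IsSeparable F y ↔ y ∈ separableClosure F Ω := mem_separableClosure_iff.symm
  refine ⟨-(∑ s : ZMod p, (s.val : Ω) * c s ^ k) / T, ?_, fun ρ t ht => ?_⟩
  · have h1 (s : ZMod p) : c s ∈ separableClosure F Ω := (hsepmem _).1 (hc.separable s)
    rw [hsepmem, hT]
    refine div_mem (neg_mem (sum_mem fun s _ => mul_mem (natCast_mem _ _) (pow_mem (h1 s) _)))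
      (sum_mem fun s _ => mul_mem (one_mem _) (pow_mem (h1 s) _))
  · have h1 : ρ T = T := by
      rw [hT, map_sum, ← Equiv.sum_comp (Equiv.addRight t) (fun s => 1 * c s ^ k)]
      refine Finset.sum_congr rfl fun s _ => ?_
      rw [map_mul, map_one, map_pow, ht, Equiv.coe_addRight]
    have h2 : ρ (∑ s : ZMod p, (s.val : Ω) * c s ^ k) =
        (∑ s : ZMod p, (s.val : Ω) * c s ^ k) - t.val * T := by
      rw [hT, Finset.mul_sum, ← Finset.sum_sub_distrib, map_sum,
        ← Equiv.sum_comp (Equiv.addRight t)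
          (fun s : ZMod p => (s.val : Ω) * c s ^ k - t.val * (1 * c s ^ k))]
      refine Finset.sum_congr rfl fun s _ => ?_
      rw [map_mul, map_natCast, map_pow, ht, Equiv.coe_addRight, natCast_val_add]
      ring
    rw [map_div₀, map_neg, h1, h2]
    field_simp
    ring

/-- The conjugation argument is the multiplicative one, except that τ fixes the integers that
replace roots of unity, so only ψ⁻¹ appears and no ω. -/
theorem apply_apply_additive_generator (hc : IsAffineSystem ψ c) {x : Ω} {j : ZMod p}
    (hx : ∀ (ρ : Gal(Ω/F)) (t : ZMod p), resK F Ω p ρ = 1 →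
      (∀ s, ρ (c s) = c (s + t)) → ρ x = x + (j * t).val)
    (τ : Gal(Ω/F)) {ρ : Gal(Ω/F)} {t : ZMod p} (hρ : resK F Ω p ρ = 1)
    (ht : ∀ s, ρ (c s) = c (s + t)) :
    ρ (τ x) = τ x + (j * ((ψ (resK F Ω p τ) : ZMod p)⁻¹ * t)).val := by
  have h1 := hx (τ⁻¹ * ρ * τ) _ (by simp [hρ]) (hc.conj_translation ht)
  have h2 : ρ (τ x) = τ ((τ⁻¹ * ρ * τ) x) := by
    rw [← AlgEquiv.mul_apply, ← AlgEquiv.mul_apply]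
    congr 1
    group
  rw [h2, h1, map_add, map_natCast]

/-- The additive resolvent x satisfies ρ(x) = x + t for a translation by t over K, so x^p - x lies
in K and spans D. For m = ψ(τ)⁻¹, the element τ(x) - m x is fixed over K. -/
theorem hasArtinSchreierCharacter [CharP F p] (hc : IsAffineSystem ψ c)
    {E : IntermediateField F Ω} (hE : E = IntermediateField.adjoin F {c 0}) :
    HasArtinSchreierCharacter E ψ⁻¹ := by
  have hp : p.Prime := Fact.out
  have : Algebra.IsAlgebraic F Ω := IsAlgClosure.isAlgebraic
  have : CharP Ω p := charP_of_injective_algebraMap (algebraMap F Ω).injective p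
  have hsepmem (y : Ω) : IsSeparable F y ↔ y ∈ separableClosure F Ω := mem_separableClosure_iff.symm
  set K := kummerField F Ω p with hK
  obtain ⟨x, hxsep, hx⟩ := hc.exists_additive_resolvent
  have haK : x ^ p - x ∈ K := by
    refine mem_kummerField_of_fixed ((hsepmem _).2 (sub_mem (pow_mem ((hsepmem _).1 hxsep) _)
      ((hsepmem _).1 hxsep))) fun ρ hρ => ?_
    obtain ⟨t, ht⟩ := hc.exists_translation_of_resK hρ
    rw [map_sub, map_pow, hx ρ t ht, add_pow_char, natCast_pow_char]
    ring
  have hxK : x ∉ K := by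
    intro hxK
    obtain ⟨ρ, hρ, hρ1⟩ := hc.exists_resK_translation 1
    have h1 := resK_eq_one_iff.1 hρ _ hxK
    rw [hx ρ 1 hρ1, ZMod.val_one, Nat.cast_one] at h1
    simp at h1
  let a : K := ⟨x ^ p - x, haK⟩
  let qa : K ⧸ (wp K p).range := QuotientAddGroup.mk a
  have hroot : ∀ y z : Ω, y ^ p - y = z ^ p - z → ∃ s : ZMod p, y = z + s.val := by
    intro y z h
    obtain ⟨s, hs⟩ := exists_val_eq_of_pow_sub (p := p) (z := y - z) (by
      rw [sub_pow_char]; linear_combination h)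
    exact ⟨s, by rw [← hs]; ring⟩
  have hmem : ∀ b : K, (QuotientAddGroup.mk b : K ⧸ (wp K p).range) ∈
      AddSubgroup.zmultiples qa → ∃ (i : ℤ) (y : K), b = i * a + (y ^ p - y) := by
    rintro b ⟨i, hi⟩
    change i • qa = _ at hi
    rw [← QuotientAddGroup.mk_zsmul, QuotientAddGroup.eq] at hi
    obtain ⟨y, hy⟩ := hi
    refine ⟨i, y, ?_⟩
    rw [show y ^ p - y = -(i • a) + b from hy, zsmul_eq_mul]
    ring
  refine ⟨AddSubgroup.zmultiples qa, ?_, ?_, ?_⟩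
  · rw [Nat.card_zmultiples]
    refine addOrderOf_eq_prime ?_ ?_
    · rw [← QuotientAddGroup.mk_nsmul, nsmul_eq_mul, CharP.cast_eq_zero, zero_mul]
      rfl
    · rw [Ne, QuotientAddGroup.eq_zero_iff]
      rintro ⟨y, hy⟩
      have hy' : (y : Ω) ^ p - (y : Ω) = x ^ p - x := congrArg Subtype.val hy
      obtain ⟨s, hs⟩ := hroot x y hy'.symm
      apply hxK
      rw [hs]
      exact add_mem y.2 (natCast_mem _ _)
  · have hKle : K ≤ E ⊔ K := le_sup_right
    apply le_antisymm
    · refine sup_le ?_ ?_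
      · rw [hE, IntermediateField.adjoin_simple_le_iff]
        refine mem_of_forall_fixed _ (hc.separable 0) fun τ hτ => ?_
        have hτK : resK F Ω p τ = 1 := resK_eq_one_iff.2 fun y hy => hτ y (by
          rw [IntermediateField.mem_restrictScalars]
          exact (IntermediateField.adjoin K _).algebraMap_mem ⟨y, hy⟩)
        have hτx : τ x = x := hτ x (by
          rw [IntermediateField.mem_restrictScalars]
          exact IntermediateField.subset_adjoin _ _ ⟨a, AddSubgroup.mem_zmultiples _, rfl⟩)
        obtain ⟨t, ht⟩ := hc.exists_translation_of_resK hτK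
        rw [hx τ t ht] at hτx
        have h2 : (t.val : Ω) = (0 : ZMod p).val := by simpa using hτx
        rw [ht, natCast_val_injective h2, add_zero]
      · intro y hy
        rw [IntermediateField.mem_restrictScalars]
        exact (IntermediateField.adjoin K _).algebraMap_mem ⟨y, hy⟩
    · have hle : IntermediateField.adjoin K {y : Ω | ∃ b : K,
          (QuotientAddGroup.mk b : K ⧸ (wp K p).range) ∈ AddSubgroup.zmultiples qa ∧
          y ^ p - y = algebraMap K Ω b} ≤ IntermediateField.extendScalars hKle := by
        rw [IntermediateField.adjoin_le_iff]
        rintro y ⟨b, hb, hy⟩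
        obtain ⟨i, u, rfl⟩ := hmem b hb
        have hi : (i : Ω) ^ p = i := by
          obtain ⟨n, hn⟩ : ∃ n : ℕ, (i : Ω) = n := ⟨(i : ZMod p).val, by
            have := map_intCast (ZMod.castHom (dvd_refl p) Ω) i
            rw [ZMod.castHom_apply, ZMod.cast_eq_val] at this
            exact this.symm⟩
          rw [hn, natCast_pow_char]
        have h1 : y ^ p - y = (i * x + (u : Ω)) ^ p - (i * x + (u : Ω)) := by
          rw [hy, add_pow_char, mul_pow, hi]
          have : algebraMap K Ω (i * a + (u ^ p - u)) = i * (x ^ p - x) + ((u : Ω) ^ p - u) := by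
            simp only [map_add, map_mul, map_intCast, map_sub, map_pow]
            rfl
          rw [this]
          ring
        obtain ⟨s, hs⟩ := hroot y _ h1
        have hxL : x ∈ E ⊔ K := hc.mem_sup_of_fixed hE hxsep fun ρ hρ h => by
          have := hx ρ 0 (fun s => by rw [h, add_zero])
          simpa using this
        have : y ∈ E ⊔ K := by
          rw [hs]
          exact add_mem (add_mem (mul_mem (intCast_mem _ _) hxL) (hKle u.2)) (natCast_mem _ _)
        exact this
      intro y hy
      exact hle hy
  · intro σ b hb
    obtain ⟨τ, rfl⟩ := resK_surjective σ
    set m := (ψ⁻¹ (resK F Ω p τ) : ZMod p) with hm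
    have hyK : τ x - m.val * x ∈ K := by
      refine mem_kummerField_of_fixed ?_ fun ρ hρ => ?_
      · have h1 : IsSeparable F (τ x) := by
          have := hxsep
          unfold IsSeparable at this ⊢
          rwa [minpoly.algEquiv_eq τ x]
        exact (hsepmem _).2 (sub_mem ((hsepmem _).1 h1)
          (mul_mem (natCast_mem _ _) ((hsepmem _).1 hxsep)))
      · obtain ⟨t, ht⟩ := hc.exists_translation_of_resK hρ
        rw [map_sub, map_mul, map_natCast, hc.apply_apply_additive_generator (j := 1)
          (fun ρ t hρ ht => by rw [one_mul]; exact hx ρ t ht) τ hρ ht, hx ρ t ht]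
        have : 1 * ((ψ (resK F Ω p τ) : ZMod p)⁻¹ * t) = m * t := by
          rw [hm, MonoidHom.inv_apply, Units.val_inv_eq_inv_val]
          ring
        rw [this, natCast_val_mul]
        ring
    let y : K := ⟨_, hyK⟩
    have hact : resK F Ω p τ a = m.val * a + (y ^ p - y) := by
      ext
      rw [resK_apply]
      change τ (x ^ p - x) = m.val * (x ^ p - x) + ((τ x - m.val * x) ^ p - (τ x - m.val * x))
      rw [sub_pow_char, mul_pow, natCast_pow_char, map_sub, map_pow]
      ring
    obtain ⟨i, u, rfl⟩ := hmem b hb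
    rw [← QuotientAddGroup.mk_nsmul, QuotientAddGroup.eq, map_add, map_mul, map_intCast, hact]
    have hi : (i : K) ^ p = i := by
      obtain ⟨n, hn⟩ : ∃ n : ℕ, (i : K) = n := ⟨(i : ZMod p).val, by
        have := map_intCast (ZMod.castHom (dvd_refl p) K) i
        rw [ZMod.castHom_apply, ZMod.cast_eq_val] at this
        exact this.symm⟩
      rw [hn, natCast_pow_char]
    refine ⟨-(i * y) - resK F Ω p τ u + m.val * u, ?_⟩
    change (-(i * y) - resK F Ω p τ u + m.val * u) ^ p - (-(i * y) - resK F Ω p τ u + m.val * u) = _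
    rw [add_pow_char, sub_pow_char, mul_pow, natCast_pow_char, ← neg_mul, mul_pow, neg_pow, hi,
      nsmul_eq_mul, map_sub, map_pow]
    -- Additivity of Frobenius gives this for p = 2 as well.
    have hneg : ((-1 : K)) ^ p = -1 := by
      have := sub_pow_char (0 : K) 1 (p := p)
      rw [zero_sub, one_pow, zero_pow hp.ne_zero, zero_sub] at this
      exact this
    rw [hneg]
    ring

/-- Any generator coming from D satisfies ρ(x) = x + jt with j ≠ 0; comparing two computations of
ρ(τ(x)) gives jm = jψ⁻¹. -/
theorem eq_of_hasArtinSchreierCharacter [CharP F p] (hc : IsAffineSystem ψ c)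
    {E : IntermediateField F Ω} (hE : E = IntermediateField.adjoin F {c 0})
    {χ : Character F Ω p} (h : HasArtinSchreierCharacter E χ) : χ = ψ⁻¹ := by
  have hp : p.Prime := Fact.out
  have : Algebra.IsAlgebraic F Ω := IsAlgClosure.isAlgebraic
  have : IsAlgClosed Ω := IsAlgClosure.isAlgClosed F
  have : CharP Ω p := charP_of_injective_algebraMap (algebraMap F Ω).injective p
  set K := kummerField F Ω p with hK
  obtain ⟨D, hD, hDE, hDact⟩ := h
  have hroot : ∀ y z : Ω, y ^ p - y = z ^ p - z → ∃ s : ZMod p, y = z + s.val := by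
    intro y z h
    obtain ⟨s, hs⟩ := exists_val_eq_of_pow_sub (p := p) (z := y - z) (by
      rw [sub_pow_char]; linear_combination h)
    exact ⟨s, by rw [← hs]; ring⟩
  have hDne : ∃ d ∈ D, d ≠ 0 := by
    by_contra! hcon
    have : D = ⊥ := (AddSubgroup.eq_bot_iff_forall D).2 hcon
    rw [this, AddSubgroup.card_bot] at hD
    exact hp.one_lt.ne hD
  obtain ⟨d, hdD, hd1⟩ := hDne
  obtain ⟨a, rfl⟩ := QuotientAddGroup.mk_surjective d
  -- Separability of the root is needed for the Galois arguments, as F is not perfect here; the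
  -- derivative of X^p - X - a is -1.
  obtain ⟨x, hx, hxsep⟩ : ∃ x : Ω, x ^ p - x = (a : Ω) ∧ IsSeparable K x := by
    have hmonic : (Polynomial.X ^ p - Polynomial.X - Polynomial.C a : Polynomial K).natDegree = p := by
      rw [sub_sub]
      rw [Polynomial.natDegree_sub_eq_left_of_natDegree_lt] <;> rw [Polynomial.natDegree_X_pow]
      exact (Polynomial.natDegree_add_le _ _).trans_lt (by simpa using hp.one_lt)
    have hsep : (Polynomial.X ^ p - Polynomial.X - Polynomial.C a : Polynomial K).Separable := by
      rw [Polynomial.separable_def]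
      simp only [Polynomial.derivative_sub, Polynomial.derivative_X_pow, Polynomial.derivative_X,
        Polynomial.derivative_C, CharP.cast_eq_zero, map_zero, zero_mul, zero_sub, sub_zero]
      exact isCoprime_one_right.neg_right
    obtain ⟨x, hx⟩ := IsAlgClosed.exists_aeval_eq_zero Ω
      (Polynomial.X ^ p - Polynomial.X - Polynomial.C a : Polynomial K) (by
        intro h
        have := Polynomial.natDegree_eq_of_degree_eq_some h
        rw [hmonic] at this
        exact hp.ne_zero this)
    refine ⟨x, ?_, hsep.of_dvd (minpoly.dvd _ _ hx)⟩
    simp only [map_sub, map_pow, Polynomial.aeval_X, Polynomial.aeval_C, sub_eq_zero] at hx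
    exact hx
  have hxL : x ∈ E ⊔ K := by
    rw [hDE, IntermediateField.mem_restrictScalars]
    exact IntermediateField.subset_adjoin _ _ ⟨a, hdD, hx⟩
  obtain ⟨ρ₁, hρ₁, hρ₁c⟩ := hc.exists_resK_translation 1
  have hfix (ρ : Gal(Ω/F)) (hρ : resK F Ω p ρ = 1) : ρ (a : Ω) = (a : Ω) :=
    resK_eq_one_iff.1 hρ _ a.2
  obtain ⟨j, hj⟩ := hroot (ρ₁ x) x (by rw [← map_pow, ← map_sub, hx, hfix ρ₁ hρ₁])
  have hpow (n : ℕ) : (ρ₁ ^ n) x = x + n * j.val ∧ ∀ s, (ρ₁ ^ n) (c s) = c (s + n) := by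
    induction n with
    | zero => simp
    | succ n ih =>
      refine ⟨?_, fun s => ?_⟩
      · rw [pow_succ', AlgEquiv.mul_apply, ih.1, map_add, map_mul, map_natCast, map_natCast, hj]
        push_cast
        ring
      · rw [pow_succ', AlgEquiv.mul_apply, ih.2, hρ₁c]
        push_cast
        rw [add_assoc]
  have hgen : ∀ (ρ : Gal(Ω/F)) (t : ZMod p), resK F Ω p ρ = 1 →
      (∀ s, ρ (c s) = c (s + t)) → ρ x = x + (j * t).val := by
    intro ρ t hρ ht
    have h1 := fixed_of_mem_sup (p := p) hE hxL (ρ := (ρ₁ ^ t.val)⁻¹ * ρ) (by simp [hρ, hρ₁]) (by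
      rw [AlgEquiv.mul_apply, AlgEquiv.aut_inv, AlgEquiv.symm_apply_eq, (hpow _).2, ht,
        ZMod.natCast_zmod_val])
    rw [AlgEquiv.mul_apply, AlgEquiv.aut_inv, AlgEquiv.symm_apply_eq, (hpow _).1] at h1
    rw [h1, natCast_val_mul, mul_comm]
  have hj0 : j ≠ 0 := by
    rintro rfl
    have hxsepF : IsSeparable F x := IsSeparable.of_algebra_isSeparable_of_isSeparable F hxsep
    have hxK : x ∈ K := mem_kummerField_of_fixed hxsepF fun ρ hρ => by
      obtain ⟨t, ht⟩ := hc.exists_translation_of_resK hρ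
      rw [hgen ρ t hρ ht]
      simp
    apply hd1
    rw [QuotientAddGroup.eq_zero_iff]
    refine ⟨⟨x, hxK⟩, ?_⟩
    ext
    exact hx
  ext σ
  obtain ⟨τ, rfl⟩ := resK_surjective σ
  have h1 := hDact (resK F Ω p τ) a hdD
  set m := (χ (resK F Ω p τ) : ZMod p) with hm
  rw [eq_comm, ← QuotientAddGroup.mk_nsmul, QuotientAddGroup.eq] at h1
  obtain ⟨y, hy⟩ := h1
  have hy'' : τ (a : Ω) = m.val * (a : Ω) + ((y : Ω) ^ p - y) := by
    rw [← resK_apply]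
    have h2 : (y : Ω) ^ p - y = -(m.val • (a : Ω)) + (resK F Ω p τ a : K) :=
      congrArg Subtype.val hy
    rw [h2, nsmul_eq_mul]
    ring
  obtain ⟨s, hs⟩ := hroot (τ x) (m.val * x + y) (by
      rw [← map_pow, ← map_sub, hx, hy'', add_pow_char, mul_pow, natCast_pow_char, ← hx]
      ring)
  have h2 := hc.apply_apply_additive_generator hgen τ hρ₁ hρ₁c
  have h3 : ρ₁ (τ x) = τ x + (j * m).val := by
    rw [hs, map_add, map_add, map_natCast, map_mul, map_natCast, hj,
      resK_eq_one_iff.1 hρ₁ _ y.2, natCast_val_mul]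
    ring
  rw [h3] at h2
  have h4 := natCast_val_injective (add_left_cancel h2)
  rw [MonoidHom.inv_apply, Units.val_inv_eq_inv_val]
  refine mul_left_cancel₀ hj0 ?_
  rw [h4]
  ring

/-- The character attached to the field generated by an affine system. -/
theorem hasCharacter_iff (hc : IsAffineSystem ψ c) {E : IntermediateField F Ω}
    (hE : E = IntermediateField.adjoin F {c 0}) (hF : CharZero F ∨ CharP F p)
    (χ : Character F Ω p) : HasCharacter E χ ↔ χ = cyclotomicChar F Ω p * ψ⁻¹ := by
  have hp : p.Prime := Fact.out
  unfold HasCharacter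
  rcases hF with hF | hF
  · have hno : ¬ CharP F p := fun h => hp.ne_zero (CharP.eq F h (CharP.ofCharZero F))
    constructor
    · rintro (⟨-, h⟩ | ⟨h, -⟩)
      · exact hc.eq_of_hasKummerCharacter hE h
      · exact absurd h hno
    · rintro rfl
      exact Or.inl ⟨hF, hc.hasKummerCharacter hE⟩
  · have hno : ¬ CharZero F := fun h => hp.ne_zero (CharP.eq F hF (CharP.ofCharZero F))
    rw [cyclotomicChar_eq_one, show (1 : Character F Ω p) * ψ⁻¹ = ψ⁻¹ by
      ext σ; rw [MonoidHom.mul_apply, MonoidHom.one_apply, one_mul]]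
    constructor
    · rintro (⟨h, -⟩ | ⟨h, h'⟩)
      · exact absurd h hno
      · exact hc.eq_of_hasArtinSchreierCharacter hE h'
    · rintro rfl
      exact Or.inr ⟨hF, hc.hasArtinSchreierCharacter hE⟩

end IsAffineSystem

end ArtinSchreier

open Polynomial

/-! ### Expansions in powers of a uniformizer and Eisenstein polynomials. -/

section Eisenstein

variable {F : Type*} [Field F] [ValuativeRel F] [TopologicalSpace F]
  [IsNonarchimedeanLocalField F] {Ω : Type*} [Field Ω] [Algebra F Ω]
  {w : Valuation Ω ℝ≥0} {p : ℕ} [CharP 𝓀[F] p] [Fact p.Prime] {ϖ : F} {π : Ω}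

/-- The absolute value of x π^l is |π|^(p v(x) + l), and |π| is neither 0 nor 1, so the exponent is
determined. Modulo p it recovers l. -/
theorem IsExtendedValuation.exponent_eq (hw : IsExtendedValuation F w) (h0 : ϖ ≠ 0)
    (hϖ : val F ϖ = 1) (hπ : w π ^ p = w (algebraMap F Ω ϖ)) {x y : F} (hx : x ≠ 0) (hy : y ≠ 0)
    {l m : ℕ} (h : w (algebraMap F Ω x * π ^ l) = w (algebraMap F Ω y * π ^ m)) :
    p * val F x + l = p * val F y + m := by
  have hp : p.Prime := Fact.out
  have hwϖ0 : w (algebraMap F Ω ϖ) ≠ 0 := by simpa using h0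
  have hπ0 : w π ≠ 0 := by
    intro h1
    rw [h1, zero_pow hp.ne_zero] at hπ
    exact hwϖ0 hπ.symm
  rw [map_mul, map_mul, map_pow, map_pow, hw.eq_zpow h0 hϖ hx, hw.eq_zpow h0 hϖ hy, ← hπ,
    ← zpow_natCast, ← zpow_natCast, ← zpow_natCast, ← zpow_mul, ← zpow_mul, ← zpow_add₀ hπ0,
    ← zpow_add₀ hπ0] at h
  refine zpow_right_injective₀ (zero_lt_iff.2 hπ0) ?_ h
  intro h1
  rw [h1, one_pow] at hπ
  exact (hw.uniformizer_lt_one h0 hϖ).ne hπ.symm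

/-- There is no cancellation in the expansion of an element in powers of a uniformizer. -/
theorem IsExtendedValuation.exists_dominant (hw : IsExtendedValuation F w) (h0 : ϖ ≠ 0)
    (hϖ : val F ϖ = 1) (hπ : w π ^ p = w (algebraMap F Ω ϖ)) {P : F[X]} (hP : P.natDegree < p)
    (hP0 : P ≠ 0) : ∃ j < p, P.coeff j ≠ 0 ∧
      w (aeval π P) = w (algebraMap F Ω (P.coeff j) * π ^ j) ∧
      w (aeval π P - algebraMap F Ω (P.coeff j) * π ^ j) < w (aeval π P) ∧
      ∀ l, l ≠ j → P.coeff l ≠ 0 → w (algebraMap F Ω (P.coeff l) * π ^ l) < w (aeval π P) := by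
  have hp : p.Prime := Fact.out
  have hwϖ0 : w (algebraMap F Ω ϖ) ≠ 0 := by simpa using h0
  have hπ0 : π ≠ 0 := by
    rintro rfl
    rw [map_zero, zero_pow hp.ne_zero] at hπ
    exact hwϖ0 hπ.symm
  have hsum : aeval π P = ∑ l ∈ Finset.range p, algebraMap F Ω (P.coeff l) * π ^ l := by
    rw [aeval_eq_sum_range' hP]
    simp [Algebra.smul_def]
  set T : ℕ → Ω := fun l => algebraMap F Ω (P.coeff l) * π ^ l with hT
  obtain ⟨j, hj, hjmax⟩ := Finset.exists_max_image (Finset.range p) (fun l => w (T l))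
    ⟨0, by simpa using hp.pos⟩
  have hnz : P.coeff P.natDegree ≠ 0 := by simpa using hP0
  have hT0 (l : ℕ) : w (T l) = 0 ↔ P.coeff l = 0 := by simp [hT, hπ0]
  have hj0 : P.coeff j ≠ 0 := by
    rw [Ne, ← hT0]
    intro h
    have h1 := hjmax P.natDegree (Finset.mem_range.2 hP)
    rw [h, le_zero_iff, hT0] at h1
    exact hnz h1
  have hTj : 0 < w (T j) := by rw [zero_lt_iff, Ne, hT0]; exact hj0
  have hlt (l : ℕ) (hlj : l ≠ j) (hl0 : P.coeff l ≠ 0) : w (T l) < w (T j) := by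
    have hl : l ∈ Finset.range p :=
      Finset.mem_range.2 ((le_natDegree_of_ne_zero hl0).trans_lt hP)
    refine lt_of_le_of_ne (hjmax l hl) fun heq => hlj ?_
    have h1 := hw.exponent_eq h0 hϖ hπ hl0 hj0 heq
    have h2 : (l : ℤ) ≡ j [ZMOD p] := by
      refine Int.modEq_iff_dvd.2 ⟨val F (P.coeff l) - val F (P.coeff j), ?_⟩
      linear_combination -h1
    rw [Int.natCast_modEq_iff] at h2
    exact Nat.ModEq.eq_of_lt_of_lt h2 (Finset.mem_range.1 hl) (Finset.mem_range.1 hj)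
  have hlt' : w (∑ l ∈ (Finset.range p).erase j, T l) < w (T j) := by
    refine w.map_sum_lt hTj.ne' fun l hl => ?_
    by_cases hl0 : P.coeff l = 0
    · rwa [(hT0 l).2 hl0]
    · exact hlt l (Finset.ne_of_mem_erase hl) hl0
  have hdiff : aeval π P - T j = ∑ l ∈ (Finset.range p).erase j, T l := by
    rw [hsum, ← Finset.add_sum_erase _ _ hj, add_sub_cancel_left]
  have heq : w (aeval π P) = w (T j) := by
    rw [hsum, ← Finset.add_sum_erase _ _ hj, w.map_add_eq_of_lt_left hlt']
  refine ⟨j, Finset.mem_range.1 hj, hj0, heq, by rw [hdiff, heq]; exact hlt', ?_⟩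
  intro l hlj hl0
  rw [heq]
  exact hlt l hlj hl0

theorem IsExtendedValuation.coeff_le (hw : IsExtendedValuation F w) (h0 : ϖ ≠ 0)
    (hϖ : val F ϖ = 1) (hπ : w π ^ p = w (algebraMap F Ω ϖ)) {P : F[X]} (hP : P.natDegree < p)
    (l : ℕ) : w (algebraMap F Ω (P.coeff l) * π ^ l) ≤ w (aeval π P) := by
  by_cases hl : P.coeff l = 0
  · simp [hl]
  have hP0 : P ≠ 0 := by rintro rfl; simp at hl
  obtain ⟨j, -, -, h1, -, h2⟩ := hw.exists_dominant h0 hϖ hπ hP hP0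
  by_cases hlj : l = j
  · rw [hlj, h1]
  · exact (h2 l hlj hl).le

theorem IsExtendedValuation.aeval_ne_zero (hw : IsExtendedValuation F w) (h0 : ϖ ≠ 0)
    (hϖ : val F ϖ = 1) (hπ : w π ^ p = w (algebraMap F Ω ϖ)) {P : F[X]} (hP : P.natDegree < p)
    (hP0 : P ≠ 0) : aeval π P ≠ 0 := by
  obtain ⟨j, -, -, -, h1, -⟩ := hw.exists_dominant h0 hϖ hπ hP hP0
  intro h
  rw [h, map_zero] at h1
  exact not_lt_zero h1

/-- An Eisenstein polynomial: monic of degree `p`, its coefficients below the leading one are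
divisible by `ϖ`, and its constant coefficient is a uniformizer. -/
structure IsEisensteinPoly (w : Valuation Ω ℝ≥0) (p : ℕ) (ϖ : F) (f : F[X]) : Prop where
  monic : f.Monic
  natDegree_eq : f.natDegree = p
  coeff_le (l : ℕ) : l < p → w (algebraMap F Ω (f.coeff l)) ≤ w (algebraMap F Ω ϖ)
  coeff_zero : w (algebraMap F Ω (f.coeff 0)) = w (algebraMap F Ω ϖ)

theorem uniformizer_ne_zero (h0 : ϖ ≠ 0) (hπ : w π ^ p = w (algebraMap F Ω ϖ)) : π ≠ 0 := by
  have hp : p.Prime := Fact.out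
  rintro rfl
  rw [map_zero, zero_pow hp.ne_zero, eq_comm] at hπ
  simp [h0] at hπ

theorem IsExtendedValuation.lt_one_of_pow_eq (hw : IsExtendedValuation F w) (h0 : ϖ ≠ 0)
    (hϖ : val F ϖ = 1) (hπ : w π ^ p = w (algebraMap F Ω ϖ)) : w π < 1 := by
  have hp : p.Prime := Fact.out
  have := hw.uniformizer_lt_one h0 hϖ
  rw [← hπ] at this
  exact (pow_lt_one_iff hp.ne_zero).1 this

theorem IsEisensteinPoly.aeval_eq {f : F[X]} (hf : IsEisensteinPoly w p ϖ f) (x : Ω) :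
    aeval x f = ∑ l ∈ Finset.range p, algebraMap F Ω (f.coeff l) * x ^ l + x ^ p := by
  rw [aeval_eq_sum_range, hf.natDegree_eq, Finset.sum_range_succ]
  have : f.coeff p = 1 := by rw [← hf.natDegree_eq]; exact hf.monic.coeff_natDegree
  simp [Algebra.smul_def, this]

/-- If |π| ≥ 1, the term π^p would dominate and f(π) could not vanish. For |π| < 1 the middle terms
are smaller than a_0, so π^p has the absolute value of a_0. -/
theorem IsEisensteinPoly.root (hw : IsExtendedValuation F w) (h0 : ϖ ≠ 0)
    (hϖ : val F ϖ = 1) {f : F[X]} (hf : IsEisensteinPoly w p ϖ f) (h : aeval π f = 0) :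
    w π ^ p = w (algebraMap F Ω ϖ) := by
  have hp : p.Prime := Fact.out
  have hϖ1 := hw.uniformizer_lt_one h0 hϖ
  have hϖ0 : 0 < w (algebraMap F Ω ϖ) := by rw [zero_lt_iff]; simpa using h0
  rw [hf.aeval_eq] at h
  have hlt : w π < 1 := by
    by_contra! hge
    have h1 : w (∑ l ∈ Finset.range p, algebraMap F Ω (f.coeff l) * π ^ l) < w (π ^ p) := by
      have hpos : 0 < w (π ^ p) := by rw [map_pow]; exact pow_pos (zero_lt_one.trans_le hge) _
      refine w.map_sum_lt hpos.ne' fun l hl => ?_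
      rw [Finset.mem_range] at hl
      rw [map_mul, map_pow, map_pow]
      calc w (algebraMap F Ω (f.coeff l)) * w π ^ l < 1 * w π ^ l := by
            refine mul_lt_mul_of_pos_right ((hf.coeff_le l hl).trans_lt hϖ1) ?_
            exact pow_pos (zero_lt_one.trans_le hge) _
        _ ≤ w π ^ p := by rw [one_mul]; exact pow_le_pow_right₀ hge hl.le
    have h2 := w.map_add_eq_of_lt_left h1
    rw [add_comm, h, map_zero] at h2
    rw [← h2] at h1
    exact not_lt_zero h1
  obtain ⟨n, rfl⟩ : ∃ n, p = n + 1 := ⟨p - 1, by have := hp.two_le; omega⟩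
  rw [Finset.sum_range_succ', pow_zero, mul_one] at h
  have h1 : w (∑ l ∈ Finset.range n, algebraMap F Ω (f.coeff (l + 1)) * π ^ (l + 1)) <
      w (algebraMap F Ω (f.coeff 0)) := by
    rw [hf.coeff_zero]
    refine w.map_sum_lt hϖ0.ne' fun l hl => ?_
    rw [Finset.mem_range] at hl
    rw [map_mul, map_pow]
    calc _ ≤ w (algebraMap F Ω ϖ) * w π ^ (l + 1) :=
          mul_le_mul_left (hf.coeff_le _ (by omega)) _
      _ < w (algebraMap F Ω ϖ) :=
          mul_lt_of_lt_one_right hϖ0 (pow_lt_one₀ zero_le hlt (by omega))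
  have h2 := w.map_add_eq_of_lt_right h1
  have h3 := eq_neg_of_add_eq_zero_right h
  have h4 := congrArg w h3
  rw [w.map_neg, h2, hf.coeff_zero, map_pow] at h4
  exact h4

/-- In the absence of cancellation, no nonzero polynomial of degree less than p vanishes at π. -/
theorem IsEisensteinPoly.minpoly_eq [Algebra.IsAlgebraic F Ω] (hw : IsExtendedValuation F w)
    (h0 : ϖ ≠ 0) (hϖ : val F ϖ = 1) {f : F[X]} (hf : IsEisensteinPoly w p ϖ f)
    (h : aeval π f = 0) : minpoly F π = f := by
  have hπ := hf.root hw h0 hϖ h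
  have hintegral : IsIntegral F π := Algebra.IsIntegral.isIntegral π
  refine (eq_of_monic_of_dvd_of_natDegree_le (minpoly.monic hintegral) hf.monic (minpoly.dvd F π h)
    ?_).symm
  rw [hf.natDegree_eq]
  by_contra! hlt
  exact hw.aeval_ne_zero h0 hϖ hπ hlt (minpoly.ne_zero hintegral) (minpoly.aeval F π)

/-- The value of f - X^p at π is -π^p, and without cancellation this bounds every term. The dominant
term has an exponent divisible by p, so it is the constant one. -/
theorem IsExtendedValuation.isEisensteinPoly_minpoly [Algebra.IsAlgebraic F Ω]
    (hw : IsExtendedValuation F w) (h0 : ϖ ≠ 0) (hϖ : val F ϖ = 1)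
    (hπ : w π ^ p = w (algebraMap F Ω ϖ)) (hdeg : (minpoly F π).natDegree ≤ p) :
    IsEisensteinPoly w p ϖ (minpoly F π) := by
  have hp : p.Prime := Fact.out
  have hintegral : IsIntegral F π := Algebra.IsIntegral.isIntegral π
  have hϖ0 : 0 < w (algebraMap F Ω ϖ) := by rw [zero_lt_iff]; simpa using h0
  have hπ0 := uniformizer_ne_zero h0 hπ
  have hπ1 := hw.lt_one_of_pow_eq h0 hϖ hπ
  have hdeg' : (minpoly F π).natDegree = p := by
    refine le_antisymm hdeg ?_
    by_contra! hlt
    exact hw.aeval_ne_zero h0 hϖ hπ hlt (minpoly.ne_zero hintegral) (minpoly.aeval F π)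
  have hmonic := minpoly.monic hintegral
  set f := minpoly F π with hf
  have hfX : f - X ^ p ≠ 0 := by
    intro h
    rw [sub_eq_zero] at h
    have := minpoly.aeval F π
    rw [← hf, h, map_pow, aeval_X] at this
    exact hπ0 (pow_eq_zero_iff hp.ne_zero |>.1 this)
  have hdegP : (f - X ^ p).natDegree < p := by
    rcases lt_or_ge (f - X ^ p).natDegree p with h | h
    · exact h
    · exfalso
      have h1 : (f - X ^ p).natDegree ≤ p :=
        (natDegree_sub_le _ _).trans (by rw [hdeg', natDegree_X_pow, max_self])
      have h2 : (f - X ^ p).coeff p = 0 := by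
        rw [coeff_sub, coeff_X_pow_self, ← hdeg', hmonic.coeff_natDegree, sub_self]
      have h3 := leadingCoeff_ne_zero.2 hfX
      rw [leadingCoeff, le_antisymm h1 h] at h3
      exact h3 h2
  have hcoeff (l : ℕ) (hl : l < p) : (f - X ^ p).coeff l = f.coeff l := by
    rw [coeff_sub, coeff_X_pow, if_neg hl.ne, sub_zero]
  have hval : w (aeval π (f - X ^ p)) = w (algebraMap F Ω ϖ) := by
    rw [map_sub, minpoly.aeval, map_pow, aeval_X, zero_sub, w.map_neg, map_pow, hπ]
  have hle (l : ℕ) (hl : l < p) : w (algebraMap F Ω (f.coeff l) * π ^ l) ≤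
      w (algebraMap F Ω ϖ) := by
    have := hw.coeff_le h0 hϖ hπ hdegP l
    rwa [hval, hcoeff l hl] at this
  refine ⟨hmonic, hdeg', fun l hl => ?_, ?_⟩
  · by_cases hl0 : f.coeff l = 0
    · simp [hl0]
    have h1 := hle l hl
    rw [map_mul, map_pow] at h1
    have h2 : w (algebraMap F Ω (f.coeff l)) < 1 := by
      by_contra! hge
      have : w π ^ p < w π ^ l :=
        pow_lt_pow_right_of_lt_one₀ (by rw [zero_lt_iff]; simpa using hπ0) hπ1 hl
      rw [← hπ] at h1
      have h3 : w π ^ l ≤ w (algebraMap F Ω (f.coeff l)) * w π ^ l :=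
        le_mul_of_one_le_left' hge
      exact absurd (h3.trans h1) (not_le.2 this)
    rw [hw.algebraMap_lt_one_iff, ← map_one (valuation F), ← val_lt_val_iff one_ne_zero hl0,
      val_one] at h2
    rw [hw.le_iff, ← not_lt, ← val_lt_val_iff hl0 h0, hϖ]
    omega
  · obtain ⟨j, hj, hj0, hjeq, -, -⟩ := hw.exists_dominant h0 hϖ hπ hdegP hfX
    rw [hcoeff j hj] at hj0 hjeq
    rw [hval] at hjeq
    have h1 := hw.exponent_eq (p := p) (l := 0) (m := j) h0 hϖ hπ h0 hj0 (by rw [← hjeq]; simp)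
    have hj' : j = 0 := by
      have : (j : ℤ) = p * (val F ϖ - val F (f.coeff j)) := by push_cast at h1; linear_combination -h1
      have h3 : (p : ℤ) ∣ j := ⟨_, this⟩
      rw [Int.natCast_dvd_natCast] at h3
      exact Nat.eq_zero_of_dvd_of_lt h3 hj
    rw [hj', pow_zero, mul_one] at hjeq
    exact hjeq.symm

/-- For a root `π` of an Eisenstein polynomial, `π ^ p` is close to minus the constant term. -/
theorem IsEisensteinPoly.pow_near (hw : IsExtendedValuation F w) (h0 : ϖ ≠ 0)
    (hϖ : val F ϖ = 1) {f : F[X]} (hf : IsEisensteinPoly w p ϖ f) (h : aeval π f = 0) :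
    w (π ^ p - algebraMap F Ω (-f.coeff 0)) < w (algebraMap F Ω ϖ) := by
  have hp : p.Prime := Fact.out
  have hϖ0 : 0 < w (algebraMap F Ω ϖ) := by rw [zero_lt_iff]; simpa using h0
  have hπ1 := hw.lt_one_of_pow_eq h0 hϖ (hf.root hw h0 hϖ h)
  rw [hf.aeval_eq] at h
  obtain ⟨n, rfl⟩ : ∃ n, p = n + 1 := ⟨p - 1, by have := hp.two_le; omega⟩
  rw [Finset.sum_range_succ', pow_zero, mul_one] at h
  have h1 : π ^ (n + 1) - algebraMap F Ω (-f.coeff 0) =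
      -∑ l ∈ Finset.range n, algebraMap F Ω (f.coeff (l + 1)) * π ^ (l + 1) := by
    rw [map_neg]
    linear_combination h
  rw [h1, w.map_neg]
  refine w.map_sum_lt hϖ0.ne' fun l hl => ?_
  rw [Finset.mem_range] at hl
  rw [map_mul, map_pow]
  calc _ ≤ w (algebraMap F Ω ϖ) * w π ^ (l + 1) :=
        mul_le_mul_left (hf.coeff_le _ (by omega)) _
    _ < w (algebraMap F Ω ϖ) :=
        mul_lt_of_lt_one_right hϖ0 (pow_lt_one₀ zero_le hπ1 (by omega))

end Eisenstein

/-! ### Differences of the roots of an Eisenstein polynomial. -/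

section Conjugates

variable {F : Type*} [Field F] [ValuativeRel F] [TopologicalSpace F]
  [IsNonarchimedeanLocalField F] {Ω : Type*} [Field Ω] [Algebra F Ω]
  {w : Valuation Ω ℝ≥0} {p : ℕ} [CharP 𝓀[F] p] [Fact p.Prime] {ϖ : F} {π : Ω}

theorem exists_one_add_pow_eq (w : Valuation Ω ℝ≥0) {z : Ω} (hz : w z ≤ 1) (l : ℕ) :
    ∃ g : Ω, w g ≤ 1 ∧ (1 + z) ^ l = 1 + l * z + z ^ 2 * g := by
  induction l with
  | zero => exact ⟨0, by simp, by simp⟩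
  | succ l ih =>
    obtain ⟨g, hg, h⟩ := ih
    refine ⟨l + g + z * g, ?_, ?_⟩
    · refine w.map_add_le (w.map_add_le (IsExtendedValuation.natCast_le_one w l) hg) ?_
      rw [map_mul]
      exact mul_le_one' hz hg
    · rw [pow_succ, h]
      push_cast
      ring

/-- The inner binomial coefficients are divisible by p. Keeping this factor in the remainder lets
the term of index p be bounded by p π^p, as are the other terms of the derivative. -/
theorem exists_one_add_pow_prime_eq (w : Valuation Ω ℝ≥0) {z : Ω} (hz : w z ≤ 1) :
    ∃ g : Ω, w g ≤ 1 ∧ (1 + z) ^ p = 1 + p * z + z ^ 2 * (p * g) + z ^ p := by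
  have hp : p.Prime := Fact.out
  obtain ⟨n, rfl⟩ : ∃ n, p = n + 2 := ⟨p - 2, by have := hp.two_le; omega⟩
  refine ⟨∑ k ∈ Finset.range n, z ^ k * (((n + 2).choose (k + 2) / (n + 2) : ℕ) : Ω), ?_, ?_⟩
  · refine w.map_sum_le fun k _ => ?_
    rw [map_mul, map_pow]
    exact mul_le_one' (pow_le_one' hz _) (IsExtendedValuation.natCast_le_one w _)
  · rw [add_comm 1 z, add_pow, Finset.sum_range_succ, Finset.sum_range_succ',
      Finset.sum_range_succ']
    simp only [one_pow, mul_one, Nat.choose_self, Nat.cast_one, Finset.mul_sum]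
    have h1 : ∀ k ∈ Finset.range n, z ^ (k + 1 + 1) * ((n + 2).choose (k + 1 + 1) : Ω) =
        z ^ 2 * (((n + 2 : ℕ) : Ω) * (z ^ k * (((n + 2).choose (k + 2) / (n + 2) : ℕ) : Ω))) := by
      intro k hk
      rw [Finset.mem_range] at hk
      have hdvd : (n + 2) ∣ (n + 2).choose (k + 2) :=
        hp.dvd_choose_self (by omega) (by omega)
      have h2 : ((n + 2).choose (k + 2) : Ω) =
          ((n + 2 : ℕ) : Ω) * (((n + 2).choose (k + 2) / (n + 2) : ℕ) : Ω) := by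
        rw [← Nat.cast_mul, Nat.mul_div_cancel' hdvd]
      rw [show k + 1 + 1 = k + 2 by ring, h2]
      ring
    rw [Finset.sum_congr rfl h1]
    simp
    ring

theorem IsEisensteinPoly.coeff_self {f : F[X]} (hf : IsEisensteinPoly w p ϖ f) : f.coeff p = 1 := by
  rw [← hf.natDegree_eq]; exact hf.monic.coeff_natDegree

theorem IsEisensteinPoly.natDegree_derivative_lt {f : F[X]} (hf : IsEisensteinPoly w p ϖ f) :
    f.derivative.natDegree < p := by
  have hp : p.Prime := Fact.out
  have := Polynomial.natDegree_derivative_lt (p := f) (by rw [hf.natDegree_eq]; exact hp.ne_zero)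
  rwa [hf.natDegree_eq] at this

/-- Multiplication by π restores the exponent l in each term l a_l π^l. -/
theorem IsEisensteinPoly.derivative_mul_eq {f : F[X]} (hf : IsEisensteinPoly w p ϖ f) :
    aeval π f.derivative * π =
      ∑ l ∈ Finset.range (p + 1), l * (algebraMap F Ω (f.coeff l) * π ^ l) := by
  rw [aeval_eq_sum_range' hf.natDegree_derivative_lt, Finset.sum_range_succ', Finset.sum_mul]
  simp only [Nat.cast_zero, zero_mul, add_zero]
  refine Finset.sum_congr rfl fun l _ => ?_
  rw [coeff_derivative, Algebra.smul_def, map_mul]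
  push_cast
  ring

/-- The expansion of f'(π) has no cancellation, so each term is at most the sum. -/
theorem IsEisensteinPoly.natCast_mul_coeff_le (hw : IsExtendedValuation F w) (h0 : ϖ ≠ 0)
    (hϖ : val F ϖ = 1) {f : F[X]} (hf : IsEisensteinPoly w p ϖ f) (h : aeval π f = 0) (l : ℕ) :
    w (l * (algebraMap F Ω (f.coeff l) * π ^ l)) ≤ w (aeval π f.derivative * π) := by
  rcases l with _ | l
  · simp
  have hπ := hf.root hw h0 hϖ h
  have h1 := hw.coeff_le h0 hϖ hπ hf.natDegree_derivative_lt l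
  rw [coeff_derivative] at h1
  rw [map_mul w (aeval π f.derivative)]
  refine le_of_eq_of_le ?_ (mul_le_mul_left h1 (w π))
  rw [← map_mul]
  congr 1
  simp only [map_mul, map_add, map_natCast, map_one]
  push_cast
  ring

/-- The term of index p is small because |p| < 1, the inner ones because ϖ divides a_l and |π| < 1,
and the term of index 0 vanishes. The strict inequality forces π' - π to be smaller than π. -/
theorem IsEisensteinPoly.derivative_mul_lt (hw : IsExtendedValuation F w) (h0 : ϖ ≠ 0)
    (hϖ : val F ϖ = 1) {f : F[X]} (hf : IsEisensteinPoly w p ϖ f) (h : aeval π f = 0) :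
    w (aeval π f.derivative * π) < w (algebraMap F Ω ϖ) := by
  have hp : p.Prime := Fact.out
  have hϖ0 : 0 < w (algebraMap F Ω ϖ) := by rw [zero_lt_iff]; simpa using h0
  have hπ := hf.root hw h0 hϖ h
  have hπ1 := hw.lt_one_of_pow_eq h0 hϖ hπ
  rw [hf.derivative_mul_eq]
  refine w.map_sum_lt hϖ0.ne' fun l hl => ?_
  rw [map_mul, map_mul, map_pow]
  rcases Nat.eq_zero_or_pos l with rfl | hl0
  · simpa using hϖ0
  rcases eq_or_lt_of_le (Nat.lt_succ_iff.1 (Finset.mem_range.1 hl)) with rfl | hlp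
  · rw [hf.coeff_self, map_one, map_one, one_mul, hπ]
    exact mul_lt_of_lt_one_left hϖ0 ((hw.natCast_lt_one_iff (p := l) l).2 dvd_rfl)
  · calc _ ≤ 1 * (w (algebraMap F Ω ϖ) * w π ^ l) :=
          mul_le_mul' (IsExtendedValuation.natCast_le_one w l)
            (mul_le_mul_left (hf.coeff_le l hlp) _)
      _ < w (algebraMap F Ω ϖ) := by
          rw [one_mul]
          exact mul_lt_of_lt_one_right hϖ0 (pow_lt_one₀ zero_le hπ1 hl0.ne')

/-- The differences of the roots of an Eisenstein polynomial of degree `p`. -/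
theorem IsEisensteinPoly.sub_pow_near (hw : IsExtendedValuation F w) (h0 : ϖ ≠ 0)
    (hϖ : val F ϖ = 1) {f : F[X]} (hf : IsEisensteinPoly w p ϖ f) (h : aeval π f = 0)
    (hd : aeval π f.derivative ≠ 0) {π' : Ω} (h' : aeval π' f = 0) (hne : π' ≠ π) :
    w ((π' - π) ^ (p - 1) + aeval π f.derivative) < w (aeval π f.derivative) ∧
      w (π' - π) < w π := by
  have hp : p.Prime := Fact.out
  have hϖ0 : 0 < w (algebraMap F Ω ϖ) := by rw [zero_lt_iff]; simpa using h0
  have hπ := hf.root hw h0 hϖ h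
  have hπ' := hf.root hw h0 hϖ h'
  have hπ0 := uniformizer_ne_zero h0 hπ
  have hwπ0 : 0 < w π := by rw [zero_lt_iff]; simpa using hπ0
  have hww : w π' = w π :=
    (pow_left_inj₀ zero_le zero_le hp.ne_zero).1 (hπ'.trans hπ.symm)
  set z := (π' - π) / π with hz
  have hπz : π' - π = π * z := by rw [hz]; field_simp
  have hz0 : z ≠ 0 := div_ne_zero (sub_ne_zero.2 hne) hπ0
  have hz1 : w z ≤ 1 := by
    rw [hz, map_div₀, div_le_one₀ hwπ0]
    exact w.map_sub_le hww.le le_rfl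
  -- With π' = π(1 + z), each term of f(π') is expanded into its value at π, a linear part l a_l π^l
  -- z, and a quadratic remainder bounded by π f'(π); index p contributes the additional π^p z^p.
  -- For 0 < l < p the bound uses that l is a unit.
  have key : ∀ l ∈ Finset.range (p + 1), ∃ g : Ω, w g ≤ w (aeval π f.derivative * π) ∧
      algebraMap F Ω (f.coeff l) * π' ^ l = algebraMap F Ω (f.coeff l) * π ^ l +
        z * (l * (algebraMap F Ω (f.coeff l) * π ^ l)) + z ^ 2 * g +
        (if l = p then π ^ p * z ^ p else 0) := by
    intro l hl
    have hle := hf.natCast_mul_coeff_le hw h0 hϖ h l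
    have hπl : π' ^ l = π ^ l * (1 + z) ^ l := by
      rw [← mul_pow]; congr 1; linear_combination hπz
    rcases eq_or_lt_of_le (Nat.lt_succ_iff.1 (Finset.mem_range.1 hl)) with rfl | hlp
    · obtain ⟨g, hg, hgeq⟩ := exists_one_add_pow_prime_eq (p := l) w hz1
      refine ⟨l * (algebraMap F Ω (f.coeff l) * π ^ l) * g, ?_, ?_⟩
      · rw [map_mul]
        exact (mul_le_of_le_one_right' hg).trans hle
      · rw [hπl, hgeq, if_pos rfl, hf.coeff_self, map_one]
        ring
    · simp only [if_neg hlp.ne, add_zero]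
      rcases Nat.eq_zero_or_pos l with rfl | hl0
      · exact ⟨0, by simp, by simp⟩
      obtain ⟨g, hg, hgeq⟩ := exists_one_add_pow_eq w hz1 l
      refine ⟨algebraMap F Ω (f.coeff l) * π ^ l * g, ?_, ?_⟩
      · rw [map_mul]
        refine (mul_le_of_le_one_right' hg).trans ?_
        rwa [map_mul, hw.natCast_eq_one (Nat.not_dvd_of_pos_of_lt hl0 hlp), one_mul] at hle
      · rw [hπl, hgeq]
        ring
  choose! g hg hgeq using key
  set G := ∑ l ∈ Finset.range (p + 1), g l with hG
  have hGle : w G ≤ w (aeval π f.derivative * π) := w.map_sum_le hg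
  have hsum (x : Ω) : aeval x f = ∑ l ∈ Finset.range (p + 1), algebraMap F Ω (f.coeff l) * x ^ l := by
    rw [hf.aeval_eq, Finset.sum_range_succ, hf.coeff_self, map_one, one_mul]
  have heq : z * (aeval π f.derivative * π) + z ^ 2 * G + π ^ p * z ^ p = 0 := by
    have h1 := hsum π'
    rw [Finset.sum_congr rfl hgeq, Finset.sum_add_distrib, Finset.sum_add_distrib,
      Finset.sum_add_distrib, ← hsum π, h, h', ← Finset.mul_sum, ← hf.derivative_mul_eq,
      ← Finset.mul_sum, Finset.sum_ite_eq' , if_pos (by simp), zero_add] at h1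
    exact h1.symm
  have hDlt := hf.derivative_mul_lt hw h0 hϖ h
  -- If |z| = 1, then π^p z^p has absolute value |ϖ| while the other two terms of the relation are
  -- smaller.
  have hzlt : w z < 1 := by
    refine lt_of_le_of_ne hz1 fun hz1' => ?_
    have h1 : w (π ^ p * z ^ p) = w (algebraMap F Ω ϖ) := by
      rw [map_mul, map_pow, map_pow, hz1', one_pow, mul_one, hπ]
    have h2 : π ^ p * z ^ p = -(z * (aeval π f.derivative * π) + z ^ 2 * G) := by
      linear_combination heq
    rw [h2, w.map_neg] at h1
    have h3 : w (z * (aeval π f.derivative * π) + z ^ 2 * G) < w (algebraMap F Ω ϖ) := by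
      refine w.map_add_lt ?_ ?_
      · rw [map_mul, hz1', one_mul]; exact hDlt
      · rw [map_mul, map_pow, hz1', one_pow, one_mul]; exact hGle.trans_lt hDlt
    exact h3.ne h1
  -- This is the relation divided by zπ. The error term is smaller than f'(π) because |z| < 1.
  have heq2 : (π' - π) ^ (p - 1) + aeval π f.derivative = -(z * G / π) := by
    have h1 : z * π * ((π * z) ^ (p - 1) + aeval π f.derivative + z * G / π) = 0 := by
      have : (π * z) ^ (p - 1) * (π * z) = π ^ p * z ^ p := by
        rw [← pow_succ, ← mul_pow]; congr 1; have := hp.two_le; omega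
      rw [mul_add, mul_add, mul_comm (z * π) ((π * z) ^ (p - 1)), mul_comm z π, this, ← heq]
      field_simp
      ring
    rw [hπz]
    have h2 := (mul_eq_zero.1 h1).resolve_left (mul_ne_zero hz0 hπ0)
    linear_combination h2
  constructor
  · rw [heq2, w.map_neg, map_div₀, map_mul, div_lt_iff₀ hwπ0, ← map_mul w _ π]
    refine lt_of_le_of_lt (mul_le_mul_right hGle (w z)) ?_
    refine mul_lt_of_lt_one_left ?_ hzlt
    rw [zero_lt_iff]
    simpa using ⟨hd, hπ0⟩
  · rw [hπz, map_mul]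
    exact mul_lt_of_lt_one_right hwπ0 hzlt

end Conjugates

/-! ### Equality of leading terms. -/

section Near

variable {Ω : Type*} [Field Ω] {w : Valuation Ω ℝ≥0}

/-- `u` and `v` have the same leading term. -/
def Near (w : Valuation Ω ℝ≥0) (u v : Ω) : Prop := w (u - v) < w v

theorem Near.map_eq {u v : Ω} (h : Near w u v) : w u = w v := by
  have := w.map_add_eq_of_lt_left h
  rwa [add_sub_cancel] at this

theorem Near.pos_right {u v : Ω} (h : Near w u v) : 0 < w v := zero_le.trans_lt h

theorem Near.ne_zero_right {u v : Ω} (h : Near w u v) : v ≠ 0 := by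
  rintro rfl
  have := h.pos_right
  simp at this

theorem Near.ne_zero {u v : Ω} (h : Near w u v) : u ≠ 0 := by
  rintro rfl
  have := h.pos_right
  rw [← h.map_eq] at this
  simp at this

theorem Near.symm {u v : Ω} (h : Near w u v) : Near w v u := by
  unfold Near
  rw [w.map_sub_swap, h.map_eq]
  exact h

theorem Near.trans {u v x : Ω} (h : Near w u v) (h' : Near w v x) : Near w u x := by
  unfold Near at h ⊢
  rw [h'.map_eq] at h
  have := w.map_add_lt h h'
  rwa [sub_add_sub_cancel] at this

theorem Near.refl {u : Ω} (hu : u ≠ 0) : Near w u u := by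
  unfold Near
  rw [sub_self, map_zero, zero_lt_iff]
  simpa using hu

theorem Near.mul {u v u' v' : Ω} (h : Near w u v) (h' : Near w u' v') :
    Near w (u * u') (v * v') := by
  unfold Near
  have h1 : w ((u - v) * u') < w (v * v') := by
    rw [map_mul, map_mul, h'.map_eq]
    exact mul_lt_mul_of_pos_right h h'.pos_right
  have h2 : w (v * (u' - v')) < w (v * v') := by
    rw [map_mul, map_mul]
    exact mul_lt_mul_of_pos_left h' h.pos_right
  have := w.map_add_lt h1 h2
  convert this using 2
  ring

theorem Near.pow {u v : Ω} (h : Near w u v) (n : ℕ) : Near w (u ^ n) (v ^ n) := by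
  induction n with
  | zero => simpa using Near.refl (w := w) (one_ne_zero (α := Ω))
  | succ n ih => rw [pow_succ, pow_succ]; exact ih.mul h

theorem Near.neg {u v : Ω} (h : Near w u v) : Near w (-u) (-v) := by
  unfold Near
  rw [w.map_neg, ← neg_sub', w.map_neg]
  exact h

end Near

/-! ### The affine structure on the roots. -/

section AffineRoots

variable {F : Type*} [Field F] [ValuativeRel F] [TopologicalSpace F]
  [IsNonarchimedeanLocalField F] {Ω : Type*} [Field Ω] [Algebra F Ω]
  {w : Valuation Ω ℝ≥0} {p : ℕ} [CharP 𝓀[F] p] [Fact p.Prime] {ϖ : F} {π : Ω}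

theorem IsExtendedValuation.reduces_div_one_iff (hw : IsExtendedValuation F w) {u v : Ω}
    (hv : v ≠ 0) : Reduces w (u / v) (1 : ZMod p) ↔ Near w u v := by
  have : 0 < w v := by rw [zero_lt_iff]; simpa using hv
  rw [hw.reduces_one_iff, div_sub_one hv, map_div₀, div_lt_one₀ this]
  rfl

/-- The term of index `j` of the Eisenstein polynomial `f` dominates the derivative of `f` at the
roots of `f`. -/
def LeadsAt (w : Valuation Ω ℝ≥0) (j : ℕ) (f : F[X]) : Prop :=
  ∀ π : Ω, aeval π f = 0 →
    Near w (aeval π f.derivative * π) (j * (algebraMap F Ω (f.coeff j) * π ^ j))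

/-- The element of `F` whose class modulo `(p-1)`-th powers is that of the `(p-1)`-th powers of the
differences of the roots. -/
noncomputable def leadingClass (j : ℕ) (f : F[X]) : F :=
  -(j * f.coeff j) * (-f.coeff 0) ^ (j - 1)

/-- Here (π' - π)^(p-1) ≈ -f'(π) ≈ -j a_j π^(j-1). The factor π^((j-1)(p-1)) completes the power of
π to (π^p)^(j-1), and π^p ≈ -a_0 moves the result into F. -/
theorem IsEisensteinPoly.diff_near (hw : IsExtendedValuation F w) (h0 : ϖ ≠ 0)
    (hϖ : val F ϖ = 1) {f : F[X]} (hf : IsEisensteinPoly w p ϖ f) {j : ℕ} (hj : 1 ≤ j)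
    (hlead : LeadsAt w j f) (h : aeval π f = 0) {π' : Ω} (h' : aeval π' f = 0) (hne : π' ≠ π) :
    Near w (((π' - π) * π ^ (j - 1)) ^ (p - 1)) (algebraMap F Ω (leadingClass j f)) ∧
      Near w π' π := by
  have hp : p.Prime := Fact.out
  have hπ0 := uniformizer_ne_zero h0 (hf.root hw h0 hϖ h)
  have hl := hlead π h
  have hd : aeval π f.derivative ≠ 0 := left_ne_zero_of_mul hl.ne_zero
  have h1 := hf.sub_pow_near hw h0 hϖ h hd h' hne
  refine ⟨?_, h1.2⟩
  have h2 : Near w ((π' - π) ^ (p - 1)) (-aeval π f.derivative) := by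
    unfold Near
    rw [sub_neg_eq_add, w.map_neg]
    exact h1.1
  have h3 : Near w (π ^ p) (algebraMap F Ω (-f.coeff 0)) := by
    unfold Near
    rw [map_neg, w.map_neg, hf.coeff_zero, ← map_neg]
    exact hf.pow_near hw h0 hϖ h
  obtain ⟨m, rfl⟩ : ∃ m, j = m + 1 := ⟨j - 1, by omega⟩
  have h4 : Near w (aeval π f.derivative)
      (((m + 1 : ℕ) : Ω) * (algebraMap F Ω (f.coeff (m + 1)) * π ^ m)) := by
    have := hl.mul (Near.refl (w := w) (inv_ne_zero hπ0))
    rw [mul_inv_cancel_right₀ hπ0] at this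
    convert this using 1
    rw [pow_succ]
    field_simp
  have h5 := (h2.trans h4.neg).mul (Near.refl (w := w) (pow_ne_zero (m * (p - 1)) hπ0))
  have h6 : -(((m + 1 : ℕ) : Ω) * (algebraMap F Ω (f.coeff (m + 1)) * π ^ m)) *
      π ^ (m * (p - 1)) =
      -(((m + 1 : ℕ) : Ω) * algebraMap F Ω (f.coeff (m + 1))) * (π ^ p) ^ m := by
    have : (π ^ p) ^ m = π ^ m * π ^ (m * (p - 1)) := by
      rw [← pow_mul, ← pow_add]
      congr 1
      obtain ⟨n, rfl⟩ : ∃ n, p = n + 1 := ⟨p - 1, by have := hp.two_le; omega⟩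
      rw [Nat.add_sub_cancel]
      ring
    rw [this]
    ring
  rw [h6] at h5
  have hA : -(((m + 1 : ℕ) : Ω) * algebraMap F Ω (f.coeff (m + 1))) ≠ 0 := by
    have := h4.ne_zero_right
    rw [← mul_assoc] at this
    exact neg_ne_zero.2 (left_ne_zero_of_mul this)
  have h7 := h5.trans ((Near.refl (w := w) hA).mul (h3.pow m))
  rw [Nat.add_sub_cancel, mul_pow, ← pow_mul]
  convert h7 using 1
  unfold leadingClass
  simp

theorem leadingClass_ne_zero (h0 : ϖ ≠ 0)
    {f : F[X]} (hf : IsEisensteinPoly w p ϖ f) {j : ℕ} (hlead : LeadsAt w j f)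
    (h : aeval π f = 0) : leadingClass j f ≠ 0 := by
  have h1 := (hlead π h).ne_zero_right
  unfold leadingClass
  rw [← mul_assoc] at h1
  have h2 := left_ne_zero_of_mul h1
  have h3 : f.coeff j ≠ 0 := by
    intro h4; apply h2; rw [h4]; simp
  have h4 : (j : F) ≠ 0 := by
    intro h5; apply h2
    rw [← map_natCast (algebraMap F Ω), h5]; simp
  have h5 : f.coeff 0 ≠ 0 := by
    intro h6
    have := hf.coeff_zero
    rw [h6, map_zero, map_zero, eq_comm] at this
    simp [h0] at this
  exact mul_ne_zero (neg_ne_zero.2 (mul_ne_zero h4 h3)) (pow_ne_zero _ (neg_ne_zero.2 h5))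

theorem IsEisensteinPoly.separable [Algebra.IsAlgebraic F Ω] (hw : IsExtendedValuation F w)
    (h0 : ϖ ≠ 0) (hϖ : val F ϖ = 1) {f : F[X]} (hf : IsEisensteinPoly w p ϖ f) {j : ℕ}
    (hlead : LeadsAt w j f) (h : aeval π f = 0) : f.Separable := by
  have hmin := hf.minpoly_eq hw h0 hϖ h
  have hirr : Irreducible f := by
    rw [← hmin]; exact minpoly.irreducible (Algebra.IsIntegral.isIntegral π)
  rw [separable_iff_derivative_ne_zero hirr]
  intro h1
  have := (hlead π h).ne_zero
  rw [h1] at this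
  simp at this

theorem notMem_kummerField [IsAlgClosure F Ω] (hdeg : (minpoly F π).natDegree = p) :
    π ∉ kummerField F Ω p := by
  intro hmem
  have : Algebra.IsAlgebraic F Ω := IsAlgClosure.isAlgebraic
  have := finiteDimensional_kummerField (F := F) (Ω := Ω) (p := p)
  apply not_dvd_finrank_kummerField (F := F) (Ω := Ω) (p := p)
  have h1 := minpoly.degree_dvd (K := F) (x := (⟨π, hmem⟩ : kummerField F Ω p))
    (Algebra.IsIntegral.isIntegral _)
  have h2 := minpoly.algebraMap_eq (A := F) (algebraMap (kummerField F Ω p) Ω).injective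
    (⟨π, hmem⟩ : kummerField F Ω p)
  rw [← h2] at h1
  have h3 : (minpoly F π).natDegree ∣ finrank F (kummerField F Ω p) := h1
  rwa [hdeg] at h3

/-- The roots of an Eisenstein polynomial of degree `p` form an affine system. -/
theorem IsEisensteinPoly.exists_affineSystem [IsAlgClosure F Ω] (hw : IsExtendedValuation F w)
    (h0 : ϖ ≠ 0) (hϖ : val F ϖ = 1) {f : F[X]} (hf : IsEisensteinPoly w p ϖ f) {j : ℕ}
    (hj : 1 ≤ j) (hlead : LeadsAt w j f) (h : aeval π f = 0) {b : Fˣ}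
    (hb : (b : F) = leadingClass j f) {ψ : Character F Ω p} (hψ : KummerDual ψ b) :
    ∃ c : ZMod p → Ω, IsAffineSystem ψ c ∧ c 0 = π := by
  have hp : p.Prime := Fact.out
  have : Algebra.IsAlgebraic F Ω := IsAlgClosure.isAlgebraic
  have : IsAlgClosed Ω := IsAlgClosure.isAlgClosed F
  have hsep := hf.separable hw h0 hϖ hlead h
  have hf0 : f ≠ 0 := hf.monic.ne_zero
  have hmemroot (x : Ω) : x ∈ f.rootSet Ω ↔ aeval x f = 0 := mem_rootSet_of_ne hf0
  have hcard : Fintype.card (f.rootSet Ω) = p := by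
    rw [card_rootSet_eq_natDegree hsep (IsAlgClosed.splits _), hf.natDegree_eq]
  have hroot0 (x : Ω) (hx : aeval x f = 0) : x ≠ 0 :=
    uniformizer_ne_zero h0 (hf.root hw h0 hϖ hx)
  set k := j - 1 with hk
  have hnear {x y : Ω} (hx : aeval x f = 0) (hy : aeval y f = 0) (hne : y ≠ x) :
      Near w (((y - x) * x ^ k) ^ (p - 1)) (algebraMap F Ω b) := by
    rw [hb]; exact (hf.diff_near hw h0 hϖ hj hlead hx hy hne).1
  have hnear' {x y : Ω} (hx : aeval x f = 0) (hy : aeval y f = 0) : Near w y x := by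
    by_cases hne : y = x
    · rw [hne]; exact Near.refl (hroot0 x hx)
    · exact (hf.diff_near hw h0 hϖ hj hlead hx hy hne).2
  obtain ⟨π₁, hπ₁, hπ₁ne⟩ : ∃ π₁ : Ω, aeval π₁ f = 0 ∧ π₁ ≠ π := by
    have : Nontrivial (f.rootSet Ω) := by
      rw [← Fintype.one_lt_card_iff_nontrivial, hcard]; exact hp.one_lt
    obtain ⟨y, hy⟩ := exists_ne (⟨π, (hmemroot π).2 h⟩ : f.rootSet Ω)
    exact ⟨y, (hmemroot _).1 y.2, fun h1 => hy (Subtype.ext h1)⟩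
  -- One normalized difference serves as unit of length. A root y gets as index the residue of (y -
  -- π) π^(j-1)/x₁, which lies in 𝔽_p because the (p-1)-th powers of numerator and denominator are
  -- both close to b when y ≠ π.
  set x₁ := (π₁ - π) * π ^ k with hx₁
  have hx₁near : Near w (x₁ ^ (p - 1)) (algebraMap F Ω b) := hnear h hπ₁ hπ₁ne
  clear_value x₁
  have hx₁0 : x₁ ≠ 0 := by
    intro h1
    have := hx₁near.ne_zero
    rw [h1, zero_pow (by have := hp.two_le; omega)] at this
    exact this rfl
  have hunit {y : Ω} (hy : Near w (y ^ (p - 1)) (algebraMap F Ω b)) :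
      ∃ s : (ZMod p)ˣ, Reduces w (y / x₁) (s : ZMod p) := by
    refine hw.exists_reduces ?_
    rw [div_pow, ← hw.reduces_one_iff (p := p),
      hw.reduces_div_one_iff (pow_ne_zero _ hx₁0)]
    exact hy.trans hx₁near.symm
  have hidx (y : f.rootSet Ω) : ∃ s : ZMod p, Reduces w (((y : Ω) - π) * π ^ k / x₁) s := by
    by_cases hy : (y : Ω) = π
    · refine ⟨0, ?_⟩
      rw [hw.reduces_zero_iff, hy]
      simp
    · obtain ⟨s, hs⟩ := hunit (hnear h ((hmemroot _).1 y.2) hy)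
      exact ⟨s, hs⟩
  choose idx hidx using hidx
  -- For distinct roots y and z the normalized difference based at z has a nonzero residue.
  -- Replacing the base point z by π costs a factor of residue 1, so this residue is the difference
  -- of the two indices.
  have hinj : Function.Injective idx := by
    intro y z hyz
    by_contra hne
    have h1 := (hidx y).sub hw (hidx z)
    rw [hyz, sub_self] at h1
    have hne' : (y : Ω) ≠ z := fun h2 => hne (Subtype.ext h2)
    have hzr := (hmemroot _).1 z.2
    obtain ⟨s, hs⟩ := hunit (hnear hzr ((hmemroot _).1 y.2) hne')
    have h2 : Reduces w (π ^ k / (z : Ω) ^ k) (1 : ZMod p) := by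
      rw [hw.reduces_div_one_iff (pow_ne_zero _ (hroot0 _ hzr))]
      exact (hnear' hzr h).pow k
    have h3 := hs.mul hw h2
    have h4 : ((y : Ω) - z) * (z : Ω) ^ k / x₁ * (π ^ k / (z : Ω) ^ k) =
        ((y : Ω) - π) * π ^ k / x₁ - ((z : Ω) - π) * π ^ k / x₁ := by
      have := hroot0 _ hzr
      field_simp
      ring
    rw [h4] at h3
    have := h3.unique hw h1
    rw [mul_one] at this
    exact s.ne_zero this
  have hbij : Function.Bijective idx :=
    (Fintype.bijective_iff_injective_and_card idx).2 ⟨hinj, by rw [hcard, ZMod.card]⟩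
  let e := Equiv.ofBijective idx hbij
  let c : ZMod p → Ω := fun s => (e.symm s : Ω)
  have hc (s : ZMod p) : Reduces w ((c s - π) * π ^ k / x₁) s := by
    have := hidx (e.symm s)
    rwa [show idx (e.symm s) = s from e.apply_symm_apply s] at this
  have hcroot (s : ZMod p) : aeval (c s) f = 0 := (hmemroot _).1 (e.symm s).2
  have hceq {y : Ω} {s : ZMod p} (hy : aeval y f = 0)
      (hs : Reduces w ((y - π) * π ^ k / x₁) s) : y = c s := by
    have h1 : idx ⟨y, (hmemroot y).2 hy⟩ = s := (hidx ⟨y, (hmemroot y).2 hy⟩).unique hw hs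
    have h2 : e.symm s = ⟨y, (hmemroot y).2 hy⟩ := by
      rw [Equiv.symm_apply_eq]; exact h1.symm
    change y = (e.symm s : Ω)
    rw [h2]
  have hc0 : c 0 = π := by
    refine (hceq h ?_).symm
    rw [hw.reduces_zero_iff]
    simp
  refine ⟨c, ⟨?_, ?_, ?_, ?_⟩, hc0⟩
  · exact Subtype.val_injective.comp e.symm.injective
  · intro s
    unfold IsSeparable
    rw [hf.minpoly_eq hw h0 hϖ (hcroot s)]
    exact hsep
  -- Write τ(c s) - π = τ(c s - π) + (τ(π) - π). The first summand is rescaled by τ(x₁)/x₁, whose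
  -- residue is ψ(τ); the second one gives the translation.
  · intro τ
    have hτroot {y : Ω} (hy : aeval y f = 0) : aeval (τ y) f = 0 := by
      rw [aeval_algHom_apply τ y f, hy, map_zero]
    obtain ⟨t, ht⟩ : ∃ t, Reduces w ((τ π - π) * π ^ k / x₁) t :=
      ⟨_, hidx ⟨τ π, (hmemroot _).2 (hτroot h)⟩⟩
    refine ⟨t, fun s => hceq (hτroot (hcroot s)) ?_⟩
    have h1 := (hc s).map hw τ
    have h2 := hw.reduces_of_kummerDual hψ hx₁near τ
    have h3 : Reduces w (π ^ k / (τ π) ^ k) (1 : ZMod p) := by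
      rw [hw.reduces_div_one_iff (pow_ne_zero _ (hroot0 _ (hτroot h)))]
      exact (hnear' (hτroot h) h).pow k
    have h4 := (((h2.mul hw h1).mul hw h3).add hw ht)
    rw [mul_one] at h4
    convert h4 using 1
    have hτx : τ x₁ ≠ 0 := by simpa using hx₁0
    have hτπ : τ π ≠ 0 := hroot0 _ (hτroot h)
    rw [map_div₀, map_mul, map_sub, map_pow]
    field_simp
    ring
  · rw [hc0]
    exact notMem_kummerField (by rw [hf.minpoly_eq hw h0 hϖ h, hf.natDegree_eq])

end AffineRoots

/-! ### Degree p extensions with a uniformizer. -/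

section Ramified

variable {F : Type*} [Field F] [ValuativeRel F] [TopologicalSpace F]
  [IsNonarchimedeanLocalField F] {Ω : Type*} [Field Ω] [Algebra F Ω]
  {w : Valuation Ω ℝ≥0} {p : ℕ} [CharP 𝓀[F] p] [Fact p.Prime] {ϖ : F} {π : Ω}
  [IsAlgClosure F Ω]

/-- `E` has degree `p` over `F`, and `π` is an element of `E` whose `p`-th power is a uniformizer
of `F` up to a unit. -/
structure IsRamifiedWith (w : Valuation Ω ℝ≥0) (p : ℕ) (ϖ : F) (E : IntermediateField F Ω)
    (π : Ω) : Prop where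
  finrank_eq : finrank F E = p
  mem : π ∈ E
  pow_eq : w π ^ p = w (algebraMap F Ω ϖ)

namespace IsRamifiedWith

variable {E : IntermediateField F Ω}

theorem finiteDimensional (h : IsRamifiedWith w p ϖ E π) : FiniteDimensional F E := by
  have hp : p.Prime := Fact.out
  exact FiniteDimensional.of_finrank_pos (by rw [h.finrank_eq]; exact hp.pos)

theorem natDegree_le (h : IsRamifiedWith w p ϖ E π) : (minpoly F π).natDegree ≤ p := by
  have := h.finiteDimensional
  have h1 := minpoly.natDegree_le (A := F) (⟨π, h.mem⟩ : E)
  rw [h.finrank_eq, ← minpoly.algebraMap_eq (A := F) (algebraMap E Ω).injective] at h1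
  exact h1

theorem isEisensteinPoly (hw : IsExtendedValuation F w) (h0 : ϖ ≠ 0) (hϖ : val F ϖ = 1)
    (h : IsRamifiedWith w p ϖ E π) : IsEisensteinPoly w p ϖ (minpoly F π) := by
  have : Algebra.IsAlgebraic F Ω := IsAlgClosure.isAlgebraic
  exact hw.isEisensteinPoly_minpoly h0 hϖ h.pow_eq h.natDegree_le

theorem adjoin_eq (hw : IsExtendedValuation F w) (h0 : ϖ ≠ 0) (hϖ : val F ϖ = 1)
    (h : IsRamifiedWith w p ϖ E π) : IntermediateField.adjoin F {π} = E := by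
  have : Algebra.IsAlgebraic F Ω := IsAlgClosure.isAlgebraic
  have := h.finiteDimensional
  refine IntermediateField.eq_of_le_of_finrank_eq ?_ ?_
  · rw [IntermediateField.adjoin_simple_le_iff]; exact h.mem
  · rw [IntermediateField.adjoin.finrank (Algebra.IsIntegral.isIntegral π), h.finrank_eq,
      (h.isEisensteinPoly hw h0 hϖ).natDegree_eq]

theorem exists_aeval (hw : IsExtendedValuation F w) (h0 : ϖ ≠ 0) (hϖ : val F ϖ = 1)
    (h : IsRamifiedWith w p ϖ E π) {x : Ω} (hx : x ∈ E) :
    ∃ P : F[X], P.natDegree < p ∧ aeval π P = x := by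
  have hp : p.Prime := Fact.out
  have : Algebra.IsAlgebraic F Ω := IsAlgClosure.isAlgebraic
  have hintegral : IsIntegral F π := Algebra.IsIntegral.isIntegral π
  have hf := h.isEisensteinPoly hw h0 hϖ
  rw [← h.adjoin_eq hw h0 hϖ, ← IntermediateField.mem_toSubalgebra,
    IntermediateField.adjoin_simple_toSubalgebra_of_isAlgebraic hintegral.isAlgebraic,
    Algebra.adjoin_singleton_eq_range_aeval] at hx
  obtain ⟨P, rfl⟩ := hx
  refine ⟨P %ₘ minpoly F π, ?_, ?_⟩
  · have := natDegree_modByMonic_lt P hf.monic (by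
      intro h1
      have h2 := hf.natDegree_eq
      rw [h1, natDegree_one] at h2
      exact hp.ne_zero h2.symm)
    rwa [hf.natDegree_eq] at this
  · exact aeval_modByMonic_eq_self_of_root (minpoly.aeval F π)

theorem exists_zpow (hw : IsExtendedValuation F w) (h0 : ϖ ≠ 0) (hϖ : val F ϖ = 1)
    (h : IsRamifiedWith w p ϖ E π) {x : Ω} (hx : x ∈ E) (hx0 : x ≠ 0) :
    ∃ k : ℤ, w x = w π ^ k := by
  obtain ⟨P, hP, rfl⟩ := h.exists_aeval hw h0 hϖ hx
  have hP0 : P ≠ 0 := by rintro rfl; simp at hx0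
  obtain ⟨j, -, hj0, hj, -⟩ := hw.exists_dominant h0 hϖ h.pow_eq hP hP0
  have hπ0 : w π ≠ 0 := by simpa using uniformizer_ne_zero h0 h.pow_eq
  refine ⟨p * val F (P.coeff j) + j, ?_⟩
  rw [hj, map_mul, map_pow, hw.eq_zpow h0 hϖ hj0, ← h.pow_eq, zpow_add₀ hπ0, zpow_mul]
  simp

theorem le_of_lt_one (hw : IsExtendedValuation F w) (h0 : ϖ ≠ 0) (hϖ : val F ϖ = 1)
    (h : IsRamifiedWith w p ϖ E π) {x : Ω} (hx : x ∈ E) (hx1 : w x < 1) : w x ≤ w π := by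
  by_cases hx0 : x = 0
  · simp [hx0]
  obtain ⟨k, hk⟩ := h.exists_zpow hw h0 hϖ hx hx0
  have hπ0 : 0 < w π := by
    rw [zero_lt_iff]; simpa using uniformizer_ne_zero h0 h.pow_eq
  have hπ1 := hw.lt_one_of_pow_eq h0 hϖ h.pow_eq
  rw [hk] at hx1 ⊢
  have : 1 ≤ k := by
    by_contra! h1
    exact absurd hx1 (not_lt.2 (one_le_zpow_of_nonpos₀ hπ0 hπ1.le (by omega)))
  calc w π ^ k ≤ w π ^ (1 : ℤ) := zpow_le_zpow_right_of_le_one₀ hπ0 hπ1.le this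
    _ = w π := zpow_one _

/-- The residue field does not grow: for an element of absolute value 1 the dominant term c_j π^j
satisfies p v(c_j) + j = 0 with j < p, which forces j = 0. -/
theorem exists_residue (hw : IsExtendedValuation F w) (h0 : ϖ ≠ 0) (hϖ : val F ϖ = 1)
    (h : IsRamifiedWith w p ϖ E π) {x : Ω} (hx : x ∈ E) (hx1 : w x ≤ 1) :
    ∃ a : 𝒪[F], w (x - algebraMap F Ω a) < 1 := by
  have hp : p.Prime := Fact.out
  by_cases hlt : w x < 1
  · exact ⟨0, by simpa using hlt⟩
  have hx1 : w x = 1 := le_antisymm hx1 (not_lt.1 hlt)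
  have hx0 : x ≠ 0 := by rintro rfl; simp at hx1
  obtain ⟨P, hP, rfl⟩ := h.exists_aeval hw h0 hϖ hx
  have hP0 : P ≠ 0 := by rintro rfl; simp at hx0
  obtain ⟨j, hjp, hj0, hj, hlt, -⟩ := hw.exists_dominant h0 hϖ h.pow_eq hP hP0
  have h1 := hw.exponent_eq (l := j) (m := 0) h0 hϖ h.pow_eq hj0 (one_ne_zero (α := F))
    (by rw [← hj, hx1]; simp)
  rw [val_one] at h1
  have hj' : j = 0 := by
    have h2 : (p : ℤ) ∣ j := ⟨-val F (P.coeff j), by push_cast at h1; linarith⟩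
    exact Nat.eq_zero_of_dvd_of_lt (by exact_mod_cast h2) hjp
  subst hj'
  rw [hx1, pow_zero, mul_one] at hlt
  rw [hx1, pow_zero, mul_one] at hj
  exact ⟨⟨P.coeff 0, (hw.algebraMap_le_one_iff _).1 hj.ge⟩, hlt⟩

/-- From p v(c_l) + l ≥ 0 and l < p it follows that v(c_l) ≥ 0. Thus the powers of π form an
integral basis. -/
theorem coeff_le (hw : IsExtendedValuation F w) (h0 : ϖ ≠ 0) (hϖ : val F ϖ = 1)
    (h : IsRamifiedWith w p ϖ E π) {P : F[X]} (hP : P.natDegree < p)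
    (hx1 : w (aeval π P) ≤ 1) (l : ℕ) : w (algebraMap F Ω (P.coeff l)) ≤ 1 := by
  have hp : p.Prime := Fact.out
  by_cases hc : P.coeff l = 0
  · simp [hc]
  have hl : l < p := (le_natDegree_of_ne_zero hc).trans_lt hP
  have h1 := (hw.coeff_le h0 hϖ h.pow_eq hP l).trans hx1
  have hπ0 : w π ≠ 0 := by simpa using uniformizer_ne_zero h0 h.pow_eq
  have hπ1 := hw.lt_one_of_pow_eq h0 hϖ h.pow_eq
  rw [map_mul, map_pow, hw.eq_zpow h0 hϖ hc, ← h.pow_eq, ← zpow_natCast, ← zpow_natCast,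
    ← zpow_mul, ← zpow_add₀ hπ0] at h1
  rw [hw.algebraMap_le_one_iff, mem_integer_iff_val hc]
  by_contra! h2
  have h3 : (p : ℤ) * val F (P.coeff l) + l < 0 := by
    have : (p : ℤ) * val F (P.coeff l) ≤ p * (-1) :=
      mul_le_mul_of_nonneg_left (by omega) (by positivity)
    omega
  exact absurd h1 (not_le.2 (one_lt_zpow_of_neg₀ (zero_lt_iff.2 hπ0) hπ1 h3))

end IsRamifiedWith

theorem IsEisensteinPoly.isRamifiedWith (hw : IsExtendedValuation F w) (h0 : ϖ ≠ 0)
    (hϖ : val F ϖ = 1) {f : F[X]} (hf : IsEisensteinPoly w p ϖ f) (h : aeval π f = 0) :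
    IsRamifiedWith w p ϖ (IntermediateField.adjoin F {π}) π := by
  have : Algebra.IsAlgebraic F Ω := IsAlgClosure.isAlgebraic
  refine ⟨?_, IntermediateField.mem_adjoin_simple_self F π, hf.root hw h0 hϖ h⟩
  rw [IntermediateField.adjoin.finrank (Algebra.IsIntegral.isIntegral π),
    hf.minpoly_eq hw h0 hϖ h, hf.natDegree_eq]

end Ramified

/-! ### Total ramification in terms of uniformizers. -/

section TotallyRamified

variable {F : Type*} [Field F] [ValuativeRel F] [TopologicalSpace F]
  [IsNonarchimedeanLocalField F] {Ω : Type*} [Field Ω] [Algebra F Ω]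
  {w : Valuation Ω ℝ≥0} {p : ℕ} [CharP 𝓀[F] p] [Fact p.Prime] {ϖ : F}
  [IsAlgClosure F Ω] {E : IntermediateField F Ω}

theorem IsExtendedValuation.mem_integralClosure_iff (hw : IsExtendedValuation F w) (x : E) :
    x ∈ integralClosure 𝒪[F] E ↔ w (x : Ω) ≤ 1 := by
  rw [hw.le_one_iff, _root_.mem_integralClosure_iff]
  exact (isIntegral_algebraMap_iff (R := 𝒪[F]) (A := E) (B := Ω)
    (algebraMap E Ω).injective).symm

theorem IsExtendedValuation.dvd_iff (hw : IsExtendedValuation F w)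
    (x y : integralClosure 𝒪[F] E) :
    x ∣ y ↔ w ((y : E) : Ω) ≤ w ((x : E) : Ω) := by
  constructor
  · rintro ⟨z, rfl⟩
    have := (hw.mem_integralClosure_iff _).1 z.2
    push_cast
    rw [map_mul]
    exact mul_le_of_le_one_right' this
  · intro h
    by_cases hx : ((x : E) : Ω) = 0
    · rw [hx, map_zero, le_zero_iff, map_eq_zero] at h
      have : y = 0 := by
        apply Subtype.ext; apply Subtype.ext; exact h
      rw [this]; exact dvd_zero x
    · refine ⟨⟨(y : E) / x, (hw.mem_integralClosure_iff _).2 ?_⟩, ?_⟩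
      · push_cast
        rw [map_div₀]
        exact div_le_one_of_le₀ h zero_le
      · apply Subtype.ext; apply Subtype.ext
        push_cast
        field_simp

theorem map_maximalIdeal_eq_span (h0 : ϖ ≠ 0) (hϖ : val F ϖ = 1) :
    Ideal.map (algebraMap 𝒪[F] (integralClosure 𝒪[F] E)) 𝓂[F] =
      Ideal.span {algebraMap 𝒪[F] (integralClosure 𝒪[F] E) ⟨ϖ, uniformizer_mem h0 hϖ⟩} := by
  rw [maximalIdeal_eq_span h0 hϖ, Ideal.map_span, Set.image_singleton]

theorem IsRamifiedWith.isTotallyRamified (hw : IsExtendedValuation F w) (h0 : ϖ ≠ 0)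
    (hϖ : val F ϖ = 1) {π : Ω} (h : IsRamifiedWith w p ϖ E π) : IsTotallyRamified E := by
  have hπ1 := hw.lt_one_of_pow_eq h0 hϖ h.pow_eq
  let x : integralClosure 𝒪[F] E := ⟨⟨π, h.mem⟩, (hw.mem_integralClosure_iff _).2 hπ1.le⟩
  refine ⟨Ideal.span {x}, ?_, ?_⟩
  · rw [Ideal.isMaximal_iff]
    constructor
    · rw [Ideal.mem_span_singleton, hw.dvd_iff, not_le]
      simpa using hπ1
    · intro J y hJ hy hyJ
      rw [Ideal.mem_span_singleton, hw.dvd_iff, not_le] at hy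
      have hy1 : 1 ≤ w ((y : E) : Ω) := by
        by_contra! h1
        exact absurd (h.le_of_lt_one hw h0 hϖ (y : E).2 h1) (not_le.2 hy)
      have : y ∣ 1 := (hw.dvd_iff _ _).2 (by simpa using hy1)
      exact J.mem_of_dvd this hyJ
  · rw [map_maximalIdeal_eq_span h0 hϖ, Ideal.span_singleton_pow, h.finrank_eq]
    refine le_antisymm ?_ ?_ <;> rw [Ideal.span_singleton_le_span_singleton, hw.dvd_iff]
    · push_cast
      rw [map_pow]
      exact h.pow_eq.ge
    · push_cast
      rw [map_pow]
      exact h.pow_eq.le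

/-- Were |x|^p < |ϖ| for all x in P, multiplicativity and the ultrametric inequality would give
|x|^p < |ϖ|^p on P^p, which contains ϖ. -/
theorem IsTotallyRamified.exists_isRamifiedWith (hw : IsExtendedValuation F w) (h0 : ϖ ≠ 0)
    (hϖ : val F ϖ = 1) (hE : IsTotallyRamified E) (hdeg : finrank F E = p) :
    ∃ π, IsRamifiedWith w p ϖ E π := by
  have hp : p.Prime := Fact.out
  obtain ⟨P, -, hP⟩ := hE
  rw [map_maximalIdeal_eq_span h0 hϖ, hdeg] at hP
  set u := algebraMap 𝒪[F] (integralClosure 𝒪[F] E) ⟨ϖ, uniformizer_mem h0 hϖ⟩ with hu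
  have hu' : ((u : E) : Ω) = algebraMap F Ω ϖ := rfl
  have hle (x : integralClosure 𝒪[F] E) (hx : x ∈ P) :
      w ((x : E) : Ω) ^ p ≤ w (algebraMap F Ω ϖ) := by
    have h1 := Ideal.pow_mem_pow hx p
    rw [← hP, Ideal.mem_span_singleton, hw.dvd_iff, hu'] at h1
    push_cast at h1
    rwa [map_pow] at h1
  by_contra! hno
  have hlt (x : integralClosure 𝒪[F] E) (hx : x ∈ P) :
      w ((x : E) : Ω) ^ p < w (algebraMap F Ω ϖ) :=
    lt_of_le_of_ne (hle x hx) fun h1 => hno (x : E) ⟨hdeg, (x : E).2, h1⟩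
  have hpow (n : ℕ) : ∀ x ∈ P ^ (n + 1), w ((x : E) : Ω) ^ p < w (algebraMap F Ω ϖ) ^ (n + 1) := by
    induction n with
    | zero => simpa using hlt
    | succ n ih =>
      intro x hx
      rw [pow_succ] at hx
      refine Submodule.mul_induction_on hx ?_ ?_
      · intro a ha b hb
        push_cast
        rw [map_mul, mul_pow, pow_succ _ (n + 1)]
        exact mul_lt_mul'' (ih a ha) (hlt b hb) zero_le zero_le
      · intro a b ha hb
        push_cast
        have h1 := w.map_add ((a : E) : Ω) ((b : E) : Ω)
        rcases le_max_iff.1 h1 with h2 | h2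
        · exact (pow_le_pow_left₀ zero_le h2 p).trans_lt ha
        · exact (pow_le_pow_left₀ zero_le h2 p).trans_lt hb
  have h1 : u ∈ P ^ (p - 1 + 1) := by
    rw [Nat.sub_add_cancel hp.one_le, ← hP]
    exact Ideal.mem_span_singleton_self u
  have h2 := hpow _ u h1
  rw [Nat.sub_add_cancel hp.one_le, hu'] at h2
  exact lt_irrefl _ h2

theorem mem_ramifiedExtensions_iff (hw : IsExtendedValuation F w) (h0 : ϖ ≠ 0)
    (hϖ : val F ϖ = 1) : E ∈ ramifiedExtensions F Ω p ↔
      Algebra.IsSeparable F E ∧ ∃ π, IsRamifiedWith w p ϖ E π := by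
  constructor
  · rintro ⟨h1, h2, h3⟩
    exact ⟨h1, h3.exists_isRamifiedWith hw h0 hϖ h2⟩
  · rintro ⟨h1, π, h2⟩
    exact ⟨h1, h2.finrank_eq, h2.isTotallyRamified hw h0 hϖ⟩

end TotallyRamified

/-! ### The discriminant and Serre's invariant. -/

section Discriminant

variable {F : Type*} [Field F] [ValuativeRel F] [TopologicalSpace F]
  [IsNonarchimedeanLocalField F] {Ω : Type*} [Field Ω] [Algebra F Ω]
  {w : Valuation Ω ℝ≥0} {p : ℕ} [CharP 𝓀[F] p] [Fact p.Prime] {ϖ : F} {π : Ω}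
  [IsAlgClosure F Ω] {E : IntermediateField F Ω}

theorem IsExtendedValuation.map_algHom (hw : IsExtendedValuation F w) (σ : E →ₐ[F] Ω) (x : E) :
    w (σ x) = w (x : Ω) := by
  have : Algebra.IsAlgebraic F Ω := IsAlgClosure.isAlgebraic
  have : Normal F Ω := IsAlgClosure.normal F Ω
  have h1 : minpoly F (σ x) = minpoly F (x : Ω) := by
    rw [minpoly.algHom_eq σ σ.injective]
    exact (minpoly.algebraMap_eq (A := F) (algebraMap E Ω).injective x).symm
  obtain ⟨τ, hτ⟩ := (isConjRoot_iff_exists_algEquiv (K := F)).1 h1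
  rw [← hτ, hw.map_algEquiv]

theorem IsExtendedValuation.map_norm (hw : IsExtendedValuation F w) [FiniteDimensional F E]
    [Algebra.IsSeparable F E] (x : E) :
    w (algebraMap F Ω (Algebra.norm F x)) = w (x : Ω) ^ finrank F E := by
  have : IsAlgClosed Ω := IsAlgClosure.isAlgClosed F
  rw [Algebra.norm_eq_prod_embeddings F Ω x, map_prod, ← AlgHom.card F E Ω]
  simp [hw.map_algHom]

namespace IsRamifiedWith

theorem adjoin_eq_top (hw : IsExtendedValuation F w) (h0 : ϖ ≠ 0) (hϖ : val F ϖ = 1)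
    (h : IsRamifiedWith w p ϖ E π) : Algebra.adjoin F {(⟨π, h.mem⟩ : E)} = ⊤ := by
  rw [eq_top_iff]
  intro y _
  obtain ⟨P, -, hP⟩ := h.exists_aeval hw h0 hϖ y.2
  have : y = aeval (⟨π, h.mem⟩ : E) P := by
    apply Subtype.ext
    rw [← hP]
    exact aeval_algebraMap_apply Ω (⟨π, h.mem⟩ : E) P
  rw [this]
  exact aeval_mem_adjoin_singleton F _

/-- The discriminant of a power basis is up to sign the norm of f'(π), and all conjugates have the
same absolute value. -/
theorem exists_discr (hw : IsExtendedValuation F w) (h0 : ϖ ≠ 0) (hϖ : val F ϖ = 1)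
    (h : IsRamifiedWith w p ϖ E π) [Algebra.IsSeparable F E] :
    ∃ B : Basis (Fin (finrank F E)) F E, (∀ i, (B i : Ω) = π ^ (i : ℕ)) ∧
      w (algebraMap F Ω (Algebra.discr F B)) = w (aeval π (minpoly F π).derivative) ^ p := by
  have := h.finiteDimensional
  have hintegral : IsIntegral F (⟨π, h.mem⟩ : E) := Algebra.IsIntegral.isIntegral _
  let pb : PowerBasis F E := PowerBasis.ofAdjoinEqTop hintegral (h.adjoin_eq_top hw h0 hϖ)
  have hgen : pb.gen = ⟨π, h.mem⟩ := PowerBasis.ofAdjoinEqTop_gen _ _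
  let e : Fin pb.dim ≃ Fin (finrank F E) := finCongr pb.finrank.symm
  refine ⟨pb.basis.reindex e, ?_, ?_⟩
  · intro i
    rw [Basis.reindex_apply, PowerBasis.basis_eq_pow, hgen]
    simp [e]
  · rw [Basis.coe_reindex, Algebra.discr_reindex, Algebra.discr_powerBasis_eq_norm, map_mul,
      map_mul, hw.map_norm, h.finrank_eq, hgen]
    have h1 : ((aeval (⟨π, h.mem⟩ : E) (minpoly F (⟨π, h.mem⟩ : E)).derivative : E) : Ω) =
        aeval π (minpoly F π).derivative := by
      rw [← minpoly.algebraMap_eq (A := F) (algebraMap E Ω).injective]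
      exact (aeval_algebraMap_apply Ω (⟨π, h.mem⟩ : E) _).symm
    rw [h1]
    simp [w.map_neg]

theorem repr_le (hw : IsExtendedValuation F w) (h0 : ϖ ≠ 0) (hϖ : val F ϖ = 1)
    (h : IsRamifiedWith w p ϖ E π) (B : Basis (Fin (finrank F E)) F E)
    (hB : ∀ i, (B i : Ω) = π ^ (i : ℕ)) {x : E} (hx : w (x : Ω) ≤ 1) (i : Fin (finrank F E)) :
    w (algebraMap F Ω (B.repr x i)) ≤ 1 := by
  have hp : p.Prime := Fact.out
  let P : F[X] := ∑ j : Fin (finrank F E), C (B.repr x j) * X ^ (j : ℕ)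
  have hPdeg : P.natDegree < p := by
    refine (natDegree_sum_le_of_forall_le (n := p - 1) _ _ ?_).trans_lt
      (by have := hp.two_le; omega)
    intro j _
    refine (natDegree_C_mul_X_pow_le _ _).trans ?_
    have := j.2
    have := h.finrank_eq
    omega
  have hcoeff : P.coeff i = B.repr x i := by
    simp only [P, finsetSum_coeff, coeff_C_mul_X_pow]
    rw [Finset.sum_eq_single i]
    · simp
    · intro j _ hj
      rw [if_neg]
      exact fun h1 => hj (Fin.ext h1.symm)
    · simp
  have haeval : aeval π P = x := by
    conv_rhs => rw [← B.sum_repr x]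
    simp only [P, map_sum, map_mul, aeval_C, map_pow, aeval_X]
    rw [show ((∑ j, B.repr x j • B j : E) : Ω) = E.val (∑ j, B.repr x j • B j) from rfl, map_sum]
    refine Finset.sum_congr rfl fun j _ => ?_
    rw [map_smul, Algebra.smul_def, IntermediateField.coe_val, hB]
  rw [← hcoeff]
  exact h.coeff_le hw h0 hϖ hPdeg (by rw [haeval]; exact hx) _

/-- The powers of π form an integral basis, so the discriminant of any family of integers is that of
the basis times the square of an integral determinant. -/
theorem discrIdeal_eq (hw : IsExtendedValuation F w) (h0 : ϖ ≠ 0) (hϖ : val F ϖ = 1)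
    (h : IsRamifiedWith w p ϖ E π) [Algebra.IsSeparable F E] {d : ℕ}
    (hd : w (aeval π (minpoly F π).derivative) = w π ^ d) : discrIdeal E = 𝓂[F] ^ d := by
  obtain ⟨B, hB, hdisc⟩ := h.exists_discr hw h0 hϖ
  rw [hd, ← pow_mul, mul_comm d p, pow_mul, h.pow_eq] at hdisc
  have hϖ0 : w (algebraMap F Ω ϖ) ≠ 0 := by simpa using h0
  have hD0 : Algebra.discr F B ≠ 0 := by
    intro h1
    rw [h1, map_zero, map_zero] at hdisc
    exact pow_ne_zero d hϖ0 hdisc.symm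
  have hπ1 := hw.lt_one_of_pow_eq h0 hϖ h.pow_eq
  refine le_antisymm ?_ ?_
  · unfold discrIdeal
    rw [Ideal.span_le]
    rintro D ⟨b, hb⟩
    rw [SetLike.mem_coe, hw.mem_maximalIdeal_pow_iff h0 hϖ, hb]
    have h1 : (fun i => (b i : E)) =
        Matrix.vecMul B ((B.toMatrix fun i => (b i : E)).map (algebraMap F E)) :=
      (Basis.toMatrix_map_vecMul B _).symm
    rw [h1, Algebra.discr_of_matrix_vecMul, map_mul, map_mul, hdisc]
    refine mul_le_of_le_one_left' ?_
    rw [hw.algebraMap_le_one_iff]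
    have h2 (i j) : (B.toMatrix fun i => (b i : E)) i j ∈ 𝒪[F] := by
      rw [← hw.algebraMap_le_one_iff, Basis.toMatrix_apply]
      exact h.repr_le hw h0 hϖ B hB ((hw.mem_integralClosure_iff _).1 (b j).2) i
    rw [Matrix.det_apply]
    refine pow_mem (sum_mem fun σ _ => ?_) 2
    rw [Units.smul_def]
    exact zsmul_mem (prod_mem fun i _ => h2 _ _) _
  · intro x hx
    rw [hw.mem_maximalIdeal_pow_iff h0 hϖ, ← hdisc] at hx
    have hDle : w (algebraMap F Ω (Algebra.discr F B)) ≤ 1 := by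
      rw [hdisc]; exact pow_le_one' (hw.uniformizer_lt_one h0 hϖ).le d
    let D : 𝒪[F] := ⟨Algebra.discr F B, (hw.algebraMap_le_one_iff _).1 hDle⟩
    have hDmem : D ∈ discrIdeal E := by
      refine Ideal.subset_span ⟨fun i => ⟨B i, (hw.mem_integralClosure_iff _).2 ?_⟩, rfl⟩
      rw [hB, map_pow]
      exact pow_le_one' hπ1.le _
    have hy : (x : F) / Algebra.discr F B ∈ 𝒪[F] := by
      rw [← hw.algebraMap_le_one_iff (w := w), map_div₀, map_div₀]
      exact div_le_one_of_le₀ hx zero_le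
    have : x = ⟨_, hy⟩ * D := by
      apply Subtype.ext
      change (x : F) = (x : F) / Algebra.discr F B * Algebra.discr F B
      field_simp
    rw [this]
    exact Ideal.mul_mem_left _ _ hDmem

theorem serreC_eq (hw : IsExtendedValuation F w) (h0 : ϖ ≠ 0) (hϖ : val F ϖ = 1)
    (h : IsRamifiedWith w p ϖ E π) [Algebra.IsSeparable F E] {d : ℕ}
    (hd : w (aeval π (minpoly F π).derivative) = w π ^ d) : serreC E = d - (p - 1) := by
  have hm : 𝓂[F] ≠ ⊥ := by
    rw [maximalIdeal_eq_span h0 hϖ, Ne, Ideal.span_singleton_eq_bot]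
    intro h1
    exact h0 (congrArg Subtype.val h1)
  unfold serreC
  rw [h.discrIdeal_eq hw h0 hϖ hd, h.finrank_eq, multiplicity_pow_self hm]
  rw [Ideal.isUnit_iff]
  exact Ideal.IsPrime.ne_top inferInstance

end IsRamifiedWith

end Discriminant

/-! ### Representatives modulo a subgroup. -/

section Transversal

variable {G : Type*} [AddCommGroup G]

/-- `T` is a system of representatives of the set `C` modulo the subgroup `B`. -/
structure IsTransversal (B : AddSubgroup G) (C : Set G) (T : Finset G) : Prop where
  subset : ∀ t ∈ T, t ∈ C
  exists_sub_mem : ∀ x ∈ C, ∃ t ∈ T, x - t ∈ B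
  eq_of_sub_mem : ∀ s ∈ T, ∀ t ∈ T, s - t ∈ B → s = t

theorem IsTransversal.card_eq {A B : AddSubgroup G} {x₀ : G} {T : Finset G}
    (h : IsTransversal B {x | x - x₀ ∈ A} T) : T.card = B.relIndex A := by
  have hcard : T.card = Nat.card (T : Set G) := by simp
  rw [hcard, AddSubgroup.relIndex, AddSubgroup.index]
  refine Nat.card_eq_of_bijective
    (fun t : (T : Set G) => (QuotientAddGroup.mk (⟨(t : G) - x₀, h.subset t t.2⟩ : A) :
      A ⧸ B.addSubgroupOf A)) ⟨?_, ?_⟩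
  · intro s t hst
    rw [QuotientAddGroup.eq, AddSubgroup.mem_addSubgroupOf] at hst
    push_cast at hst
    rw [show -((s : G) - x₀) + ((t : G) - x₀) = t - s by abel] at hst
    exact Subtype.ext (h.eq_of_sub_mem t t.2 s s.2 hst).symm
  · intro y
    obtain ⟨a, rfl⟩ := QuotientAddGroup.mk_surjective y
    obtain ⟨t, ht, hat⟩ := h.exists_sub_mem (a + x₀) (by simp)
    refine ⟨⟨t, ht⟩, ?_⟩
    rw [QuotientAddGroup.eq, AddSubgroup.mem_addSubgroupOf]
    push_cast
    rwa [show -(t - x₀) + (a : G) = a + x₀ - t by abel]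

theorem exists_isTransversal {A B : AddSubgroup G} (hfin : B.relIndex A ≠ 0)
    (x₀ : G) : ∃ T : Finset G, IsTransversal B {x | x - x₀ ∈ A} T := by
  classical
  have : Finite (A ⧸ B.addSubgroupOf A) := Nat.finite_of_card_ne_zero hfin
  have := Fintype.ofFinite (A ⧸ B.addSubgroupOf A)
  refine ⟨Finset.univ.image fun y : A ⧸ B.addSubgroupOf A => (y.out : G) + x₀, ?_, ?_, ?_⟩
  · intro t ht
    obtain ⟨y, -, rfl⟩ := Finset.mem_image.1 ht
    simp
  · intro x hx
    refine ⟨_, Finset.mem_image_of_mem _ (Finset.mem_univ (QuotientAddGroup.mk ⟨x - x₀, hx⟩)), ?_⟩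
    have h1 := QuotientAddGroup.out_eq' (QuotientAddGroup.mk (⟨x - x₀, hx⟩ : A) :
      A ⧸ B.addSubgroupOf A)
    rw [QuotientAddGroup.eq, AddSubgroup.mem_addSubgroupOf] at h1
    push_cast at h1
    convert h1 using 1
    abel
  · intro s hs t ht hst
    obtain ⟨y, -, rfl⟩ := Finset.mem_image.1 hs
    obtain ⟨z, -, rfl⟩ := Finset.mem_image.1 ht
    rw [add_sub_add_right_eq_sub] at hst
    have h1 : (QuotientAddGroup.mk z.out : A ⧸ B.addSubgroupOf A) = QuotientAddGroup.mk y.out := by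
      rw [QuotientAddGroup.eq, AddSubgroup.mem_addSubgroupOf]
      push_cast
      rwa [neg_add_eq_sub]
    rw [QuotientAddGroup.out_eq', QuotientAddGroup.out_eq'] at h1
    rw [h1]

end Transversal

/-! ### Indices of balls. -/

section BallIndex

variable {F : Type*} [Field F] [ValuativeRel F] {L : Type*} [Field L] [Algebra F L]
  {v : Valuation L ℝ≥0} {π : L}

/-- Multiplication by π^k identifies the residue field with the quotient of two consecutive balls.
The hypotheses are abstract so as to cover both F and its totally ramified extensions, which have
the same residue field. -/
theorem relIndex_leAddSubgroup_succ (hπ0 : π ≠ 0)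
    (hO : ∀ a : 𝒪[F], v (algebraMap F L a) ≤ 1)
    (hm : ∀ a : 𝒪[F], IsLocalRing.residue 𝒪[F] a = 0 ↔ v (algebraMap F L a) < 1)
    (hres : ∀ x, v x ≤ 1 → ∃ a : 𝒪[F], v (x - algebraMap F L a) < 1) (hπ1 : v π < 1)
    (hdisc : ∀ x, v x < 1 → v x ≤ v π) (k : ℕ) :
    (v.leAddSubgroup (v π ^ (k + 1))).relIndex (v.leAddSubgroup (v π ^ k)) =
      Nat.card 𝓀[F] := by
  have hv0 : 0 < v π := by rw [zero_lt_iff]; simpa using hπ0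
  have hvk : 0 < v (π ^ k) := by rw [map_pow]; positivity
  have hlt (a : L) : v (a * π ^ k) ≤ v π ^ (k + 1) ↔ v a < 1 := by
    rw [map_mul, map_pow, pow_succ', mul_le_mul_iff_left₀ (by positivity)]
    exact ⟨fun h => h.trans_lt hπ1, hdisc a⟩
  let φ : 𝒪[F] →+ v.leAddSubgroup (v π ^ k) :=
    { toFun := fun a => ⟨algebraMap F L a * π ^ k, by
        rw [Valuation.mem_leAddSubgroup_iff, map_mul, map_pow]
        exact mul_le_of_le_one_left' (hO a)⟩
      map_zero' := by ext; simp
      map_add' := fun a b => by ext; simp [add_mul] }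
  let ψ := (QuotientAddGroup.mk' ((v.leAddSubgroup (v π ^ (k + 1))).addSubgroupOf
    (v.leAddSubgroup (v π ^ k)))).comp φ
  have hψ : Function.Surjective ψ := by
    intro y
    obtain ⟨x, rfl⟩ := QuotientAddGroup.mk_surjective y
    have hx : v (x / π ^ k) ≤ 1 := by
      rw [map_div₀, map_pow]
      exact div_le_one_of_le₀ x.2 zero_le
    obtain ⟨a, ha⟩ := hres _ hx
    refine ⟨a, ?_⟩
    change QuotientAddGroup.mk (φ a) = QuotientAddGroup.mk x
    rw [QuotientAddGroup.eq, AddSubgroup.mem_addSubgroupOf, Valuation.mem_leAddSubgroup_iff]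
    rw [← hlt] at ha
    convert ha using 2
    push_cast
    change -(algebraMap F L a * π ^ k) + (x : L) = _
    field_simp
    ring
  have hker : ψ.ker = (IsLocalRing.residue 𝒪[F] : 𝒪[F] →+ 𝓀[F]).ker := by
    ext a
    rw [AddMonoidHom.mem_ker, AddMonoidHom.mem_ker]
    change QuotientAddGroup.mk (φ a) = _ ↔ IsLocalRing.residue 𝒪[F] a = 0
    rw [QuotientAddGroup.eq_zero_iff, AddSubgroup.mem_addSubgroupOf,
      Valuation.mem_leAddSubgroup_iff, hm]
    exact hlt _
  have e1 := QuotientAddGroup.quotientKerEquivOfSurjective ψ hψ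
  have e2 := QuotientAddGroup.quotientKerEquivOfSurjective
    (IsLocalRing.residue 𝒪[F] : 𝒪[F] →+ 𝓀[F]) IsLocalRing.residue_surjective
  have e3 := QuotientAddGroup.quotientAddEquivOfEq hker
  exact Nat.card_congr ((e1.symm.trans e3).trans e2).toEquiv

theorem relIndex_leAddSubgroup_add (hπ0 : π ≠ 0)
    (hO : ∀ a : 𝒪[F], v (algebraMap F L a) ≤ 1)
    (hm : ∀ a : 𝒪[F], IsLocalRing.residue 𝒪[F] a = 0 ↔ v (algebraMap F L a) < 1)
    (hres : ∀ x, v x ≤ 1 → ∃ a : 𝒪[F], v (x - algebraMap F L a) < 1) (hπ1 : v π < 1)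
    (hdisc : ∀ x, v x < 1 → v x ≤ v π) (k n : ℕ) :
    (v.leAddSubgroup (v π ^ (k + n))).relIndex (v.leAddSubgroup (v π ^ k)) =
      Nat.card 𝓀[F] ^ n := by
  have hle {a b : ℕ} (hab : a ≤ b) : v.leAddSubgroup (v π ^ b) ≤ v.leAddSubgroup (v π ^ a) := by
    intro x hx
    rw [Valuation.mem_leAddSubgroup_iff] at hx ⊢
    exact hx.trans (pow_le_pow_right_of_le_one' hπ1.le hab)
  induction n with
  | zero => simp
  | succ n ih =>
    rw [← add_assoc, ← AddSubgroup.relIndex_mul_relIndex _ _ _ (hle (Nat.le_succ (k + n)))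
      (hle (Nat.le_add_right k n)), ih,
      relIndex_leAddSubgroup_succ hπ0 hO hm hres hπ1 hdisc, pow_succ']

end BallIndex

/-! ### Distance to the roots of a polynomial over an algebraically closed field. -/

section RootDistance

variable {Ω : Type*} [Field Ω] [DecidableEq Ω] {w : Valuation Ω ℝ≥0} {g : Polynomial Ω} {x y z : Ω}

theorem map_eval_eq_mul_prod (hs : g.Splits) (hm : g.Monic) (hy : y ∈ g.roots) :
    w (g.eval x) = w (x - y) * ((g.roots.erase y).map fun z => w (x - z)).prod := by
  rw [hs.eval_eq_prod_roots_of_monic hm, map_multiset_prod, Multiset.map_map]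
  exact (Multiset.prod_map_erase (f := fun z => w (x - z)) hy).symm

theorem map_eval_derivative_eq_prod (hs : g.Splits) (hm : g.Monic) (hy : y ∈ g.roots) :
    w (g.derivative.eval y) = ((g.roots.erase y).map fun z => w (y - z)).prod := by
  rw [hs.eval_root_derivative hm hy, map_multiset_prod, Multiset.map_map]
  rfl

/-- The derivative at y is a product of differences of absolute value at most 1; all but one of them
are dropped. -/
theorem map_eval_derivative_le (hs : g.Splits) (hm : g.Monic) (hy : y ∈ g.roots)
    (hz : z ∈ g.roots) (hne : z ≠ y) (h1 : ∀ u ∈ g.roots, w u ≤ 1) :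
    w (g.derivative.eval y) ≤ w (y - z) := by
  rw [map_eval_derivative_eq_prod hs hm hy]
  have hz' : z ∈ g.roots.erase y := (Multiset.mem_erase_of_ne hne).2 hz
  rw [← Multiset.prod_map_erase hz']
  refine mul_le_of_le_one_right' ?_
  refine Multiset.prod_induction (fun r : ℝ≥0 => r ≤ 1) _ (fun a b ha hb => mul_le_one' ha hb)
    le_rfl fun r hr => ?_
  obtain ⟨u, hu, rfl⟩ := Multiset.mem_map.1 hr
  refine (w.map_sub y u).trans (max_le (h1 y hy) (h1 u ?_))
  exact Multiset.mem_of_mem_erase (Multiset.mem_of_mem_erase hu)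

/-- Let y be the root nearest to x. Then |y - z| ≤ |x - z| for every other root z, and the products
over z are compared. -/
theorem exists_root_mul_derivative_le (hs : g.Splits) (hm : g.Monic) (hdeg : 0 < g.natDegree)
    (x : Ω) : ∃ y ∈ g.roots, w (x - y) * w (g.derivative.eval y) ≤ w (g.eval x) := by
  have hne : g.roots.toFinset.Nonempty := by
    rw [Multiset.toFinset_nonempty, ← Multiset.card_pos, ← hs.natDegree_eq_card_roots]
    exact hdeg
  obtain ⟨y, hy, hmin⟩ := Finset.exists_min_image g.roots.toFinset (fun y => w (x - y)) hne
  rw [Multiset.mem_toFinset] at hy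
  refine ⟨y, hy, ?_⟩
  rw [map_eval_eq_mul_prod hs hm hy, map_eval_derivative_eq_prod hs hm hy]
  gcongr 1
  refine Multiset.prod_map_le_prod_map _ _ fun z hz => ?_
  have h1 : w (x - y) ≤ w (x - z) :=
    hmin z (Multiset.mem_toFinset.2 (Multiset.mem_of_mem_erase hz))
  have h2 := w.map_sub (x - z) (x - y)
  rw [sub_sub_sub_cancel_left, max_eq_left h1] at h2
  exact h2

/-- Since |x - y| is below |g'(y)|, it is below the distance from y to any other root z, whence |x -
z| ≤ |y - z| factor by factor. -/
theorem map_eval_le_of_close (hs : g.Splits) (hm : g.Monic) (hy : y ∈ g.roots)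
    (h1 : ∀ u ∈ g.roots, w u ≤ 1) (hclose : w (x - y) < w (g.derivative.eval y)) :
    w (g.eval x) ≤ w (x - y) * w (g.derivative.eval y) := by
  have hd : g.derivative.eval y ≠ 0 := by
    intro h
    rw [h, map_zero] at hclose
    exact not_lt_zero hclose
  rw [map_eval_eq_mul_prod hs hm hy]
  conv_rhs => rw [map_eval_derivative_eq_prod hs hm hy]
  gcongr 1
  refine Multiset.prod_map_le_prod_map _ _ fun z hz => ?_
  have hzy : z ≠ y := by
    rintro rfl
    apply hd
    rw [hs.eval_root_derivative hm hy]
    exact Multiset.prod_eq_zero (Multiset.mem_map.2 ⟨z, hz, sub_self z⟩)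
  have h2 := map_eval_derivative_le (w := w) hs hm hy (Multiset.mem_of_mem_erase hz) hzy h1
  have h3 := w.map_add (x - y) (y - z)
  rw [sub_add_sub_cancel, max_eq_right (hclose.le.trans h2)] at h3
  exact h3

end RootDistance

/-! ### Krasner's lemma for Eisenstein polynomials. -/

section Approximation

variable {F : Type*} [Field F] [ValuativeRel F] [TopologicalSpace F]
  [IsNonarchimedeanLocalField F] {Ω : Type*} [Field Ω] [Algebra F Ω]
  {w : Valuation Ω ℝ≥0} {p : ℕ} [CharP 𝓀[F] p] [Fact p.Prime] {ϖ : F}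
  [IsAlgClosure F Ω] {ρ : ℝ≥0} {d N : ℕ} {f g : F[X]} {x y : Ω}

/-- `f` is an Eisenstein polynomial, and the derivative of `f` at the roots of `f` has the absolute
value `ρ ^ d`, where `ρ ^ p` is the absolute value of `ϖ`. -/
structure HasDifferent (w : Valuation Ω ℝ≥0) (p : ℕ) (ϖ : F) (ρ : ℝ≥0) (d : ℕ) (f : F[X]) :
    Prop where
  isEisensteinPoly : IsEisensteinPoly w p ϖ f
  map_derivative (y : Ω) : aeval y f = 0 → w (aeval y f.derivative) = ρ ^ d

/-- The coefficients of `f` and `g` are congruent modulo `ϖ ^ N`. -/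
def CoeffClose (w : Valuation Ω ℝ≥0) (p : ℕ) (ϖ : F) (N : ℕ) (f g : F[X]) : Prop :=
  ∀ l < p, w (algebraMap F Ω (f.coeff l - g.coeff l)) ≤ w (algebraMap F Ω ϖ) ^ N

theorem IsEisensteinPoly.map_root (hw : IsExtendedValuation F w) (h0 : ϖ ≠ 0)
    (hϖ : val F ϖ = 1) (hρ : ρ ^ p = w (algebraMap F Ω ϖ)) (hf : IsEisensteinPoly w p ϖ f)
    (hy : aeval y f = 0) : w y = ρ := by
  have hp : p.Prime := Fact.out
  exact pow_left_injective hp.ne_zero ((hf.root hw h0 hϖ hy).trans hρ.symm)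

theorem radius_pos (h0 : ϖ ≠ 0) (hρ : ρ ^ p = w (algebraMap F Ω ϖ)) : 0 < ρ := by
  have hp : p.Prime := Fact.out
  rw [pos_iff_ne_zero]
  rintro rfl
  rw [zero_pow hp.ne_zero, eq_comm] at hρ
  simp [h0] at hρ

theorem radius_lt_one (hw : IsExtendedValuation F w) (h0 : ϖ ≠ 0) (hϖ : val F ϖ = 1)
    (hρ : ρ ^ p = w (algebraMap F Ω ϖ)) : ρ < 1 := by
  have hp : p.Prime := Fact.out
  have := hw.uniformizer_lt_one h0 hϖ
  rw [← hρ] at this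
  exact (pow_lt_one_iff hp.ne_zero).1 this

namespace HasDifferent

theorem mem_roots_iff (hf : HasDifferent w p ϖ ρ d f) (y : Ω) :
    y ∈ (f.map (algebraMap F Ω)).roots ↔ aeval y f = 0 := by
  have h1 : f.map (algebraMap F Ω) ≠ 0 := (hf.isEisensteinPoly.monic.map _).ne_zero
  rw [mem_roots h1, IsRoot.def, eval_map_algebraMap]

theorem roots_le_one (hw : IsExtendedValuation F w) (h0 : ϖ ≠ 0) (hϖ : val F ϖ = 1)
    (hf : HasDifferent w p ϖ ρ d f) (u : Ω) (hu : u ∈ (f.map (algebraMap F Ω)).roots) :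
    w u ≤ 1 :=
  (hw.lt_one_of_pow_eq h0 hϖ
    (hf.isEisensteinPoly.root hw h0 hϖ ((hf.mem_roots_iff u).1 hu))).le

theorem le_sub (hw : IsExtendedValuation F w) (h0 : ϖ ≠ 0) (hϖ : val F ϖ = 1)
    (hf : HasDifferent w p ϖ ρ d f) (hx : aeval x f = 0) (hy : aeval y f = 0) (hne : x ≠ y) :
    ρ ^ d ≤ w (x - y) := by
  classical
  have : IsAlgClosed Ω := IsAlgClosure.isAlgClosed F
  have h1 := map_eval_derivative_le (w := w) (IsAlgClosed.splits (f.map (algebraMap F Ω)))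
    (hf.isEisensteinPoly.monic.map _) ((hf.mem_roots_iff x).2 hx) ((hf.mem_roots_iff y).2 hy)
    hne.symm (hf.roots_le_one hw h0 hϖ)
  rwa [derivative_map, eval_map_algebraMap, hf.map_derivative x hx] at h1

theorem eq_of_sub_lt (hw : IsExtendedValuation F w) (h0 : ϖ ≠ 0) (hϖ : val F ϖ = 1)
    (hf : HasDifferent w p ϖ ρ d f) (hx : aeval x f = 0) (hy : aeval y f = 0)
    (hlt : w (x - y) < ρ ^ d) : x = y := by
  by_contra hne
  exact absurd (hf.le_sub hw h0 hϖ hx hy hne) (not_le.2 hlt)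

theorem separable (h0 : ϖ ≠ 0) (hw : IsExtendedValuation F w) (hϖ : val F ϖ = 1)
    (hρ : ρ ^ p = w (algebraMap F Ω ϖ)) (hf : HasDifferent w p ϖ ρ d f) (hx : aeval x f = 0) :
    f.Separable := by
  have : Algebra.IsAlgebraic F Ω := IsAlgClosure.isAlgebraic
  have hirr : Irreducible f := by
    rw [← hf.isEisensteinPoly.minpoly_eq hw h0 hϖ hx]
    exact minpoly.irreducible (Algebra.IsIntegral.isIntegral x)
  rw [separable_iff_derivative_ne_zero hirr]
  intro h1
  have h2 := hf.map_derivative x hx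
  rw [h1, map_zero, map_zero, eq_comm] at h2
  exact pow_ne_zero d (radius_pos h0 hρ).ne' h2

theorem map_aeval_le_of_coeffClose (hw : IsExtendedValuation F w) (h0 : ϖ ≠ 0)
    (hϖ : val F ϖ = 1) (hρ : ρ ^ p = w (algebraMap F Ω ϖ)) (hf : IsEisensteinPoly w p ϖ f)
    (hg : IsEisensteinPoly w p ϖ g) (hfg : CoeffClose w p ϖ N f g) (hx : aeval x g = 0) :
    w (aeval x f) ≤ ρ ^ (p * N) := by
  have hx1 := (hw.lt_one_of_pow_eq h0 hϖ (hg.root hw h0 hϖ hx)).le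
  have h1 : aeval x f = ∑ l ∈ Finset.range p,
      algebraMap F Ω (f.coeff l - g.coeff l) * x ^ l := by
    rw [← sub_zero (aeval x f), ← hx, hf.aeval_eq, hg.aeval_eq]
    simp only [map_sub, sub_mul, Finset.sum_sub_distrib]
    ring
  rw [h1, pow_mul, hρ]
  refine w.map_sum_le fun l hl => ?_
  rw [map_mul, map_pow]
  exact (mul_le_of_le_one_right' (pow_le_one' hx1 l)).trans (hfg l (Finset.mem_range.1 hl))

/-- Krasner's lemma: a polynomial with coefficients close to those of the minimal polynomial of `x`
has a root close to `x` in the field generated by `x`. -/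
theorem exists_close_root (hw : IsExtendedValuation F w) (h0 : ϖ ≠ 0) (hϖ : val F ϖ = 1)
    (hρ : ρ ^ p = w (algebraMap F Ω ϖ)) (hN : 2 * d < p * N) (hf : HasDifferent w p ϖ ρ d f)
    (hg : IsEisensteinPoly w p ϖ g) (hfg : CoeffClose w p ϖ N f g) (hx : aeval x g = 0) :
    ∃ y, aeval y f = 0 ∧ w (x - y) ≤ ρ ^ (p * N - d) ∧ y ∈ IntermediateField.adjoin F {x} := by
  classical
  have hp : p.Prime := Fact.out
  have : Algebra.IsAlgebraic F Ω := IsAlgClosure.isAlgebraic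
  have : IsAlgClosed Ω := IsAlgClosure.isAlgClosed F
  have hρ0 := radius_pos h0 hρ
  have hρ1 := radius_lt_one hw h0 hϖ hρ
  obtain ⟨y, hy, hle⟩ := exists_root_mul_derivative_le (w := w)
    (IsAlgClosed.splits (f.map (algebraMap F Ω))) (hf.isEisensteinPoly.monic.map _)
    (by rw [natDegree_map, hf.isEisensteinPoly.natDegree_eq]; exact hp.pos) x
  rw [hf.mem_roots_iff] at hy
  rw [derivative_map, eval_map_algebraMap, eval_map_algebraMap, hf.map_derivative y hy] at hle
  have h1 := hle.trans (map_aeval_le_of_coeffClose hw h0 hϖ hρ hf.isEisensteinPoly hg hfg hx)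
  have h2 : w (x - y) ≤ ρ ^ (p * N - d) := by
    rw [← Nat.sub_add_cancel (show d ≤ p * N by omega), pow_add] at h1
    exact le_of_mul_le_mul_right h1 (by positivity)
  refine ⟨y, hy, h2, ?_⟩
  have hlt : ρ ^ (p * N - d) < ρ ^ d := pow_lt_pow_right_of_lt_one₀ hρ0 hρ1 (by omega)
  refine mem_of_forall_fixed _ ?_ ?_
  · unfold IsSeparable
    rw [hf.isEisensteinPoly.minpoly_eq hw h0 hϖ hy]
    exact hf.separable h0 hw hϖ hρ hy
  -- As τ fixes x, both y and τ(y) are close to x, and they are roots of f. Distinct roots of f are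
  -- at distance at least ρ^d, so τ(y) = y.
  · intro τ hτ
    have hτy : aeval (τ y) f = 0 := by rw [aeval_algHom_apply τ y f, hy, map_zero]
    refine hf.eq_of_sub_lt hw h0 hϖ hτy hy (lt_of_le_of_lt ?_ hlt)
    have h3 : w (τ y - x) ≤ ρ ^ (p * N - d) := by
      rw [← hτ x (IntermediateField.mem_adjoin_simple_self F x), ← map_sub, hw.map_algEquiv,
        w.map_sub_swap]
      exact h2
    have h4 := w.map_add (τ y - x) (x - y)
    rw [sub_add_sub_cancel] at h4
    exact h4.trans (max_le h3 h2)

/-- As x is near the root y of f, the value f(x) is small, and it equals (f - g)(x). This polynomial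
has degree less than p and x is a uniformizer, so no cancellation occurs and every coefficient is
small. -/
theorem coeffClose_of_close (hw : IsExtendedValuation F w) (h0 : ϖ ≠ 0) (hϖ : val F ϖ = 1)
    (hρ : ρ ^ p = w (algebraMap F Ω ϖ)) (hN : 2 * d < p * N) (hf : HasDifferent w p ϖ ρ d f)
    (hg : IsEisensteinPoly w p ϖ g) (hx : aeval x g = 0) (hy : aeval y f = 0)
    (hxy : w (x - y) ≤ ρ ^ (p * N - d)) : CoeffClose w p ϖ N f g := by
  classical
  have hp : p.Prime := Fact.out
  have : IsAlgClosed Ω := IsAlgClosure.isAlgClosed F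
  have hρ0 := radius_pos h0 hρ
  have hρ1 := radius_lt_one hw h0 hϖ hρ
  have hπ := hg.root hw h0 hϖ hx
  have hwx := hg.map_root hw h0 hϖ hρ hx
  have hlt : ρ ^ (p * N - d) < ρ ^ d := pow_lt_pow_right_of_lt_one₀ hρ0 hρ1 (by omega)
  have h1 := map_eval_le_of_close (x := x) (w := w)
    (IsAlgClosed.splits (f.map (algebraMap F Ω))) (hf.isEisensteinPoly.monic.map _)
    ((hf.mem_roots_iff y).2 hy) (hf.roots_le_one hw h0 hϖ) (by
      rw [derivative_map, eval_map_algebraMap, hf.map_derivative y hy]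
      exact hxy.trans_lt hlt)
  rw [derivative_map, eval_map_algebraMap, eval_map_algebraMap, hf.map_derivative y hy] at h1
  have h2 : w (aeval x (f - g)) ≤ ρ ^ (p * N) := by
    rw [map_sub, hx, sub_zero, ← Nat.sub_add_cancel (show d ≤ p * N by omega), pow_add]
    exact h1.trans (mul_le_mul_left hxy _)
  have hdeg : (f - g).natDegree < p := by
    by_cases hfg : f - g = 0
    · rw [hfg, natDegree_zero]; exact hp.pos
    have hm := hf.isEisensteinPoly.monic
    rw [natDegree_lt_iff_degree_lt hfg, ← hf.isEisensteinPoly.natDegree_eq,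
      ← degree_eq_natDegree hm.ne_zero]
    refine degree_sub_lt_left ?_ hm.ne_zero (hm.leadingCoeff.trans hg.monic.leadingCoeff.symm)
    rw [degree_eq_natDegree hm.ne_zero, degree_eq_natDegree hg.monic.ne_zero,
      hf.isEisensteinPoly.natDegree_eq, hg.natDegree_eq]
  intro l hl
  rw [← coeff_sub]
  by_cases hc : (f - g).coeff l = 0
  · simp [hc]
  have h3 := (hw.coeff_le h0 hϖ hπ hdeg l).trans h2
  rw [map_mul, map_pow, hw.eq_zpow h0 hϖ hc, ← hρ, hwx, ← zpow_natCast, ← zpow_natCast,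
    ← zpow_natCast, ← zpow_mul, ← zpow_add₀ hρ0.ne', zpow_le_zpow_iff_right_of_lt_one₀ hρ0 hρ1] at h3
  rw [hw.eq_zpow h0 hϖ hc, ← zpow_natCast,
    zpow_le_zpow_iff_right_of_lt_one₀ (by rw [← hρ]; positivity) (hw.uniformizer_lt_one h0 hϖ)]
  -- From p v + l ≥ pN and l < p one gets v ≥ N.
  by_contra! h4
  have h5 : (p : ℤ) * val F ((f - g).coeff l) ≤ p * (N - 1) :=
    mul_le_mul_of_nonneg_left (by omega) (by positivity)
  push_cast at h3
  have h6 : (l : ℤ) < p := by exact_mod_cast hl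
  linarith

end HasDifferent

end Approximation

/-! ### Uniformizers whose p-th power is close to ϖ. -/

section AdaptedUniformizers

variable {F : Type*} [Field F] [ValuativeRel F] [TopologicalSpace F]
  [IsNonarchimedeanLocalField F] {Ω : Type*} [Field Ω] [Algebra F Ω]
  {w : Valuation Ω ℝ≥0} {p : ℕ} [CharP 𝓀[F] p] [Fact p.Prime] {ϖ : F}
  [IsAlgClosure F Ω] {ρ : ℝ≥0} {E : IntermediateField F Ω} {π : Ω}

theorem IsExtendedValuation.prime_lt_one (hw : IsExtendedValuation F w) : w (p : Ω) < 1 :=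
  (hw.natCast_lt_one_iff p).2 dvd_rfl

/-- Modulo p the difference is z^p: Frobenius is injective on residues. -/
theorem IsExtendedValuation.one_add_pow_prime_sub_one_lt_iff (hw : IsExtendedValuation F w)
    {z : Ω} (hz : w z ≤ 1) : w ((1 + z) ^ p - 1) < 1 ↔ w z < 1 := by
  have hp : p.Prime := Fact.out
  obtain ⟨g, hg, h⟩ := exists_one_add_pow_prime_eq (p := p) w hz
  have h1 : w (p * (z + z ^ 2 * g)) < 1 := by
    rw [map_mul]
    refine mul_lt_one_of_lt_of_le (hw.prime_lt_one (p := p)) ?_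
    refine (w.map_add _ _).trans (max_le hz ?_)
    rw [map_mul, map_pow]
    exact mul_le_one' (pow_le_one' hz 2) hg
  rw [← pow_lt_one_iff (x := w z) hp.ne_zero, ← map_pow]
  constructor
  · intro h2
    have := w.map_sub_lt h2 h1
    convert this using 2
    rw [h]; ring
  · intro h2
    have := w.map_add_lt h2 h1
    convert this using 2
    rw [h]; ring

theorem IsRamifiedWith.of_near (hE : finrank F E = p) (hπ : π ∈ E)
    (h : Near w (π ^ p) (algebraMap F Ω ϖ)) : IsRamifiedWith w p ϖ E π :=
  ⟨hE, hπ, by rw [← map_pow, h.map_eq]⟩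

/-- The unit π^p/ϖ has its residue in the finite field 𝓀[F], on which Frobenius is surjective.
Dividing π by a lift of the p-th root of this residue normalizes it. -/
theorem IsRamifiedWith.exists_near (hw : IsExtendedValuation F w) (h0 : ϖ ≠ 0)
    (hϖ : val F ϖ = 1) (h : IsRamifiedWith w p ϖ E π) :
    ∃ x ∈ E, Near w (x ^ p) (algebraMap F Ω ϖ) := by
  have hp : p.Prime := Fact.out
  have hϖ0 : algebraMap F Ω ϖ ≠ 0 := by simpa using h0
  have hu : w (π ^ p / algebraMap F Ω ϖ) = 1 := by
    rw [map_div₀, map_pow, h.pow_eq, div_self]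
    simpa using h0
  obtain ⟨a, ha⟩ := h.exists_residue hw h0 hϖ (div_mem (pow_mem h.mem p) (E.algebraMap_mem ϖ)) hu.le
  have : Finite 𝓀[F] := inferInstance
  have hfrob : Function.Surjective (frobenius 𝓀[F] p) :=
    Finite.surjective_of_injective (frobenius_inj 𝓀[F] p)
  obtain ⟨b', hb'⟩ := hfrob (IsLocalRing.residue 𝒪[F] a)
  obtain ⟨b, rfl⟩ := IsLocalRing.residue_surjective b'
  rw [frobenius_def, ← map_pow, hw.residue_eq_iff] at hb'
  have h1 : Near w (algebraMap F Ω a) (π ^ p / algebraMap F Ω ϖ) := by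
    unfold Near
    rw [hu, w.map_sub_swap]
    exact ha
  have h2 : Near w (algebraMap F Ω b ^ p) (algebraMap F Ω a) := by
    unfold Near
    rw [h1.map_eq, hu]
    simpa using hb'
  have h3 := h2.trans h1
  have hb0 : algebraMap F Ω b ≠ 0 := by
    intro h4
    have := h3.ne_zero
    rw [h4, zero_pow hp.ne_zero] at this
    exact this rfl
  refine ⟨π / algebraMap F Ω b, div_mem h.mem (E.algebraMap_mem b), ?_⟩
  have h4 := h3.symm.mul (Near.refl (w := w) (div_ne_zero hϖ0 (pow_ne_zero p hb0)))
  convert h4 using 1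
  · rw [div_pow]; field_simp
  · field_simp

/-- The condition says that x/π has residue 1, and in E the largest absolute value below ρ is ρ².
The normalized uniformizers thus form a single coset of a ball. -/
theorem IsRamifiedWith.near_iff (hw : IsExtendedValuation F w) (h0 : ϖ ≠ 0) (hϖ : val F ϖ = 1)
    (hρ : ρ ^ p = w (algebraMap F Ω ϖ)) (h : IsRamifiedWith w p ϖ E π)
    (hnear : Near w (π ^ p) (algebraMap F Ω ϖ)) {x : Ω} (hx : x ∈ E) :
    Near w (x ^ p) (algebraMap F Ω ϖ) ↔ w (x - π) ≤ ρ ^ 2 := by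
  have hp : p.Prime := Fact.out
  have hρ0 := radius_pos h0 hρ
  have hρ1 := radius_lt_one hw h0 hϖ hρ
  have hwπ : w π = ρ := pow_left_injective hp.ne_zero (h.pow_eq.trans hρ.symm)
  have hπ0 := uniformizer_ne_zero h0 h.pow_eq
  have hiff : Near w (x ^ p) (algebraMap F Ω ϖ) ↔ Near w (x ^ p) (π ^ p) :=
    ⟨fun h1 => h1.trans hnear.symm, fun h1 => h1.trans hnear⟩
  have hz : (x - π) / π = x / π - 1 := by field_simp
  have hlt : w (x - π) ≤ ρ ^ 2 ↔ w (x / π - 1) < 1 := by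
    rw [← hz, map_div₀, hwπ]
    constructor
    · intro h1
      rw [div_lt_one₀ hρ0]
      refine h1.trans_lt ?_
      rw [sq]
      exact mul_lt_of_lt_one_left hρ0 hρ1
    · intro h1
      have h2 := h.le_of_lt_one hw h0 hϖ (div_mem (sub_mem hx h.mem) h.mem)
        (by rwa [map_div₀, hwπ])
      rw [map_div₀, hwπ, div_le_iff₀ hρ0, ← sq] at h2
      exact h2
  have hpow : Near w (x ^ p) (π ^ p) ↔ w ((1 + (x / π - 1)) ^ p - 1) < 1 := by
    rw [add_sub_cancel, div_pow, ← hw.reduces_one_iff (p := p),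
      hw.reduces_div_one_iff (pow_ne_zero _ hπ0)]
  rw [hiff, hpow, hlt]
  by_cases hz1 : w (x / π - 1) ≤ 1
  · exact hw.one_add_pow_prime_sub_one_lt_iff hz1
  · refine ⟨fun h1 => ?_, fun h1 => absurd h1.le hz1⟩
    exfalso
    apply hz1
    rw [← hpow] at h1
    have h2 : w x = w π := by
      have := h1.map_eq
      rw [map_pow, map_pow] at this
      exact pow_left_injective hp.ne_zero this
    refine (w.map_sub _ _).trans (max_le ?_ w.map_one.le)
    rw [map_div₀, h2]
    exact div_self_le_one _

/-- The normalized uniformizers form a coset of the ball of radius ρ², which splits into q^n balls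
of radius ρ^(2+n), q being the cardinality of the residue field. -/
theorem IsRamifiedWith.card_eq_of_transversal (hw : IsExtendedValuation F w) (h0 : ϖ ≠ 0)
    (hϖ : val F ϖ = 1) (hρ : ρ ^ p = w (algebraMap F Ω ϖ)) (h : IsRamifiedWith w p ϖ E π)
    {n : ℕ} {T : Finset Ω} (hT : ∀ t ∈ T, t ∈ E ∧ Near w (t ^ p) (algebraMap F Ω ϖ))
    (hex : ∀ x ∈ E, Near w (x ^ p) (algebraMap F Ω ϖ) → ∃ t ∈ T, w (x - t) ≤ ρ ^ (2 + n))
    (hun : ∀ s ∈ T, ∀ t ∈ T, w (s - t) ≤ ρ ^ (2 + n) → s = t) : T.card = Nat.card 𝓀[F] ^ n := by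
  classical
  have hp : p.Prime := Fact.out
  obtain ⟨π₀, hmem, hnear⟩ := h.exists_near hw h0 hϖ
  have h' : IsRamifiedWith w p ϖ E π₀ := .of_near h.finrank_eq hmem hnear
  have hwπ : w π₀ = ρ := pow_left_injective hp.ne_zero (h'.pow_eq.trans hρ.symm)
  let v : Valuation E ℝ≥0 := w.comap (algebraMap E Ω)
  have hv (x : E) : v x = w (x : Ω) := rfl
  let x₀ : E := ⟨π₀, hmem⟩
  have hvx : v x₀ = ρ := hwπ
  have hindex := relIndex_leAddSubgroup_add (F := F) (v := v) (π := x₀)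
    (by intro h1; exact uniformizer_ne_zero h0 h'.pow_eq (congrArg Subtype.val h1))
    (fun a => (hw.algebraMap_le_one_iff a).2 a.2) (fun a => hw.residue_eq_zero_iff a)
    (fun x hx => h'.exists_residue hw h0 hϖ x.2 hx) (hw.lt_one_of_pow_eq h0 hϖ h'.pow_eq)
    (fun x hx => h'.le_of_lt_one hw h0 hϖ x.2 hx) 2 n
  rw [hvx] at hindex
  have htr : IsTransversal (v.leAddSubgroup (ρ ^ (2 + n)))
      {x | x - x₀ ∈ v.leAddSubgroup (ρ ^ 2)} (T.subtype (· ∈ E)) := by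
    refine ⟨?_, ?_, ?_⟩
    · intro t ht
      rw [Finset.mem_subtype] at ht
      exact (h'.near_iff hw h0 hϖ hρ hnear t.2).1 (hT _ ht).2
    · intro x hx
      obtain ⟨t, ht, hxt⟩ := hex x x.2 ((h'.near_iff hw h0 hϖ hρ hnear x.2).2 hx)
      exact ⟨⟨t, (hT t ht).1⟩, Finset.mem_subtype.2 ht, hxt⟩
    · intro s hs t ht hst
      exact Subtype.ext (hun _ (Finset.mem_subtype.1 hs) _ (Finset.mem_subtype.1 ht) hst)
  rw [← hindex, ← htr.card_eq, Finset.card_subtype, Finset.filter_true_of_mem]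
  exact fun t ht => (hT t ht).1

end AdaptedUniformizers

/-! ### From polynomials to fields. -/

section Counting

variable {F : Type*} [Field F] [ValuativeRel F] [TopologicalSpace F]
  [IsNonarchimedeanLocalField F] {Ω : Type*} [Field Ω] [Algebra F Ω]
  {w : Valuation Ω ℝ≥0} {p : ℕ} [CharP 𝓀[F] p] [Fact p.Prime] {ϖ : F}
  [IsAlgClosure F Ω] {ρ : ℝ≥0} {d N : ℕ}

theorem HasDifferent.card_roots [DecidableEq Ω] (hw : IsExtendedValuation F w) (h0 : ϖ ≠ 0)
    (hϖ : val F ϖ = 1) (hρ : ρ ^ p = w (algebraMap F Ω ϖ)) {f : F[X]}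
    (hf : HasDifferent w p ϖ ρ d f) :
    (f.map (algebraMap F Ω)).roots.toFinset.card = p := by
  have hp : p.Prime := Fact.out
  have : IsAlgClosed Ω := IsAlgClosure.isAlgClosed F
  have hdeg : (f.map (algebraMap F Ω)).roots.card = p := by
    rw [← (IsAlgClosed.splits (f.map (algebraMap F Ω))).natDegree_eq_card_roots, natDegree_map,
      hf.isEisensteinPoly.natDegree_eq]
  obtain ⟨x, hx⟩ := Multiset.card_pos_iff_exists_mem.1 (by rw [hdeg]; exact hp.pos)
  have hsep := hf.separable h0 hw hϖ hρ ((hf.mem_roots_iff x).1 hx)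
  rw [Multiset.toFinset_card_of_nodup (nodup_roots (hsep.map (f := algebraMap F Ω))), hdeg]

/-- The number of fields generated by the roots of a set of Eisenstein polynomials, from the number
of the polynomials modulo `ϖ ^ N`. -/
theorem finite_and_ncard_mul_eq (hw : IsExtendedValuation F w) (h0 : ϖ ≠ 0)
    (hϖ : val F ϖ = 1) (hρ : ρ ^ p = w (algebraMap F Ω ϖ)) (hN : 2 * d < p * N)
    (hd : d + 2 ≤ p * N) {S : Set (IntermediateField F Ω)} {X : Set F[X]} {X₀ : Finset F[X]}
    (hX : ∀ f ∈ X, HasDifferent w p ϖ ρ d f ∧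
      Near w (algebraMap F Ω (-f.coeff 0)) (algebraMap F Ω ϖ))
    (hX₀ : ∀ f ∈ X₀, f ∈ X) (hrep : ∀ g ∈ X, ∃ f ∈ X₀, CoeffClose w p ϖ N f g)
    (hirr : ∀ f ∈ X₀, ∀ g ∈ X₀, CoeffClose w p ϖ N f g → f = g)
    (hS : ∀ E ∈ S, ∃ π, IsRamifiedWith w p ϖ E π)
    (hSX : ∀ E ∈ S, ∀ x ∈ E, Near w (x ^ p) (algebraMap F Ω ϖ) → minpoly F x ∈ X)
    (hXS : ∀ f ∈ X, ∀ x : Ω, aeval x f = 0 → IntermediateField.adjoin F {x} ∈ S) :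
    S.Finite ∧ S.ncard * Nat.card 𝓀[F] ^ (p * N - d - 2) = p * X₀.card := by
  classical
  have hp : p.Prime := Fact.out
  have : Algebra.IsAlgebraic F Ω := IsAlgClosure.isAlgebraic
  have hρ0 := radius_pos h0 hρ
  have hρ1 := radius_lt_one hw h0 hϖ hρ
  -- The roots of the representative polynomials are counted in two ways: each polynomial has p of
  -- them, and they are also sorted by the field they generate.
  let U : Finset Ω := X₀.biUnion fun f => (f.map (algebraMap F Ω)).roots.toFinset
  have hmemU (y : Ω) : y ∈ U ↔ ∃ f ∈ X₀, aeval y f = 0 := by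
    simp only [U, Finset.mem_biUnion, Multiset.mem_toFinset]
    exact exists_congr fun f => and_congr_right fun hf =>
      (hX f (hX₀ f hf)).1.mem_roots_iff y
  have hclose (E) (hE : E ∈ S) (x) (hx : x ∈ E) (hnear : Near w (x ^ p) (algebraMap F Ω ϖ)) :
      ∃ y ∈ U, w (x - y) ≤ ρ ^ (p * N - d) ∧ IntermediateField.adjoin F {y} = E := by
    obtain ⟨π, hπ⟩ := hS E hE
    have hEx : IsRamifiedWith w p ϖ E x := .of_near hπ.finrank_eq hx hnear
    obtain ⟨f, hf, hfx⟩ := hrep _ (hSX E hE x hx hnear)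
    have hdf := (hX f (hX₀ f hf)).1
    obtain ⟨y, hy, hxy, hmem⟩ := hdf.exists_close_root hw h0 hϖ hρ hN
      (hEx.isEisensteinPoly hw h0 hϖ) hfx (minpoly.aeval F x)
    rw [hEx.adjoin_eq hw h0 hϖ] at hmem
    have hEy : IsRamifiedWith w p ϖ E y :=
      ⟨hπ.finrank_eq, hmem, hdf.isEisensteinPoly.root hw h0 hϖ hy⟩
    exact ⟨y, (hmemU y).2 ⟨f, hf, hy⟩, hxy, hEy.adjoin_eq hw h0 hϖ⟩
  have hSU : S = (U.image fun y => IntermediateField.adjoin F {y} : Set _) := by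
    ext E
    rw [Finset.mem_coe, Finset.mem_image]
    constructor
    · intro hE
      obtain ⟨π, hπ⟩ := hS E hE
      obtain ⟨x, hx, hnear⟩ := hπ.exists_near hw h0 hϖ
      obtain ⟨y, hy, -, h1⟩ := hclose E hE x hx hnear
      exact ⟨y, hy, h1⟩
    · rintro ⟨y, hy, rfl⟩
      obtain ⟨f, hf, h1⟩ := (hmemU y).1 hy
      exact hXS f (hX₀ f hf) y h1
  refine ⟨hSU ▸ Finset.finite_toSet _, ?_⟩
  have hcardU : U.card = p * X₀.card := by
    rw [Finset.card_biUnion, Finset.sum_congr rfl fun f hf =>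
      (hX f (hX₀ f hf)).1.card_roots hw h0 hϖ hρ, Finset.sum_const, smul_eq_mul, mul_comm]
    intro f hf g hg hne
    rw [Function.onFun, Finset.disjoint_left]
    intro y hy hy'
    rw [Multiset.mem_toFinset] at hy hy'
    have hdf := (hX f (hX₀ f hf)).1
    have hdg := (hX g (hX₀ g hg)).1
    rw [hdf.mem_roots_iff] at hy
    rw [hdg.mem_roots_iff] at hy'
    exact hne ((hdf.isEisensteinPoly.minpoly_eq hw h0 hϖ hy).symm.trans
      (hdg.isEisensteinPoly.minpoly_eq hw h0 hϖ hy'))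
  -- By Krasner's lemma the roots in U generating E represent the normalized uniformizers of E
  -- modulo the ball of radius ρ^(pN - d).
  have hfiber (E) (hE : E ∈ S) :
      (U.filter fun y => IntermediateField.adjoin F {y} = E).card =
        Nat.card 𝓀[F] ^ (p * N - d - 2) := by
    obtain ⟨π, hπ⟩ := hS E hE
    refine hπ.card_eq_of_transversal hw h0 hϖ hρ ?_ ?_ ?_
    · intro t ht
      obtain ⟨htU, rfl⟩ := Finset.mem_filter.1 ht
      obtain ⟨f, hf, hft⟩ := (hmemU t).1 htU
      obtain ⟨hdf, hnear⟩ := hX f (hX₀ f hf)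
      refine ⟨IntermediateField.mem_adjoin_simple_self F t, Near.trans ?_ hnear⟩
      unfold Near
      rw [hnear.map_eq]
      exact hdf.isEisensteinPoly.pow_near hw h0 hϖ hft
    · intro x hx hnear
      obtain ⟨y, hy, hxy, h1⟩ := hclose E hE x hx hnear
      refine ⟨y, Finset.mem_filter.2 ⟨hy, h1⟩, ?_⟩
      rwa [show 2 + (p * N - d - 2) = p * N - d by omega]
    · intro s hs t ht hst
      rw [show 2 + (p * N - d - 2) = p * N - d by omega] at hst
      obtain ⟨f, hf, hfs⟩ := (hmemU s).1 (Finset.mem_filter.1 hs).1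
      obtain ⟨g, hg, hgt⟩ := (hmemU t).1 (Finset.mem_filter.1 ht).1
      have hdf := (hX f (hX₀ f hf)).1
      have hdg := (hX g (hX₀ g hg)).1
      -- Close roots come from congruent polynomials, and congruent representatives coincide; then
      -- two roots of the same polynomial closer than ρ^d are equal.
      have hgf := hirr g hg f hf
        (hdg.coeffClose_of_close hw h0 hϖ hρ hN hdf.isEisensteinPoly hfs hgt hst)
      subst hgf
      exact hdg.eq_of_sub_lt hw h0 hϖ hfs hgt
        (hst.trans_lt (pow_lt_pow_right_of_lt_one₀ hρ0 hρ1 (by omega)))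
  rw [← hcardU, Finset.card_eq_sum_card_image (fun y => IntermediateField.adjoin F {y}) U,
    Finset.sum_congr rfl fun E hE => hfiber E (by rw [hSU]; exact hE), Finset.sum_const,
    smul_eq_mul, hSU, Set.ncard_coe_finset]

end Counting

/-! ### The dominant term of the derivative. -/

section Types

variable {F : Type*} [Field F] [ValuativeRel F] [TopologicalSpace F]
  [IsNonarchimedeanLocalField F] {Ω : Type*} [Field Ω] [Algebra F Ω]
  {w : Valuation Ω ℝ≥0} {p : ℕ} [CharP 𝓀[F] p] [Fact p.Prime] {ϖ : F}
  [IsAlgClosure F Ω] {ρ : ℝ≥0} {m j : ℕ} {f : F[X]} {π : Ω}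

/-- `f` is an Eisenstein polynomial such that among the terms of its derivative at a root, the one
of index `j` is the largest, with a coefficient of valuation `m`. -/
structure HasType (w : Valuation Ω ℝ≥0) (p : ℕ) (ϖ : F) (m j : ℕ) (f : F[X]) : Prop where
  isEisensteinPoly : IsEisensteinPoly w p ϖ f
  one_le : 1 ≤ j
  le_prime : j ≤ p
  map_coeff_eq : w (j * algebraMap F Ω (f.coeff j)) = w (algebraMap F Ω ϖ) ^ m
  map_coeff_le_of_lt (l : ℕ) : 1 ≤ l → l < j →
    w (algebraMap F Ω (f.coeff l)) ≤ w (algebraMap F Ω ϖ) ^ (m + 1)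
  map_coeff_le_of_gt (l : ℕ) : j < l → l < p →
    w (algebraMap F Ω (f.coeff l)) ≤ w (algebraMap F Ω ϖ) ^ m
  map_prime_le : w (p : Ω) ≤ w (algebraMap F Ω ϖ) ^ m

/-- The term of index j has size ρ^(pm + j) with ρ = |π|. A lower index loses fewer than p powers of
ρ in π^l but gains p from the coefficient; a higher index gains from π^l. All other terms are
strictly smaller. -/
theorem HasType.leadsAt (hw : IsExtendedValuation F w) (h0 : ϖ ≠ 0) (hϖ : val F ϖ = 1)
    (hf : HasType w p ϖ m j f) : LeadsAt w j f := by
  have hp : p.Prime := Fact.out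
  intro π h
  have hpow := hf.isEisensteinPoly.root hw h0 hϖ h
  set ρ := w π with hρ
  have hρ0 : 0 < ρ := radius_pos h0 hpow
  have hρ1 : ρ < 1 := radius_lt_one hw h0 hϖ hpow
  have hj1 := hf.one_le
  have hjp := hf.le_prime
  have hlead : w (j * (algebraMap F Ω (f.coeff j) * π ^ j)) = ρ ^ (p * m + j) := by
    rw [← mul_assoc, map_mul, hf.map_coeff_eq, map_pow, ← hpow, pow_add, pow_mul]
  have hterm (l : ℕ) (k : ℕ) (h1 : w (algebraMap F Ω (f.coeff l)) ≤ w (algebraMap F Ω ϖ) ^ k)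
      (h2 : p * m + j < p * k + l) :
      w (l * (algebraMap F Ω (f.coeff l) * π ^ l)) < ρ ^ (p * m + j) := by
    refine lt_of_le_of_lt ?_ (pow_lt_pow_right_of_lt_one₀ hρ0 hρ1 h2)
    rw [map_mul, map_mul, map_pow, pow_add, pow_mul, hpow]
    exact (mul_le_of_le_one_left' (IsExtendedValuation.natCast_le_one w l)).trans
      (mul_le_mul_left h1 _)
  unfold Near
  rw [hlead, hf.isEisensteinPoly.derivative_mul_eq,
    Finset.sum_eq_add_sum_sdiff_singleton_of_mem (show j ∈ Finset.range (p + 1) by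
      rw [Finset.mem_range]; omega), add_sub_cancel_left]
  refine w.map_sum_lt (by positivity) fun l hl => ?_
  rw [Finset.mem_sdiff, Finset.mem_range, Finset.mem_singleton] at hl
  obtain ⟨hlp, hlj⟩ := hl
  rcases Nat.eq_zero_or_pos l with rfl | hl0
  · simp only [Nat.cast_zero, zero_mul, map_zero]; positivity
  rcases lt_or_gt_of_ne hlj with hlt | hgt
  · refine hterm l (m + 1) (hf.map_coeff_le_of_lt l hl0 hlt) ?_
    rw [mul_add, mul_one]
    omega
  · rcases Nat.lt_or_ge l p with hlp' | hlp'
    · exact hterm l m (hf.map_coeff_le_of_gt l hgt hlp') (by omega)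
    · obtain rfl : l = p := by omega
      refine lt_of_le_of_lt ?_
        (pow_lt_pow_right_of_lt_one₀ hρ0 hρ1 (show l * m + j < l * m + l by omega))
      rw [hf.isEisensteinPoly.coeff_self, map_one, one_mul, map_mul, map_pow, pow_add, pow_mul,
        hpow]
      exact mul_le_mul_left hf.map_prime_le _

theorem HasType.hasDifferent (hw : IsExtendedValuation F w) (h0 : ϖ ≠ 0) (hϖ : val F ϖ = 1)
    (hρ : ρ ^ p = w (algebraMap F Ω ϖ)) (hf : HasType w p ϖ m j f) :
    HasDifferent w p ϖ ρ (p * m + j - 1) f := by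
  refine ⟨hf.isEisensteinPoly, fun y hy => ?_⟩
  have hwy := hf.isEisensteinPoly.map_root hw h0 hϖ hρ hy
  have hρ0 := radius_pos h0 hρ
  have hj1 := hf.one_le
  have h1 := (hf.leadsAt hw h0 hϖ y hy).map_eq
  rw [← mul_assoc, map_mul, map_mul, hf.map_coeff_eq, map_pow, hwy, ← hρ, ← pow_mul, ← pow_add,
    show p * m + j = (p * m + j - 1) + 1 by omega, pow_succ] at h1
  exact mul_right_cancel₀ hρ0.ne' h1

/-- Let k be the index of the dominant term in the expansion of f'(π). Then j = k + 1, and i + 1 is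
the valuation of the corresponding coefficient of f'. Comparing the exponents p v + l yields the
remaining bounds, stronger below j than above. -/
theorem IsEisensteinPoly.exists_hasType (hw : IsExtendedValuation F w) (h0 : ϖ ≠ 0)
    (hϖ : val F ϖ = 1) (hf : IsEisensteinPoly w p ϖ f) (hsep : f.derivative ≠ 0)
    (h : aeval π f = 0) : ∃ i j, HasType w p ϖ (i + 1) j f := by
  have hp : p.Prime := Fact.out
  have hpow := hf.root hw h0 hϖ h
  have hwϖ0 : 0 < w (algebraMap F Ω ϖ) := by rw [zero_lt_iff]; simpa using h0
  have hwϖ1 := hw.uniformizer_lt_one h0 hϖ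
  set ρ := w π with hρ
  have hρ0 : 0 < ρ := radius_pos h0 hpow
  have hρ1 : ρ < 1 := radius_lt_one hw h0 hϖ hpow
  obtain ⟨k, hkp, hk0, hk, -, hlt⟩ := hw.exists_dominant h0 hϖ hpow hf.natDegree_derivative_lt hsep
  have hval {x : F} (hx : x ≠ 0) (l : ℕ) :
      w (algebraMap F Ω x * π ^ l) = ρ ^ (p * val F x + l) := by
    rw [map_mul, map_pow, hw.eq_zpow h0 hϖ hx, ← hpow, zpow_add₀ hρ0.ne', zpow_mul,
      zpow_natCast, zpow_natCast]
  have hcoeff (l : ℕ) : f.derivative.coeff l = f.coeff (l + 1) * ((l + 1 : ℕ) : F) := by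
    rw [coeff_derivative]; push_cast; rfl
  set v := val F (f.derivative.coeff k) with hv
  -- All coefficients of f', including p itself, are divisible by ϖ; so v ≥ 1 and v may be written i
  -- + 1.
  have hle1 (l : ℕ) (hl : l < p) :
      w (algebraMap F Ω (f.coeff (l + 1) * ((l + 1 : ℕ) : F))) ≤ w (algebraMap F Ω ϖ) := by
    rcases Nat.lt_or_ge (l + 1) p with h1 | h1
    · rw [map_mul, map_mul, map_natCast]
      exact (mul_le_of_le_one_right' (IsExtendedValuation.natCast_le_one w _)).trans
        (hf.coeff_le _ h1)
    · obtain rfl : l + 1 = p := by omega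
      rw [hf.coeff_self, one_mul]
      by_cases hp0 : ((l + 1 : ℕ) : F) = 0
      · rw [hp0]; simp
      have h2 := hw.prime_lt_one (p := l + 1)
      rw [← map_natCast (algebraMap F Ω), hw.eq_zpow h0 hϖ hp0] at h2
      rw [hw.eq_zpow h0 hϖ hp0]
      have h3 : 1 ≤ val F ((l + 1 : ℕ) : F) := by
        by_contra! h4
        exact absurd h2 (not_lt.2 (one_le_zpow_of_nonpos₀ hwϖ0 hwϖ1.le (by omega)))
      calc _ ≤ w (algebraMap F Ω ϖ) ^ (1 : ℤ) := zpow_le_zpow_right_of_le_one₀ hwϖ0 hwϖ1.le h3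
        _ = _ := zpow_one _
  have hv1 : 1 ≤ v := by
    have h1 := hle1 k hkp
    rw [← hcoeff, hw.eq_zpow h0 hϖ hk0] at h1
    by_contra! h2
    exact absurd (h1.trans_lt hwϖ1) (not_lt.2 (one_le_zpow_of_nonpos₀ hwϖ0 hwϖ1.le (by omega)))
  obtain ⟨i, hi⟩ : ∃ i : ℕ, v = i + 1 := ⟨(v - 1).toNat, by omega⟩
  have hbound (l : ℕ) (hlk : l ≠ k) (n : ℕ) (hn : p * ((n : ℤ) - 1) + l ≤ p * v + k) :
      w (algebraMap F Ω (f.derivative.coeff l)) ≤ w (algebraMap F Ω ϖ) ^ n := by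
    by_cases hc : f.derivative.coeff l = 0
    · simp [hc]
    have h1 := hlt l hlk hc
    rw [hk, hval hc, hval hk0, ← hv, zpow_lt_zpow_iff_right_of_lt_one₀ hρ0 hρ1] at h1
    rw [hw.eq_zpow h0 hϖ hc, ← zpow_natCast, zpow_le_zpow_iff_right_of_lt_one₀ hwϖ0 hwϖ1]
    by_contra! h2
    have : (p : ℤ) * val F (f.derivative.coeff l) ≤ p * (n - 1) :=
      mul_le_mul_of_nonneg_left (by omega) (by positivity)
    omega
  have hunit (l : ℕ) (hl : l + 1 < p) : w (algebraMap F Ω (f.derivative.coeff l)) =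
      w (algebraMap F Ω (f.coeff (l + 1))) := by
    rw [hcoeff, map_mul, map_mul, map_natCast, hw.natCast_eq_one (p := p), mul_one]
    exact fun h1 => absurd (Nat.le_of_dvd (by omega) h1) (by omega)
  refine ⟨i, k + 1, hf, by omega, by omega, ?_, ?_, ?_, ?_⟩
  · rw [mul_comm, ← map_natCast (algebraMap F Ω), ← map_mul, ← hcoeff, hw.eq_zpow h0 hϖ hk0, ← hv,
      hi]
    exact_mod_cast rfl
  · intro l hl1 hlk
    obtain ⟨l, rfl⟩ : ∃ l', l = l' + 1 := ⟨l - 1, by omega⟩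
    rw [← hunit l (by omega)]
    refine hbound l (by omega) _ ?_
    rw [hi]; push_cast
    have : (l : ℤ) < k := by exact_mod_cast (by omega : l < k)
    linarith
  · intro l hkl hlp
    obtain ⟨l, rfl⟩ : ∃ l', l = l' + 1 := ⟨l - 1, by omega⟩
    rw [← hunit l (by omega)]
    refine hbound l (by omega) _ ?_
    rw [hi]; push_cast
    have : (l : ℤ) < p := by exact_mod_cast (by omega : l < p)
    linarith
  · obtain ⟨n, rfl⟩ : ∃ n, p = n + 1 := ⟨p - 1, by have := hp.two_le; omega⟩
    have h1 : ((n + 1 : ℕ) : Ω) = algebraMap F Ω (f.derivative.coeff n) := by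
      rw [hcoeff, hf.coeff_self, one_mul, map_natCast]
    rw [h1]
    by_cases hnk : n = k
    · rw [hnk, hw.eq_zpow h0 hϖ hk0, ← hv, hi]
      exact_mod_cast le_rfl
    · refine hbound n hnk _ ?_
      rw [hi]; push_cast
      linarith

/-- The exponent of the different is d = p(i + 1) + j - 1, and c(E) = d - (p - 1). -/
theorem HasType.serreC_eq (hw : IsExtendedValuation F w) (h0 : ϖ ≠ 0) (hϖ : val F ϖ = 1)
    {E : IntermediateField F Ω} [Algebra.IsSeparable F E] (h : IsRamifiedWith w p ϖ E π) {i : ℕ}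
    (hf : HasType w p ϖ (i + 1) j (minpoly F π)) : serreC E = i * p + j := by
  have h1 := (hf.hasDifferent hw h0 hϖ h.pow_eq).map_derivative π (minpoly.aeval F π)
  rw [h.serreC_eq hw h0 hϖ h1]
  have := hf.one_le
  rw [Nat.cast_sub (by nlinarith)]
  push_cast
  ring

theorem HasType.separable (hw : IsExtendedValuation F w) (h0 : ϖ ≠ 0) (hϖ : val F ϖ = 1)
    (hf : HasType w p ϖ m j f) (h : aeval π f = 0) :
    Algebra.IsSeparable F (IntermediateField.adjoin F {π}) := by
  have : Algebra.IsAlgebraic F Ω := IsAlgClosure.isAlgebraic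
  rw [IntermediateField.isSeparable_adjoin_simple_iff_isSeparable]
  unfold IsSeparable
  rw [hf.isEisensteinPoly.minpoly_eq hw h0 hϖ h]
  exact hf.isEisensteinPoly.separable hw h0 hϖ (hf.leadsAt hw h0 hϖ) h

theorem IsRamifiedWith.exists_hasType (hw : IsExtendedValuation F w) (h0 : ϖ ≠ 0)
    (hϖ : val F ϖ = 1) {E : IntermediateField F Ω} [Algebra.IsSeparable F E]
    (h : IsRamifiedWith w p ϖ E π) : ∃ i j, HasType w p ϖ (i + 1) j (minpoly F π) := by
  have : Algebra.IsAlgebraic F Ω := IsAlgClosure.isAlgebraic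
  refine (h.isEisensteinPoly hw h0 hϖ).exists_hasType hw h0 hϖ ?_ (minpoly.aeval F π)
  have hsep : (minpoly F π).Separable := by
    have := Algebra.IsSeparable.isSeparable F (⟨π, h.mem⟩ : E)
    unfold IsSeparable at this
    rwa [← minpoly.algebraMap_eq (A := F) (algebraMap E Ω).injective] at this
  exact (separable_iff_derivative_ne_zero
    (minpoly.irreducible (Algebra.IsIntegral.isIntegral π))).1 hsep

end Types

/-! ### Reading the character off the coefficients. -/

section TypesAndCharacters

variable {F : Type*} [Field F] [ValuativeRel F] [TopologicalSpace F]
  [IsNonarchimedeanLocalField F] {Ω : Type*} [Field Ω] [Algebra F Ω]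
  {w : Valuation Ω ℝ≥0} {p : ℕ} [CharP 𝓀[F] p] [Fact p.Prime] {ϖ : F}
  [IsAlgClosure F Ω] {ρ : ℝ≥0} {m i j : ℕ} {f : F[X]} {π : Ω}

variable (F p) in
theorem charZero_or_charP : CharZero F ∨ CharP F p := by
  have hp : p.Prime := Fact.out
  obtain ⟨r, hr⟩ := CharP.exists F
  rcases CharP.char_is_prime_or_zero F r with hr' | rfl
  · right
    have h1 : ((r : 𝒪[F]) : F) = 0 := by simp
    have h2 : (r : 𝒪[F]) = 0 := Subtype.ext h1
    have h3 : (r : 𝓀[F]) = 0 := by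
      rw [← map_natCast (IsLocalRing.residue 𝒪[F]), h2, map_zero]
    rw [CharP.cast_eq_zero_iff 𝓀[F] p, Nat.prime_dvd_prime_iff_eq hp hr'] at h3
    rwa [h3]
  · left
    exact CharP.charP_to_charZero F

/-- The linear part ψ of the action on the roots is dual to the leading class b, and χ = ωψ⁻¹ means
ψ = ωχ⁻¹. -/
theorem HasType.hasCharacter_iff (hw : IsExtendedValuation F w) (h0 : ϖ ≠ 0) (hϖ : val F ϖ = 1)
    (hf : HasType w p ϖ m j f) (h : aeval π f = 0) {b : Fˣ} (hb : (b : F) = leadingClass j f)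
    (χ : Character F Ω p) : HasCharacter (IntermediateField.adjoin F {π}) χ ↔
      KummerDual (cyclotomicChar F Ω p * χ⁻¹) b := by
  obtain ⟨ψ, hψ⟩ := exists_kummerDual (p := p) Ω b
  obtain ⟨c, hc, hc0⟩ := hf.isEisensteinPoly.exists_affineSystem hw h0 hϖ hf.one_le
    (hf.leadsAt hw h0 hϖ) h hb hψ
  rw [hc.hasCharacter_iff (by rw [hc0]) (charZero_or_charP F p)]
  constructor
  · rintro rfl
    convert hψ using 1
    ext σ
    simp
  · intro h1
    rw [← kummerDual_unique h1 hψ]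
    ext σ
    simp

theorem existsUnique_hasCharacter {E : IntermediateField F Ω}
    (hE : E ∈ ramifiedExtensions F Ω p) : ∃! χ : Character F Ω p, HasCharacter E χ := by
  have : Algebra.IsAlgebraic F Ω := IsAlgClosure.isAlgebraic
  obtain ⟨w, hw⟩ := exists_isExtendedValuation F Ω
  obtain ⟨ϖ, h0, hϖ⟩ := exists_val_eq_one F
  obtain ⟨hsep, π, hπ⟩ := (mem_ramifiedExtensions_iff hw h0 hϖ).1 hE
  obtain ⟨i, j, ht⟩ := hπ.exists_hasType hw h0 hϖ
  have hroot := minpoly.aeval F π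
  have hne := leadingClass_ne_zero h0 ht.isEisensteinPoly (ht.leadsAt hw h0 hϖ) hroot
  obtain ⟨ψ, hψ⟩ := exists_kummerDual (p := p) Ω (Units.mk0 _ hne)
  have hiff := ht.hasCharacter_iff hw h0 hϖ hroot (Units.val_mk0 hne)
  rw [hπ.adjoin_eq hw h0 hϖ] at hiff
  refine ⟨cyclotomicChar F Ω p * ψ⁻¹, ?_, ?_⟩
  · change HasCharacter E _
    rw [hiff]
    convert hψ using 1
    ext σ
    simp
  · intro χ hχ
    rw [← kummerDual_unique ((hiff χ).1 hχ) hψ]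
    ext σ
    simp

/-- The condition on the coefficient `a` of index `l` of an Eisenstein polynomial with constant
coefficient close to `-ϖ`, for it to be of type `(m, j)` and to have a leading class dual
to `θ`. -/
structure CoeffCond (w : Valuation Ω ℝ≥0) (ϖ : F) (θ : Character F Ω p) (m j l : ℕ) (a : F) :
    Prop where
  near : l = 0 → Near w (algebraMap F Ω (-a)) (algebraMap F Ω ϖ)
  le_of_lt : 1 ≤ l → l < j → w (algebraMap F Ω a) ≤ w (algebraMap F Ω ϖ) ^ (m + 1)
  eq_of_eq : l = j → w (algebraMap F Ω a) = w (algebraMap F Ω ϖ) ^ m ∧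
    ∀ b : Fˣ, (b : F) = -(j * a) * ϖ ^ (j - 1) → KummerDual θ b
  le_of_gt : j < l → w (algebraMap F Ω a) ≤ w (algebraMap F Ω ϖ) ^ m

/-- The monic polynomials of degree `p` with coefficients restricted by `CoeffCond`. -/
def typedPolys (w : Valuation Ω ℝ≥0) (ϖ : F) (θ : Character F Ω p) (m j : ℕ) : Set F[X] :=
  {f | f.Monic ∧ f.natDegree = p ∧ ∀ l < p, CoeffCond w ϖ θ m j l (f.coeff l)}

theorem map_natCast_mul_of_lt (hw : IsExtendedValuation F w) (hj : 1 ≤ j) (hjp : j < p) (x : Ω) :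
    w (j * x) = w x := by
  rw [map_mul, hw.natCast_eq_one (p := p), one_mul]
  exact fun h1 => absurd (Nat.le_of_dvd (by omega) h1) (by omega)

/-- The classes dual to `θ` of the two forms of the leading coefficient agree. -/
theorem kummerDual_leadingClass_iff (hw : IsExtendedValuation F w) {θ : Character F Ω p}
    (hnear : Near w (algebraMap F Ω (-f.coeff 0)) (algebraMap F Ω ϖ)) {b b' : Fˣ}
    (hb : (b : F) = leadingClass j f) (hb' : (b' : F) = -(j * f.coeff j) * ϖ ^ (j - 1)) :
    KummerDual θ b ↔ KummerDual θ b' := by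
  have h1 : -((j : F) * f.coeff j) ≠ 0 := by
    have := b'.ne_zero
    rw [hb'] at this
    exact left_ne_zero_of_mul this
  have h2 : Near w (algebraMap F Ω b) (algebraMap F Ω b') := by
    rw [hb, hb']
    unfold leadingClass
    rw [map_mul, map_mul, map_pow, map_pow]
    exact (Near.refl (by rwa [Ne, map_eq_zero])).mul (hnear.pow (j - 1))
  exact ⟨fun h => hw.kummerDual_of_near h h2.symm, fun h => hw.kummerDual_of_near h h2⟩

/-- For j = p the dominant coefficient is p times the leading coefficient 1. No condition on a lower
coefficient expresses it, so it is imposed on |p| by `heq`. -/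
theorem hasType_of_mem_typedPolys (hw : IsExtendedValuation F w) (h0 : ϖ ≠ 0) (hϖ : val F ϖ = 1)
    {θ : Character F Ω p} (hm : 1 ≤ m) (hj : 1 ≤ j) (hjp : j ≤ p)
    (hle : w (p : Ω) ≤ w (algebraMap F Ω ϖ) ^ m)
    (heq : j = p → w (p : Ω) = w (algebraMap F Ω ϖ) ^ m) (hf : f ∈ typedPolys w ϖ θ m j) :
    HasType w p ϖ m j f ∧ Near w (algebraMap F Ω (-f.coeff 0)) (algebraMap F Ω ϖ) := by
  have hp : p.Prime := Fact.out
  obtain ⟨hmonic, hdeg, hc⟩ := hf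
  have hwϖ1 := hw.uniformizer_lt_one h0 hϖ
  have hnear := (hc 0 hp.pos).near rfl
  have hpow : w (algebraMap F Ω ϖ) ^ m ≤ w (algebraMap F Ω ϖ) := by
    calc _ ≤ w (algebraMap F Ω ϖ) ^ 1 := pow_le_pow_right_of_le_one' hwϖ1.le hm
      _ = _ := pow_one _
  have hzero : w (algebraMap F Ω (f.coeff 0)) = w (algebraMap F Ω ϖ) := by
    have := hnear.map_eq
    rwa [map_neg, w.map_neg] at this
  refine ⟨⟨⟨hmonic, hdeg, fun l hl => ?_, hzero⟩, hj, hjp, ?_, fun l h1 h2 => ?_, fun l h1 h2 => ?_,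
    hle⟩, hnear⟩
  · rcases Nat.eq_zero_or_pos l with rfl | hl0
    · exact hzero.le
    refine le_trans ?_ hpow
    rcases lt_trichotomy l j with h1 | h1 | h1
    · exact ((hc l hl).le_of_lt hl0 h1).trans (pow_le_pow_right_of_le_one' hwϖ1.le (by omega))
    · exact ((hc l hl).eq_of_eq h1).1.le
    · exact (hc l hl).le_of_gt h1
  · rcases hjp.lt_or_eq with h1 | h1
    · rw [map_natCast_mul_of_lt hw hj h1]
      exact ((hc j h1).eq_of_eq rfl).1
    · have : f.coeff j = 1 := by rw [h1, ← hdeg]; exact hmonic.coeff_natDegree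
      rw [this, map_one, mul_one, ← heq h1, h1]
  · exact (hc l (by omega)).le_of_lt h1 h2
  · exact (hc l h2).le_of_gt h1

theorem HasType.mem_typedPolys (hw : IsExtendedValuation F w)
    {θ : Character F Ω p} (hf : HasType w p ϖ m j f)
    (hnear : Near w (algebraMap F Ω (-f.coeff 0)) (algebraMap F Ω ϖ))
    (hdual : ∀ b : Fˣ, (b : F) = -(j * f.coeff j) * ϖ ^ (j - 1) → KummerDual θ b) :
    f ∈ typedPolys w ϖ θ m j := by
  refine ⟨hf.isEisensteinPoly.monic, hf.isEisensteinPoly.natDegree_eq, fun l hl => ⟨?_, ?_, ?_, ?_⟩⟩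
  · rintro rfl
    exact hnear
  · exact fun h1 h2 => hf.map_coeff_le_of_lt l h1 h2
  · rintro rfl
    refine ⟨?_, hdual⟩
    rw [← hf.map_coeff_eq, map_natCast_mul_of_lt hw hf.one_le hl]
  · exact fun h1 => hf.map_coeff_le_of_gt l h1 hl

/-- The extensions with character `χ` and invariant `c = ip + j`. -/
def extensionsOfType (F Ω : Type*) [Field F] [ValuativeRel F] [Field Ω] [Algebra F Ω] {p : ℕ}
    [Fact p.Prime] (χ : Character F Ω p) (i j : ℕ) : Set (IntermediateField F Ω) :=
  {E | (E ∈ ramifiedExtensions F Ω p ∧ HasCharacter E χ) ∧ serreC E = i * p + j}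

theorem type_unique {i j i' j' : ℕ} (hj : 1 ≤ j) (hjp : j ≤ p) (hj' : 1 ≤ j') (hjp' : j' ≤ p)
    (h : (i * p + j : ℤ) = i' * p + j') : i = i' ∧ j = j' := by
  have h1 : i * p + j = i' * p + j' := by exact_mod_cast h
  have hii : i = i' := by
    rcases lt_trichotomy i i' with h2 | h2 | h2
    · have : (i + 1) * p ≤ i' * p := Nat.mul_le_mul_right p h2
      rw [add_mul, one_mul] at this
      omega
    · exact h2
    · have : (i' + 1) * p ≤ i * p := Nat.mul_le_mul_right p h2
      rw [add_mul, one_mul] at this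
      omega
  subst hii
  exact ⟨rfl, by omega⟩

/-- With d = p(i + 1) + j - 1 ≤ p(i + 2) - 1, the modulus N = 2i + 4 satisfies 2d < pN as Krasner's
lemma requires, and pN - d - 2 = p(i + 3) - j - 1. -/
theorem ncard_extensionsOfType_mul (hw : IsExtendedValuation F w) (h0 : ϖ ≠ 0)
    (hϖ : val F ϖ = 1) (hρ : ρ ^ p = w (algebraMap F Ω ϖ)) {χ : Character F Ω p} (hj : 1 ≤ j)
    (hjp : j ≤ p) (hle : w (p : Ω) ≤ w (algebraMap F Ω ϖ) ^ (i + 1))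
    (heq : j = p → w (p : Ω) = w (algebraMap F Ω ϖ) ^ (i + 1))
    (hdual : j = p → ∀ b : Fˣ, (b : F) = -(p * 1) * ϖ ^ (p - 1) →
      KummerDual (cyclotomicChar F Ω p * χ⁻¹) b) {X₀ : Finset F[X]}
    (hX₀ : ∀ f ∈ X₀, f ∈ typedPolys w ϖ (cyclotomicChar F Ω p * χ⁻¹) (i + 1) j)
    (hrep : ∀ g ∈ typedPolys w ϖ (cyclotomicChar F Ω p * χ⁻¹) (i + 1) j,
      ∃ f ∈ X₀, CoeffClose w p ϖ (2 * i + 4) f g)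
    (hirr : ∀ f ∈ X₀, ∀ g ∈ X₀, CoeffClose w p ϖ (2 * i + 4) f g → f = g) :
    (extensionsOfType F Ω χ i j).Finite ∧
      (extensionsOfType F Ω χ i j).ncard * Nat.card 𝓀[F] ^ (p * (i + 3) - j - 1) =
        p * X₀.card := by
  have hp : p.Prime := Fact.out
  have : Algebra.IsAlgebraic F Ω := IsAlgClosure.isAlgebraic
  have hp2 := hp.two_le
  have htype {f : F[X]} (hf : f ∈ typedPolys w ϖ (cyclotomicChar F Ω p * χ⁻¹) (i + 1) j) :=
    hasType_of_mem_typedPolys hw h0 hϖ (by omega) hj hjp hle heq hf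
  have e1 : p * (i + 1) = p * i + p := by ring
  have e2 : p * (2 * i + 4) = 2 * (p * i) + 4 * p := by ring
  have e3 : p * (i + 3) = p * i + 3 * p := by ring
  have hexp : p * (2 * i + 4) - (p * (i + 1) + j - 1) - 2 = p * (i + 3) - j - 1 := by
    rw [e1, e2, e3]; omega
  have key := finite_and_ncard_mul_eq (d := p * (i + 1) + j - 1) (N := 2 * i + 4)
    (S := extensionsOfType F Ω χ i j)
    (X := typedPolys w ϖ (cyclotomicChar F Ω p * χ⁻¹) (i + 1) j) (X₀ := X₀) hw h0 hϖ hρ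
    (by rw [e1, e2]; omega) (by rw [e1, e2]; omega) ?_ hX₀ hrep hirr ?_ ?_ ?_
  · rwa [hexp] at key
  · exact fun f hf => ⟨(htype hf).1.hasDifferent hw h0 hϖ hρ, (htype hf).2⟩
  · rintro E ⟨⟨hE, -⟩, -⟩
    exact ((mem_ramifiedExtensions_iff hw h0 hϖ).1 hE).2
  -- The value c(E) = ip + j determines the type of the minimal polynomial of x, and the character
  -- of E then fixes the class of its leading coefficient.
  · rintro E ⟨⟨hE, hχ⟩, hc⟩ x hx hnear
    obtain ⟨hsep, π, hπ⟩ := (mem_ramifiedExtensions_iff hw h0 hϖ).1 hE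
    have hEx : IsRamifiedWith w p ϖ E x := .of_near hπ.finrank_eq hx hnear
    obtain ⟨i', j', ht⟩ := hEx.exists_hasType hw h0 hϖ
    have hc' := ht.serreC_eq hw h0 hϖ hEx
    obtain ⟨rfl, rfl⟩ := type_unique ht.one_le ht.le_prime hj hjp (hc'.symm.trans hc)
    have hroot := minpoly.aeval F x
    have hnear0 : Near w (algebraMap F Ω (-(minpoly F x).coeff 0)) (algebraMap F Ω ϖ) := by
      refine Near.trans (Near.symm ?_) hnear
      unfold Near
      rw [map_neg, w.map_neg, ht.isEisensteinPoly.coeff_zero, ← map_neg]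
      exact ht.isEisensteinPoly.pow_near hw h0 hϖ hroot
    have hne := leadingClass_ne_zero h0 ht.isEisensteinPoly (ht.leadsAt hw h0 hϖ) hroot
    refine ht.mem_typedPolys hw hnear0 fun b hb => ?_
    rw [← kummerDual_leadingClass_iff hw hnear0 (Units.val_mk0 hne) hb,
      ← ht.hasCharacter_iff hw h0 hϖ hroot (Units.val_mk0 hne), hEx.adjoin_eq hw h0 hϖ]
    exact hχ
  · intro f hf x hx
    obtain ⟨ht, hnear⟩ := htype hf
    have hram := ht.isEisensteinPoly.isRamifiedWith hw h0 hϖ hx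
    have hsep := ht.separable hw h0 hϖ hx
    have hmin := ht.isEisensteinPoly.minpoly_eq hw h0 hϖ hx
    have hne := leadingClass_ne_zero h0 ht.isEisensteinPoly (ht.leadsAt hw h0 hϖ) hx
    have hne' : -((j : F) * f.coeff j) * ϖ ^ (j - 1) ≠ 0 := by
      unfold leadingClass at hne
      exact mul_ne_zero (left_ne_zero_of_mul hne) (pow_ne_zero _ h0)
    refine ⟨⟨(mem_ramifiedExtensions_iff hw h0 hϖ).2 ⟨hsep, x, hram⟩, ?_⟩, ?_⟩
    · rw [ht.hasCharacter_iff hw h0 hϖ hx (Units.val_mk0 hne),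
        kummerDual_leadingClass_iff hw hnear (Units.val_mk0 hne) (Units.val_mk0 hne')]
      rcases hjp.lt_or_eq with h1 | h1
      · exact ((hf.2.2 j h1).eq_of_eq rfl).2 _ (Units.val_mk0 hne')
      -- `CoeffCond` is imposed only for indices below p, so for j = p duality is not recorded
      -- there.
      · refine hdual h1 _ ?_
        rw [Units.val_mk0, h1, ht.isEisensteinPoly.coeff_self]
    · rw [← hmin] at ht
      exact ht.serreC_eq hw h0 hϖ hram

end TypesAndCharacters

/-- The cosets x h + A are disjoint, so one system of representatives of A modulo B, translated to
each of them, suffices. -/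
theorem exists_isTransversal_iUnion {G ι : Type*} [AddCommGroup G] {A B : AddSubgroup G}
    (hBA : B ≤ A) (hfin : B.relIndex A ≠ 0) (H : Finset ι) (x : ι → G)
    (hx : ∀ h ∈ H, ∀ h' ∈ H, x h - x h' ∈ A → h = h') :
    ∃ T : Finset G, IsTransversal B {y | ∃ h ∈ H, y - x h ∈ A} T ∧
      T.card = H.card * B.relIndex A := by
  classical
  obtain ⟨R, hR⟩ := exists_isTransversal hfin 0
  have hRA (r) (hr : r ∈ R) : r ∈ A := by simpa using hR.subset r hr
  have hinj (a : ι × G) (ha : a ∈ H ×ˢ R) (b : ι × G) (hb : b ∈ H ×ˢ R)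
      (hab : x a.1 + a.2 - (x b.1 + b.2) ∈ B) : a = b := by
    rw [Finset.mem_product] at ha hb
    have h1 : a.1 = b.1 := by
      refine hx _ ha.1 _ hb.1 ?_
      have := A.sub_mem (A.add_mem (hBA hab) (hRA _ hb.2)) (hRA _ ha.2)
      convert this using 1
      abel
    rw [h1, add_sub_add_left_eq_sub] at hab
    exact Prod.ext h1 (hR.eq_of_sub_mem _ ha.2 _ hb.2 hab)
  refine ⟨(H ×ˢ R).image fun a => x a.1 + a.2, ⟨?_, ?_, ?_⟩, ?_⟩
  · intro t ht
    obtain ⟨a, ha, rfl⟩ := Finset.mem_image.1 ht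
    rw [Finset.mem_product] at ha
    exact ⟨a.1, ha.1, by rw [add_sub_cancel_left]; exact hRA _ ha.2⟩
  · rintro y ⟨h, hh, hy⟩
    obtain ⟨r, hr, hyr⟩ := hR.exists_sub_mem (y - x h) (by simpa using hy)
    exact ⟨x h + r, Finset.mem_image.2 ⟨(h, r), Finset.mem_product.2 ⟨hh, hr⟩, rfl⟩,
      by rwa [← sub_sub]⟩
  · intro s hs t ht hst
    obtain ⟨a, ha, rfl⟩ := Finset.mem_image.1 hs
    obtain ⟨b, hb, rfl⟩ := Finset.mem_image.1 ht
    rw [hinj a ha b hb hst]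
  · rw [Finset.card_image_of_injOn, Finset.card_product, hR.card_eq]
    intro a ha b hb hab
    refine hinj a ha b hb ?_
    simp only at hab
    rw [hab, sub_self]
    exact B.zero_mem

/-! ### Counting coefficients modulo powers of ϖ. -/

section Coefficients

variable {F : Type*} [Field F] [ValuativeRel F] [TopologicalSpace F]
  [IsNonarchimedeanLocalField F] {Ω : Type*} [Field Ω] [Algebra F Ω]
  {w : Valuation Ω ℝ≥0} {p : ℕ} [CharP 𝓀[F] p] [Fact p.Prime] {ϖ : F}
  [IsAlgClosure F Ω]

/-- The fractional ideal of `F` generated by `ϖ ^ n`, as an additive group. -/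
noncomputable def coeffBall (w : Valuation Ω ℝ≥0) (ϖ : F) (n : ℕ) : AddSubgroup F :=
  (w.comap (algebraMap F Ω)).leAddSubgroup (w (algebraMap F Ω ϖ) ^ n)

theorem mem_coeffBall {n : ℕ} {x : F} :
    x ∈ coeffBall w ϖ n ↔ w (algebraMap F Ω x) ≤ w (algebraMap F Ω ϖ) ^ n := Iff.rfl

theorem coeffBall_anti (hw : IsExtendedValuation F w) (h0 : ϖ ≠ 0) (hϖ : val F ϖ = 1) {k n : ℕ}
    (hkn : k ≤ n) : coeffBall w ϖ n ≤ coeffBall w ϖ k := by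
  intro x hx
  rw [mem_coeffBall] at hx ⊢
  exact hx.trans (pow_le_pow_right_of_le_one' (hw.uniformizer_lt_one h0 hϖ).le hkn)

theorem IsExtendedValuation.lt_pow_iff (hw : IsExtendedValuation F w) (h0 : ϖ ≠ 0)
    (hϖ : val F ϖ = 1) (x : F) (n : ℕ) : w (algebraMap F Ω x) < w (algebraMap F Ω ϖ) ^ n ↔
      w (algebraMap F Ω x) ≤ w (algebraMap F Ω ϖ) ^ (n + 1) := by
  have hwϖ0 : 0 < w (algebraMap F Ω ϖ) := by rw [zero_lt_iff]; simpa using h0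
  have hwϖ1 := hw.uniformizer_lt_one h0 hϖ
  by_cases hx : x = 0
  · simp only [hx, map_zero, zero_le, iff_true]
    positivity
  · rw [hw.eq_zpow h0 hϖ hx, ← zpow_natCast, ← zpow_natCast,
      zpow_lt_zpow_iff_right_of_lt_one₀ hwϖ0 hwϖ1, zpow_le_zpow_iff_right_of_lt_one₀ hwϖ0 hwϖ1]
    push_cast
    omega

theorem relIndex_coeffBall (hw : IsExtendedValuation F w) (h0 : ϖ ≠ 0) (hϖ : val F ϖ = 1)
    (k n : ℕ) : (coeffBall w ϖ (k + n)).relIndex (coeffBall w ϖ k) = Nat.card 𝓀[F] ^ n := by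
  refine relIndex_leAddSubgroup_add (F := F) (L := F) (v := w.comap (algebraMap F Ω)) (π := ϖ) h0
    (fun a => (hw.algebraMap_le_one_iff a).2 a.2) (fun a => hw.residue_eq_zero_iff a)
    (fun x hx => ⟨⟨x, (hw.algebraMap_le_one_iff x).1 hx⟩, ?_⟩) (hw.uniformizer_lt_one h0 hϖ)
    (fun x hx => ?_) k n
  · simp
  · have := (hw.lt_pow_iff h0 hϖ x 0).1 (by simpa using hx)
    simpa using this

theorem card_residueField_ne_zero : Nat.card 𝓀[F] ≠ 0 := Nat.card_pos.ne'

variable (F p) in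
theorem pred_dvd_card_pred : p - 1 ∣ Nat.card 𝓀[F] - 1 := by
  have : Fintype 𝓀[F] := Fintype.ofFinite _
  obtain ⟨n, -, hn⟩ := FiniteField.card 𝓀[F] p
  rw [Nat.card_eq_fintype_card, hn]
  simpa using Nat.sub_dvd_pow_sub_pow p 1 n

-- The group of units is cyclic of order q - 1, which p - 1 divides, so the (p-1)-th powers have
-- index p - 1. This is the source of (q - 1)/(p - 1) in the mass.
variable (F p) in
theorem card_range_pow : Nat.card (powMonoidHom (p - 1) : 𝓀[F]ˣ →* 𝓀[F]ˣ).range =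
    (Nat.card 𝓀[F] - 1) / (p - 1) := by
  have : Fintype 𝓀[F] := Fintype.ofFinite _
  rw [IsCyclic.card_powMonoidHom_range, Nat.card_units, Nat.gcd_eq_right (pred_dvd_card_pred F p)]

/-- Representatives of the products of `a` with the `(p-1)`-th powers of units. -/
theorem exists_isTransversal_mul_pow (hw : IsExtendedValuation F w) (h0 : ϖ ≠ 0)
    (hϖ : val F ϖ = 1) {a : Fˣ} {m : ℕ} (ha : w (algebraMap F Ω a) = w (algebraMap F Ω ϖ) ^ m)
    (n : ℕ) : ∃ T : Finset F, IsTransversal (coeffBall w ϖ (m + 1 + n))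
      {y | ∃ c : Fˣ, w (algebraMap F Ω c) = 1 ∧ y = a * (c : F) ^ (p - 1)} T ∧
      T.card = (Nat.card 𝓀[F] - 1) / (p - 1) * Nat.card 𝓀[F] ^ n := by
  classical
  have hp : p.Prime := Fact.out
  have hp1 : p - 1 ≠ 0 := by have := hp.two_le; omega
  have hwϖ0 : 0 < w (algebraMap F Ω ϖ) := by rw [zero_lt_iff]; simpa using h0
  let R := (powMonoidHom (p - 1) : 𝓀[F]ˣ →* 𝓀[F]ˣ).range
  have : Fintype R := Fintype.ofFinite R
  have hex (r : R) : ∃ s : 𝒪[F], IsLocalRing.residue 𝒪[F] s ^ (p - 1) = ((r : 𝓀[F]ˣ) : 𝓀[F]) := by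
    obtain ⟨u, hu⟩ := r.2
    obtain ⟨s, hs⟩ := IsLocalRing.residue_surjective (u : 𝓀[F])
    refine ⟨s, ?_⟩
    rw [hs, ← hu]
    simp
  choose s hs using hex
  have hmem (y z : F) : a * y - a * z ∈ coeffBall w ϖ (m + 1) ↔
      w (algebraMap F Ω y - algebraMap F Ω z) < 1 := by
    rw [mem_coeffBall, ← hw.lt_pow_iff h0 hϖ, ← mul_sub, map_mul, map_mul, ha, map_sub,
      mul_lt_iff_lt_one_right (pow_pos hwϖ0 m)]
  obtain ⟨T, hT, hcard⟩ := exists_isTransversal_iUnion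
    (coeffBall_anti hw h0 hϖ (show m + 1 ≤ m + 1 + n by omega))
    (by rw [relIndex_coeffBall hw h0 hϖ]; exact pow_ne_zero _ card_residueField_ne_zero)
    (Finset.univ : Finset R) (fun r => (a : F) * (s r : F) ^ (p - 1)) (by
      intro r _ r' _ h1
      rw [hmem] at h1
      have h2 := (hw.residue_eq_iff (s r ^ (p - 1)) (s r' ^ (p - 1))).2 (by simpa using h1)
      rw [map_pow, map_pow, hs, hs] at h2
      exact Subtype.ext (Units.ext h2))
  refine ⟨T, ?_, ?_⟩
  · convert hT using 1
    ext y
    constructor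
    · rintro ⟨c, hc, rfl⟩
      have hcO : (c : F) ∈ 𝒪[F] := (hw.algebraMap_le_one_iff _).1 hc.le
      have hc0 : IsLocalRing.residue 𝒪[F] ⟨c, hcO⟩ ≠ 0 := by
        rw [Ne, hw.residue_eq_zero_iff, hc]; exact lt_irrefl 1
      refine ⟨⟨Units.mk0 _ hc0 ^ (p - 1), ⟨Units.mk0 _ hc0, rfl⟩⟩, Finset.mem_univ _, ?_⟩
      rw [hmem]
      have h1 := (hw.residue_eq_iff ((⟨c, hcO⟩ : 𝒪[F]) ^ (p - 1))
        (s ⟨Units.mk0 _ hc0 ^ (p - 1), ⟨Units.mk0 _ hc0, rfl⟩⟩ ^ (p - 1))).1 (by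
          rw [map_pow, map_pow, hs]; simp)
      simpa using h1
    · rintro ⟨r, -, hr⟩
      have hy : y = a * (y / a) := by field_simp
      rw [hy, hmem] at hr
      have hsO : w (algebraMap F Ω ((s r : F) ^ (p - 1))) ≤ 1 :=
        (hw.algebraMap_le_one_iff _).2 (pow_mem (s r).2 _)
      have hyO : y / a ∈ 𝒪[F] := by
        rw [← hw.algebraMap_le_one_iff (w := w)]
        have := w.map_add_le hr.le hsO
        rwa [sub_add_cancel] at this
      have h1 : IsLocalRing.residue 𝒪[F] ⟨y / a, hyO⟩ = ((r : 𝓀[F]ˣ) : 𝓀[F]) := by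
        rw [← hs r, ← map_pow, hw.residue_eq_iff]
        simpa using hr
      have hu : IsUnit (⟨y / a, hyO⟩ : 𝒪[F]) := by
        rw [← IsLocalRing.residue_ne_zero_iff_isUnit, h1]
        exact Units.ne_zero _
      obtain ⟨z, hz, -⟩ := exists_pow_eq_of_residue (p := p) hu (a := s r) (by rw [hs, h1])
      have hz' : (z : F) ^ (p - 1) = y / a := by
        have := congrArg Subtype.val hz
        simpa using this
      have hz0 : (z : F) ≠ 0 := by
        intro h2
        have h3 : (⟨y / a, hyO⟩ : 𝒪[F]) = 0 := by
          apply Subtype.ext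
          change y / (a : F) = 0
          rw [← hz', h2, zero_pow hp1]
        rw [h3] at hu
        exact not_isUnit_zero hu
      refine ⟨Units.mk0 z hz0, ?_, ?_⟩
      · have h2 : w (algebraMap F Ω (y / a)) = 1 := by
          refine le_antisymm ((hw.algebraMap_le_one_iff _).2 hyO) (not_lt.1 fun h3 => ?_)
          have h4 := (hw.residue_eq_zero_iff ⟨y / a, hyO⟩).2 h3
          rw [h1] at h4
          exact Units.ne_zero _ h4
        rw [← hz', map_pow, map_pow] at h2
        exact (pow_eq_one_iff.1 h2).resolve_right hp1
      · rw [Units.val_mk0, hz']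
        exact hy
  · rw [hcard, relIndex_coeffBall hw h0 hϖ, ← card_range_pow F p, Finset.card_univ,
      ← Nat.card_eq_fintype_card (α := R)]

/-- Polynomials with coefficients in given systems of representatives. -/
theorem exists_poly_transversal {N : ℕ} {C : ℕ → Set F} {T : ℕ → Finset F}
    (hT : ∀ l < p, IsTransversal (coeffBall w ϖ N) (C l) (T l)) :
    ∃ X₀ : Finset F[X],
      (∀ f ∈ X₀, f.Monic ∧ f.natDegree = p ∧ ∀ l < p, f.coeff l ∈ C l) ∧
      (∀ g : F[X], (g.Monic ∧ g.natDegree = p ∧ ∀ l < p, g.coeff l ∈ C l) →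
        ∃ f ∈ X₀, CoeffClose w p ϖ N f g) ∧
      (∀ f ∈ X₀, ∀ g ∈ X₀, CoeffClose w p ϖ N f g → f = g) ∧
      X₀.card = ∏ l ∈ Finset.range p, (T l).card := by
  classical
  let P : (Fin p → F) → F[X] := fun c => X ^ p + ∑ l : Fin p, Polynomial.C (c l) * X ^ (l : ℕ)
  have hcoeff (c : Fin p → F) (l : Fin p) : (P c).coeff l = c l := by
    simp only [P, coeff_add, coeff_X_pow, finsetSum_coeff, coeff_C_mul_X_pow]
    rw [if_neg (by have := l.2; omega), zero_add, Finset.sum_eq_single l]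
    · simp
    · intro k _ hk
      rw [if_neg]
      exact fun h1 => hk (Fin.ext h1.symm)
    · simp
  have hmonic (c : Fin p → F) : (P c).Monic := monic_X_pow_add (degree_sum_fin_lt c)
  have hdeg (c : Fin p → F) : (P c).natDegree = p := by
    have h1 : (P c).degree = p := by
      simp only [P]
      rw [degree_add_eq_left_of_degree_lt (by rw [degree_X_pow]; exact degree_sum_fin_lt c),
        degree_X_pow]
    exact natDegree_eq_of_degree_eq_some h1
  have hinj : Function.Injective P := by
    intro c c' h
    ext l
    rw [← hcoeff c l, h, hcoeff]
  have hmem {f : F[X]} (hf : f ∈ (Fintype.piFinset fun l : Fin p => T l).image P) :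
      ∃ c : Fin p → F, (∀ l : Fin p, c l ∈ T l) ∧ P c = f := by
    obtain ⟨c, hc, rfl⟩ := Finset.mem_image.1 hf
    exact ⟨c, Fintype.mem_piFinset.1 hc, rfl⟩
  refine ⟨(Fintype.piFinset fun l : Fin p => T l).image P, ?_, ?_, ?_, ?_⟩
  · intro f hf
    obtain ⟨c, hc, rfl⟩ := hmem hf
    refine ⟨hmonic c, hdeg c, fun l hl => ?_⟩
    rw [hcoeff c ⟨l, hl⟩]
    exact (hT l hl).subset _ (hc ⟨l, hl⟩)
  · rintro g ⟨-, -, hg⟩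
    choose c hc hgc using fun l : Fin p => (hT l l.2).exists_sub_mem _ (hg l l.2)
    refine ⟨P c, Finset.mem_image_of_mem P (Fintype.mem_piFinset.2 hc), fun l hl => ?_⟩
    rw [hcoeff c ⟨l, hl⟩, ← neg_sub, map_neg, w.map_neg]
    exact hgc ⟨l, hl⟩
  · intro f hf g hg hfg
    obtain ⟨c, hc, rfl⟩ := hmem hf
    obtain ⟨c', hc', rfl⟩ := hmem hg
    congr 1
    ext l
    have := hfg l l.2
    rw [hcoeff, hcoeff] at this
    exact (hT l l.2).eq_of_sub_mem _ (hc l) _ (hc' l) this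
  · rw [Finset.card_image_of_injective _ hinj, Fintype.card_piFinset,
      Finset.prod_range fun l => (T l).card]

end Coefficients

/-! ### The number of extensions of each type. -/

section Cardinality

variable {F : Type*} [Field F] [ValuativeRel F] [TopologicalSpace F]
  [IsNonarchimedeanLocalField F] {Ω : Type*} [Field Ω] [Algebra F Ω]
  {w : Valuation Ω ℝ≥0} {p : ℕ} [CharP 𝓀[F] p] [Fact p.Prime] {ϖ : F}
  [IsAlgClosure F Ω] {i j : ℕ}

theorem val_zpow {x : F} (n : ℤ) : val F (x ^ n) = n * val F x := by
  rcases n with n | n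
  · simp [val_pow]
  · rw [zpow_negSucc, val_inv, val_pow, Int.negSucc_eq]
    push_cast
    ring

/-- The leading coefficients with the prescribed absolute value and class form a single class
modulo `(p-1)`-th powers of units. -/
theorem exists_leadingCoeff (hw : IsExtendedValuation F w) (h0 : ϖ ≠ 0) (hϖ : val F ϖ = 1)
    {χ : Character F Ω p} (hj : jIndex χ i = j) :
    ∃ a₁ : Fˣ, w (algebraMap F Ω a₁) = w (algebraMap F Ω ϖ) ^ (i + 1) ∧ ∀ a : F,
      (w (algebraMap F Ω a) = w (algebraMap F Ω ϖ) ^ (i + 1) ∧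
        ∀ b : Fˣ, (b : F) = -(j * a) * ϖ ^ (j - 1) →
          KummerDual (cyclotomicChar F Ω p * χ⁻¹) b) ↔
      ∃ c : Fˣ, w (algebraMap F Ω c) = 1 ∧ a = a₁ * (c : F) ^ (p - 1) := by
  have hp : p.Prime := Fact.out
  have hp1 : p - 1 ≠ 0 := by have := hp.two_le; omega
  have hwϖ0 : w (algebraMap F Ω ϖ) ≠ 0 := by simpa using h0
  obtain ⟨hj1, hjp, hspec⟩ := (jIndex_spec χ i j).2 hj.symm
  obtain ⟨bω, hω⟩ := exists_kummerDual_right (cyclotomicChar F Ω p)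
  obtain ⟨bχ, hχ⟩ := exists_kummerDual_right χ
  have hθ := hω.mul hχ.inv
  rw [hω.valBar_eq, hχ.valBar_eq] at hspec
  -- The definition of j_{χ,i} says that elements dual to ωχ⁻¹ have valuation congruent to i + j
  -- modulo p - 1. A power of ϖ^(p-1) makes the valuation equal to i + j.
  obtain ⟨k, hk⟩ : ((p - 1 : ℕ) : ℤ) ∣ val F (bω : F) - val F (bχ : F) - (i + j : ℕ) := by
    rw [← ZMod.intCast_zmod_eq_zero_iff_dvd]
    push_cast
    rw [hspec]
    push_cast
    ring
  let t : Fˣ := Units.mk0 (ϖ ^ (-k)) (zpow_ne_zero _ h0)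
  set b₁ : Fˣ := bω * bχ⁻¹ * t ^ (p - 1) with hb₁
  have hθ₁ : KummerDual (cyclotomicChar F Ω p * χ⁻¹) b₁ := hθ.mul_pow t
  have hvb₁ : val F (b₁ : F) = (i + j : ℕ) := by
    rw [hb₁]
    push_cast
    rw [val_mul (mul_ne_zero (Units.ne_zero _) (inv_ne_zero (Units.ne_zero _)))
      (pow_ne_zero _ (Units.ne_zero _)), val_mul (Units.ne_zero _) (inv_ne_zero (Units.ne_zero _)),
      val_inv, val_pow, Units.val_mk0, val_zpow, hϖ]
    push_cast at hk
    linarith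
  clear_value b₁
  have hwj : w (j : Ω) = 1 :=
    hw.natCast_eq_one (p := p) fun h1 => absurd (Nat.le_of_dvd (by omega) h1) (by omega)
  have hj0 : (j : F) ≠ 0 := by
    intro h1
    rw [← map_natCast (algebraMap F Ω), h1] at hwj
    simp at hwj
  have hD : (j : F) * ϖ ^ (j - 1) ≠ 0 := mul_ne_zero hj0 (pow_ne_zero _ h0)
  -- The solution of -(j a) ϖ^(j-1) = b₁; its valuation is (i + j) - (j - 1) = i + 1.
  let a₁ : Fˣ := Units.mk0 (-(b₁ : F) / (j * ϖ ^ (j - 1)))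
    (div_ne_zero (neg_ne_zero.2 b₁.ne_zero) hD)
  have ha₁ : (a₁ : F) = -(b₁ : F) / (j * ϖ ^ (j - 1)) := rfl
  have hwa₁ : w (algebraMap F Ω a₁) = w (algebraMap F Ω ϖ) ^ (i + 1) := by
    rw [ha₁, map_div₀, map_div₀, map_neg, w.map_neg, hw.eq_zpow h0 hϖ b₁.ne_zero, hvb₁, map_mul,
      map_natCast, map_mul, hwj, one_mul, map_pow, map_pow, div_eq_iff (pow_ne_zero _ hwϖ0),
      ← pow_add, zpow_natCast]
    congr 1
    omega
  have hrel (y : F) : -((j : F) * (a₁ * y)) * ϖ ^ (j - 1) = b₁ * y := by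
    rw [ha₁]
    field_simp
  refine ⟨a₁, hwa₁, fun a => ⟨?_, ?_⟩⟩
  · rintro ⟨ha, hdual⟩
    have ha0 : a ≠ 0 := by
      rintro rfl
      rw [map_zero, map_zero, eq_comm] at ha
      exact pow_ne_zero _ hwϖ0 ha
    have hne : -((j : F) * a) * ϖ ^ (j - 1) ≠ 0 :=
      mul_ne_zero (neg_ne_zero.2 (mul_ne_zero hj0 ha0)) (pow_ne_zero _ h0)
    obtain ⟨c, hc⟩ := hθ₁.exists_eq_mul_pow (hdual (Units.mk0 _ hne) (Units.val_mk0 hne))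
    have hc' : -((j : F) * a) * ϖ ^ (j - 1) = b₁ * (c : F) ^ (p - 1) := by
      have := congrArg Units.val hc
      simpa using this
    have hac : a = a₁ * (c : F) ^ (p - 1) := by
      rw [← hrel] at hc'
      have h1 := mul_right_cancel₀ (pow_ne_zero _ h0) hc'
      exact mul_left_cancel₀ hj0 (neg_injective h1)
    refine ⟨c, ?_, hac⟩
    rw [hac, map_mul, map_mul, hwa₁, map_pow, map_pow] at ha
    exact (pow_eq_one_iff.1 (mul_right_eq_self₀.1 ha |>.resolve_right
      (pow_ne_zero _ hwϖ0))).resolve_right hp1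
  · rintro ⟨c, hc, rfl⟩
    refine ⟨?_, fun b hb => ?_⟩
    · rw [map_mul, map_mul, map_pow, map_pow, hc, one_pow, mul_one, hwa₁]
    · rw [hrel] at hb
      have : b = b₁ * c ^ (p - 1) := Units.ext (by simpa using hb)
      rw [this]
      exact hθ₁.mul_pow c

variable (F p) in
/-- The number of coefficients of index `l`, modulo `ϖ ^ (2 * i + 4)`, of the polynomials of
type `(i + 1, j)`. -/
noncomputable def coeffCount (i j l : ℕ) : ℕ :=
  if l = 0 then Nat.card 𝓀[F] ^ (2 * i + 2) else
  if l < j then Nat.card 𝓀[F] ^ (i + 2) else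
  if l = j then (Nat.card 𝓀[F] - 1) / (p - 1) * Nat.card 𝓀[F] ^ (i + 2) else
  Nat.card 𝓀[F] ^ (i + 3)

/-- Apart from index j, each condition defines a coset of the ball of exponent k, with k = 2 at
index 0, i + 2 below j and i + 1 above; this gives q^(2i+4-k) classes. Index j gives a class modulo
(p-1)-th powers of units. -/
theorem exists_coeff_transversal (hw : IsExtendedValuation F w) (h0 : ϖ ≠ 0) (hϖ : val F ϖ = 1)
    {χ : Character F Ω p} (hj1 : 1 ≤ j) (hj : j < p → jIndex χ i = j) (l : ℕ) (hl : l < p) :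
    ∃ T : Finset F, IsTransversal (coeffBall w ϖ (2 * i + 4))
      {a | CoeffCond w ϖ (cyclotomicChar F Ω p * χ⁻¹) (i + 1) j l a} T ∧
      T.card = coeffCount F p i j l := by
  have hball (x₀ : F) (k n : ℕ) (hkn : k + n = 2 * i + 4) :
      ∃ T : Finset F, IsTransversal (coeffBall w ϖ (2 * i + 4)) {x | x - x₀ ∈ coeffBall w ϖ k} T ∧
        T.card = Nat.card 𝓀[F] ^ n := by
    have hindex := relIndex_coeffBall hw h0 hϖ k n
    rw [hkn] at hindex
    obtain ⟨T, hT⟩ := exists_isTransversal (A := coeffBall w ϖ k) (B := coeffBall w ϖ (2 * i + 4))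
      (by rw [hindex]; exact pow_ne_zero _ card_residueField_ne_zero) x₀
    exact ⟨T, hT, by rw [hT.card_eq, hindex]⟩
  unfold coeffCount
  rcases Nat.eq_zero_or_pos l with rfl | hl0
  · rw [if_pos rfl]
    obtain ⟨T, hT, hcard⟩ := hball (-ϖ) 2 (2 * i + 2) (by omega)
    refine ⟨T, ?_, hcard⟩
    convert hT using 1
    ext a
    have hiff : a - -ϖ ∈ coeffBall w ϖ 2 ↔
        Near w (algebraMap F Ω (-a)) (algebraMap F Ω ϖ) := by
      rw [mem_coeffBall, ← hw.lt_pow_iff h0 hϖ _ 1, pow_one]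
      unfold Near
      rw [← map_sub, ← w.map_neg, ← map_neg]
      congr! 3
      ring
    rw [Set.mem_ofPred_eq, Set.mem_ofPred_eq, hiff]
    exact ⟨fun h => h.near rfl, fun h => ⟨fun _ => h, fun h1 => by omega, fun h1 => by omega,
      fun h1 => by omega⟩⟩
  rw [if_neg (by omega)]
  rcases lt_trichotomy l j with hlt | heq | hgt
  · rw [if_pos hlt]
    obtain ⟨T, hT, hcard⟩ := hball 0 (i + 2) (i + 2) (by omega)
    refine ⟨T, ?_, hcard⟩
    convert hT using 1
    ext a
    rw [Set.mem_ofPred_eq, Set.mem_ofPred_eq, sub_zero, mem_coeffBall]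
    exact ⟨fun h => h.le_of_lt hl0 hlt, fun h => ⟨fun h1 => by omega, fun _ _ => h,
      fun h1 => by omega, fun h1 => by omega⟩⟩
  · subst heq
    rw [if_neg (lt_irrefl l), if_pos rfl]
    obtain ⟨a₁, ha₁, hiff⟩ := exists_leadingCoeff hw h0 hϖ (hj hl)
    obtain ⟨T, hT, hcard⟩ := exists_isTransversal_mul_pow (p := p) hw h0 hϖ ha₁ (i + 2)
    rw [show i + 1 + 1 + (i + 2) = 2 * i + 4 by ring] at hT
    refine ⟨T, ?_, hcard⟩
    convert hT using 1
    ext a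
    rw [Set.mem_ofPred_eq, Set.mem_ofPred_eq, ← hiff]
    exact ⟨fun h => h.eq_of_eq rfl, fun h => ⟨fun h1 => by omega, fun h1 h2 => by omega,
      fun _ => h, fun h1 => by omega⟩⟩
  · rw [if_neg (by omega), if_neg (by omega)]
    obtain ⟨T, hT, hcard⟩ := hball 0 (i + 1) (i + 3) (by omega)
    refine ⟨T, ?_, hcard⟩
    convert hT using 1
    ext a
    rw [Set.mem_ofPred_eq, Set.mem_ofPred_eq, sub_zero, mem_coeffBall]
    exact ⟨fun h => h.le_of_gt hgt, fun h => ⟨fun h1 => by omega, fun _ _ => by omega,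
      fun h1 => by omega, fun _ => h⟩⟩

/-- The exponents add up to (2i + 2) + j(i + 2) + (p - 1 - j)(i + 3) = (p(i + 3) - j - 1) + i. The
first summand cancels against the number of uniformizers, leaving q^i. -/
theorem prod_coeffCount_of_lt (hj1 : 1 ≤ j) (hjp : j < p) :
    ∏ l ∈ Finset.range p, coeffCount F p i j l =
      Nat.card 𝓀[F] ^ (p * (i + 3) - j - 1) *
        ((Nat.card 𝓀[F] - 1) / (p - 1) * Nat.card 𝓀[F] ^ i) := by
  obtain ⟨k, rfl⟩ : ∃ k, j = k + 1 := ⟨j - 1, by omega⟩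
  obtain ⟨r, hr⟩ : ∃ r, p = k + 1 + 1 + r := ⟨p - (k + 1 + 1), by omega⟩
  have h1 : ∀ l ∈ Finset.range k, coeffCount F p i (k + 1) (l + 1) =
      Nat.card 𝓀[F] ^ (i + 2) := by
    intro l hl
    rw [Finset.mem_range] at hl
    unfold coeffCount
    rw [if_neg (by omega), if_pos (by omega)]
  have h2 : ∀ l ∈ Finset.range r, coeffCount F p i (k + 1) (k + 1 + 1 + l) =
      Nat.card 𝓀[F] ^ (i + 3) := by
    intro l hl
    unfold coeffCount
    rw [if_neg (by omega), if_neg (by omega), if_neg (by omega)]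
  have h3 : coeffCount F p i (k + 1) 0 = Nat.card 𝓀[F] ^ (2 * i + 2) := by
    unfold coeffCount
    rw [if_pos rfl]
  have h4 : coeffCount F p i (k + 1) (k + 1) =
      (Nat.card 𝓀[F] - 1) / (p - 1) * Nat.card 𝓀[F] ^ (i + 2) := by
    unfold coeffCount
    rw [if_neg (by omega), if_neg (by omega), if_pos rfl]
  have h5 : p * (i + 3) - (k + 1) - 1 + i = 2 * i + 2 + (i + 2) * (k + 1) + (i + 3) * r := by
    have : p * (i + 3) = (i + 2) * (k + 1) + (i + 3) * r + (k + 1) + (i + 3) := by rw [hr]; ring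
    omega
  calc ∏ l ∈ Finset.range p, coeffCount F p i (k + 1) l
      = ∏ l ∈ Finset.range (k + 1 + 1 + r), coeffCount F p i (k + 1) l := by rw [← hr]
    _ = Nat.card 𝓀[F] ^ (2 * i + 2 + (i + 2) * (k + 1) + (i + 3) * r) *
        ((Nat.card 𝓀[F] - 1) / (p - 1)) := by
      rw [Finset.prod_range_add, Finset.prod_congr rfl h2, Finset.prod_range_succ,
        Finset.prod_range_succ', Finset.prod_congr rfl h1, h3, h4, Finset.prod_const,
        Finset.prod_const, Finset.card_range, Finset.card_range]
      ring
    _ = _ := by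
      rw [← h5, pow_add]
      ring

/-- No coefficient below the leading one is tied to a class of (p-1)-th powers, so the factor (q -
1)/(p - 1) disappears and q^(i+1) is left. -/
theorem prod_coeffCount_prime :
    ∏ l ∈ Finset.range p, coeffCount F p i p l =
      Nat.card 𝓀[F] ^ (p * (i + 3) - p - 1) * Nat.card 𝓀[F] ^ (i + 1) := by
  have hp : p.Prime := Fact.out
  obtain ⟨r, hr⟩ : ∃ r, p = r + 1 := ⟨p - 1, by have := hp.two_le; omega⟩
  have h1 : ∀ l ∈ Finset.range r, coeffCount F p i p (l + 1) = Nat.card 𝓀[F] ^ (i + 2) := by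
    intro l hl
    rw [Finset.mem_range] at hl
    unfold coeffCount
    rw [if_neg (by omega), if_pos (by omega)]
  have h3 : coeffCount F p i p 0 = Nat.card 𝓀[F] ^ (2 * i + 2) := by
    unfold coeffCount
    rw [if_pos rfl]
  have h5 : p * (i + 3) - p - 1 + (i + 1) = (i + 2) * r + (2 * i + 2) := by
    have : p * (i + 3) = (i + 2) * r + p + (i + 2) := by rw [hr]; ring
    omega
  calc ∏ l ∈ Finset.range p, coeffCount F p i p l
      = ∏ l ∈ Finset.range (r + 1), coeffCount F p i p l := by rw [← hr]
    _ = Nat.card 𝓀[F] ^ ((i + 2) * r + (2 * i + 2)) := by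
      rw [Finset.prod_range_succ', Finset.prod_congr rfl h1, h3, Finset.prod_const,
        Finset.card_range, ← pow_mul, ← pow_add]
    _ = _ := by rw [← h5, pow_add]

theorem exists_radius (w : Valuation Ω ℝ≥0) (ϖ : F) : ∃ ρ : ℝ≥0, ρ ^ p = w (algebraMap F Ω ϖ) := by
  have hp : p.Prime := Fact.out
  have : IsAlgClosed Ω := IsAlgClosure.isAlgClosed F
  obtain ⟨z, hz⟩ := IsAlgClosed.exists_pow_nat_eq (algebraMap F Ω ϖ) hp.pos
  exact ⟨w z, by rw [← map_pow, hz]⟩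

theorem extensionsOfType_finite_and_ncard (hw : IsExtendedValuation F w) (h0 : ϖ ≠ 0)
    (hϖ : val F ϖ = 1) {χ : Character F Ω p} (hj1 : 1 ≤ j) (hjp : j ≤ p)
    (hj : j < p → jIndex χ i = j) (hle : w (p : Ω) ≤ w (algebraMap F Ω ϖ) ^ (i + 1))
    (heq : j = p → w (p : Ω) = w (algebraMap F Ω ϖ) ^ (i + 1))
    (hdual : j = p → ∀ b : Fˣ, (b : F) = -(p * 1) * ϖ ^ (p - 1) →
      KummerDual (cyclotomicChar F Ω p * χ⁻¹) b) :
    (extensionsOfType F Ω χ i j).Finite ∧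
      (extensionsOfType F Ω χ i j).ncard * Nat.card 𝓀[F] ^ (p * (i + 3) - j - 1) =
        p * ∏ l ∈ Finset.range p, coeffCount F p i j l := by
  classical
  obtain ⟨ρ, hρ⟩ := exists_radius (p := p) w ϖ
  have hex (l : ℕ) : ∃ T : Finset F, l < p → IsTransversal (coeffBall w ϖ (2 * i + 4))
      {a | CoeffCond w ϖ (cyclotomicChar F Ω p * χ⁻¹) (i + 1) j l a} T ∧
      T.card = coeffCount F p i j l := by
    by_cases hl : l < p
    · obtain ⟨T, hT⟩ := exists_coeff_transversal hw h0 hϖ hj1 hj l hl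
      exact ⟨T, fun _ => hT⟩
    · exact ⟨∅, fun h => absurd h hl⟩
  choose T hT using hex
  obtain ⟨X₀, h1, h2, h3, h4⟩ := exists_poly_transversal (p := p) fun l hl => (hT l hl).1
  rw [← Finset.prod_congr rfl fun l hl => (hT l (Finset.mem_range.1 hl)).2, ← h4]
  exact ncard_extensionsOfType_mul hw h0 hϖ hρ hj1 hjp hle heq hdual h1 h2 h3

end Cardinality

/-- The terms are nonnegative and the fibres of t finite, so the family may be summed fibre by
fibre. There may be infinitely many fields, one reason to argue with `HasSum`. -/
theorem hasSum_of_card_fiber {α : Type*} (t : α → ℕ) {f : α → ℝ} {n : ℕ → ℕ} {c : ℕ → ℝ}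
    (hc : ∀ i, 0 ≤ c i) (hfin : ∀ i, Finite {a // t a = i})
    (hn : ∀ i, Nat.card {a // t a = i} = n i) (hf : ∀ a, f a = c (t a)) {s : ℝ}
    (hs : HasSum (fun i => n i * c i) s) : HasSum f s := by
  rw [← (Equiv.sigmaFiberEquiv t).hasSum_iff]
  have hfib (i : ℕ) : HasSum (fun a : {a // t a = i} => f a) (n i * c i) := by
    have := Fintype.ofFinite {a // t a = i}
    have hfc : (fun a : {a // t a = i} => f a) = fun _ => c i :=
      funext fun a => by rw [hf, a.2]
    have h1 := hasSum_fintype (fun _ : {a // t a = i} => c i)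
    rw [Finset.sum_const, Finset.card_univ, ← Nat.card_eq_fintype_card, hn, nsmul_eq_mul] at h1
    rwa [hfc]
  refine HasSum.sigma_of_hasSum hs hfib ?_
  refine (summable_sigma_of_nonneg fun a => ?_).2 ⟨fun i => (hfib i).summable, ?_⟩
  · change 0 ≤ f _
    rw [hf]
    exact hc _
  · refine hs.summable.congr fun i => ?_
    exact (hfib i).tsum_eq.symm

/-! ### The masses of the two kinds of extensions. -/

section Masses

variable {F : Type*} [Field F] [ValuativeRel F] [TopologicalSpace F]
  [IsNonarchimedeanLocalField F] {Ω : Type*} [Field Ω] [Algebra F Ω]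
  {w : Valuation Ω ℝ≥0} {p : ℕ} [CharP 𝓀[F] p] [Fact p.Prime] {ϖ : F}
  [IsAlgClosure F Ω] {i j : ℕ} {χ : Character F Ω p}

theorem kummerDual_mul_pow_prime [CharZero F] {b : Fˣ} {c : F} (hc : c ≠ 0)
    (hb : (b : F) = -(p * 1) * c ^ (p - 1)) : KummerDual (cyclotomicChar F Ω p) b := by
  have hp : p.Prime := Fact.out
  have hp0 : -(p : F) ≠ 0 := neg_ne_zero.2 (Nat.cast_ne_zero.2 hp.ne_zero)
  have h1 := (kummerDual_cyclotomicChar (Ω := Ω) (Units.val_mk0 hp0)).mul_pow (Units.mk0 c hc)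
  convert h1 using 1
  ext
  rw [hb]
  simp

/-- The leading class b = -(j a_j)(-a_0)^(j-1) is dual to ωχ⁻¹ and has valuation (i + 1) + (j - 1) =
i + j; for j < p this is the defining congruence of j_{χ,i}. For j = p the coefficient a_p is 1, so
|p| = |ϖ|^(i+1) excludes characteristic p, and b is -p times a (p-1)-th power, hence dual to ω, so
that χ = 1. -/
theorem exists_type_of_hasCharacter (hw : IsExtendedValuation F w) (h0 : ϖ ≠ 0)
    (hϖ : val F ϖ = 1) {E : IntermediateField F Ω} (hE : E ∈ ramifiedExtensions F Ω p)
    (hχ : HasCharacter E χ) : ∃ i j : ℕ, 1 ≤ j ∧ j ≤ p ∧ serreC E = i * p + j ∧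
      w (p : Ω) ≤ w (algebraMap F Ω ϖ) ^ (i + 1) ∧ (j < p → jIndex χ i = j) ∧
      (j = p → w (p : Ω) = w (algebraMap F Ω ϖ) ^ (i + 1) ∧ χ = 1) := by
  have hp : p.Prime := Fact.out
  have : Algebra.IsAlgebraic F Ω := IsAlgClosure.isAlgebraic
  obtain ⟨hsep, π, hπ⟩ := (mem_ramifiedExtensions_iff hw h0 hϖ).1 hE
  obtain ⟨i, j, ht⟩ := hπ.exists_hasType hw h0 hϖ
  have hroot := minpoly.aeval F π
  have hf := ht.isEisensteinPoly
  have hne := leadingClass_ne_zero h0 hf (ht.leadsAt hw h0 hϖ) hroot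
  have hdual : KummerDual (cyclotomicChar F Ω p * χ⁻¹) (Units.mk0 _ hne) := by
    rw [← ht.hasCharacter_iff hw h0 hϖ hroot (Units.val_mk0 hne), hπ.adjoin_eq hw h0 hϖ]
    exact hχ
  have hj1 := ht.one_le
  have hwϖ0 : 0 < w (algebraMap F Ω ϖ) := by rw [zero_lt_iff]; simpa using h0
  refine ⟨i, j, hj1, ht.le_prime, ht.serreC_eq hw h0 hϖ hπ, ht.map_prime_le, ?_, ?_⟩
  · intro hjp
    symm
    rw [← jIndex_spec]
    refine ⟨hj1, hjp, ?_⟩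
    obtain ⟨bω, hω⟩ := exists_kummerDual_right (cyclotomicChar F Ω p)
    have h1 := hω.mul hdual.inv
    have h2 : cyclotomicChar F Ω p * (cyclotomicChar F Ω p * χ⁻¹)⁻¹ = χ := by ext σ; simp
    rw [h2] at h1
    have hA : (j : F) * (minpoly F π).coeff j ≠ 0 := by
      unfold leadingClass at hne
      exact neg_ne_zero.1 (left_ne_zero_of_mul hne)
    have hB : -(minpoly F π).coeff 0 ≠ 0 := by
      intro h3
      have := hf.coeff_zero
      rw [neg_eq_zero.1 h3, map_zero, map_zero] at this
      exact hwϖ0.ne this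
    have hinj {n : ℕ} {x : F} (hx : x ≠ 0)
        (h3 : w (algebraMap F Ω x) = w (algebraMap F Ω ϖ) ^ n) : val F x = n := by
      rw [hw.eq_zpow h0 hϖ hx, ← zpow_natCast] at h3
      exact zpow_right_injective₀ hwϖ0 (hw.uniformizer_lt_one h0 hϖ).ne h3
    have hvA : val F (-((j : F) * (minpoly F π).coeff j)) = (i + 1 : ℕ) :=
      hinj (neg_ne_zero.2 hA) (by
        rw [map_neg, w.map_neg, map_mul, map_natCast]; exact ht.map_coeff_eq)
    have hvB : val F (-(minpoly F π).coeff 0) = (1 : ℕ) :=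
      hinj hB (by rw [map_neg, w.map_neg, pow_one]; exact hf.coeff_zero)
    have hv : val F (leadingClass j (minpoly F π)) = (i + j : ℕ) := by
      unfold leadingClass
      rw [val_mul (neg_ne_zero.2 hA) (pow_ne_zero _ hB), hvA, val_pow, hvB]
      push_cast [Nat.cast_sub hj1]
      ring
    rw [h1.valBar_eq, hω.valBar_eq]
    push_cast
    rw [val_mul (Units.ne_zero _) (inv_ne_zero (Units.ne_zero _)), val_inv, Units.val_mk0, hv]
    push_cast
    ring
  · rintro rfl
    have heq := ht.map_coeff_eq
    rw [hf.coeff_self, map_one, mul_one] at heq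
    refine ⟨heq, ?_⟩
    have hchar : CharZero F := by
      refine (charZero_or_charP F j).resolve_right fun h1 => ?_
      have h2 : (j : Ω) = 0 := by
        rw [← map_natCast (algebraMap F Ω), CharP.cast_eq_zero, map_zero]
      rw [h2, map_zero] at heq
      exact (pow_pos hwϖ0 _).ne heq
    have hB : -(minpoly F π).coeff 0 ≠ 0 := by
      intro h3
      have := hf.coeff_zero
      rw [neg_eq_zero.1 h3, map_zero, map_zero] at this
      exact hwϖ0.ne this
    have h1 : KummerDual (cyclotomicChar F Ω j) (Units.mk0 _ hne) := by
      refine kummerDual_mul_pow_prime hB ?_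
      rw [Units.val_mk0]
      unfold leadingClass
      rw [hf.coeff_self]
    have h2 := kummerDual_unique hdual h1
    ext σ
    have h3 := DFunLike.congr_fun h2 σ
    rw [MonoidHom.mul_apply, mul_eq_left, MonoidHom.inv_apply, inv_eq_one] at h3
    rw [h3]
    rfl

theorem ncard_extensionsOfType_of_le (hw : IsExtendedValuation F w) (h0 : ϖ ≠ 0)
    (hϖ : val F ϖ = 1) (hle : w (p : Ω) ≤ w (algebraMap F Ω ϖ) ^ (i + 1)) :
    (extensionsOfType F Ω χ i (jIndex χ i)).Finite ∧
      (extensionsOfType F Ω χ i (jIndex χ i)).ncard =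
        p * ((Nat.card 𝓀[F] - 1) / (p - 1) * Nat.card 𝓀[F] ^ i) := by
  obtain ⟨hj1, hjp, -⟩ := (jIndex_spec χ i _).2 rfl
  obtain ⟨h1, h2⟩ := extensionsOfType_finite_and_ncard hw h0 hϖ (χ := χ) hj1 hjp.le
    (fun _ => rfl) hle (fun h => absurd h hjp.ne) (fun h => absurd h hjp.ne)
  refine ⟨h1, ?_⟩
  rw [prod_coeffCount_of_lt hj1 hjp, mul_left_comm, mul_comm] at h2
  exact mul_left_cancel₀ (pow_ne_zero _ card_residueField_ne_zero) h2

theorem ncard_extensionsOfType_prime [CharZero F] (hw : IsExtendedValuation F w) (h0 : ϖ ≠ 0)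
    (hϖ : val F ϖ = 1) (heq : w (p : Ω) = w (algebraMap F Ω ϖ) ^ (i + 1)) :
    (extensionsOfType F Ω (1 : Character F Ω p) i p).Finite ∧
      (extensionsOfType F Ω (1 : Character F Ω p) i p).ncard = p * Nat.card 𝓀[F] ^ (i + 1) := by
  have hp : p.Prime := Fact.out
  obtain ⟨h1, h2⟩ := extensionsOfType_finite_and_ncard hw h0 hϖ (χ := (1 : Character F Ω p))
    hp.one_le le_rfl (fun h => absurd h (lt_irrefl p)) heq.le (fun _ => heq) (fun _ b hb => by
      have h3 : cyclotomicChar F Ω p * (1 : Character F Ω p)⁻¹ = cyclotomicChar F Ω p := by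
        ext σ; simp
      rw [h3]
      exact kummerDual_mul_pow_prime h0 hb)
  refine ⟨h1, ?_⟩
  rw [prod_coeffCount_prime, mul_left_comm, mul_comm] at h2
  exact mul_left_cancel₀ (pow_ne_zero _ card_residueField_ne_zero) h2

theorem two_le_card_residueField : 2 ≤ Nat.card 𝓀[F] := by
  have : Fintype 𝓀[F] := Fintype.ofFinite _
  rw [Nat.card_eq_fintype_card]
  exact Fintype.one_lt_card

/-- The mass of the extensions with character `χ` that are not très ramifiées. -/
theorem hasSum_not_dvd (hw : IsExtendedValuation F w) (h0 : ϖ ≠ 0) (hϖ : val F ϖ = 1)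
    (A : ℕ → Prop) [DecidablePred A]
    (hA : ∀ i, A i ↔ w (p : Ω) ≤ w (algebraMap F Ω ϖ) ^ (i + 1)) {s : ℝ}
    (hs : HasSum (fun i => if A i then massTerm χ i else 0) s) :
    HasSum (fun E : {E : IntermediateField F Ω //
        (E ∈ ramifiedExtensions F Ω p ∧ HasCharacter E χ) ∧ ¬ (p : ℤ) ∣ serreC E} =>
      (Nat.card 𝓀[F] : ℝ) ^ (-serreC E.1))
      ((p : ℝ) * ((Nat.card 𝓀[F] : ℝ) - 1) / (p - 1) * s) := by
  have hp : p.Prime := Fact.out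
  have hp2 := hp.two_le
  have hq2 := two_le_card_residueField (F := F)
  have hq0 : (Nat.card 𝓀[F] : ℝ) ≠ 0 := by positivity
  -- The case j = p would make c(E) divisible by p; hence j = j_{χ,i}, and i alone determines c(E).
  have htype (E : {E : IntermediateField F Ω //
      (E ∈ ramifiedExtensions F Ω p ∧ HasCharacter E χ) ∧ ¬ (p : ℤ) ∣ serreC E}) :
      ∃ i : ℕ, A i ∧ serreC E.1 = i * p + jIndex χ i := by
    obtain ⟨i, j, hj1, hjp, hc, hle, hj, -⟩ := exists_type_of_hasCharacter hw h0 hϖ E.2.1.1 E.2.1.2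
    rcases hjp.lt_or_eq with h1 | h1
    · exact ⟨i, (hA i).2 hle, by rw [hc, hj h1]⟩
    · exact absurd ⟨(i : ℤ) + 1, by rw [hc, h1]; ring⟩ E.2.2
  choose t htA htc using htype
  have hndvd (i : ℕ) : ¬ (p : ℤ) ∣ i * p + jIndex χ i := by
    obtain ⟨hj1, hjp, -⟩ := (jIndex_spec χ i _).2 rfl
    rw [dvd_add_right (dvd_mul_left _ _), Int.natCast_dvd_natCast]
    exact fun h => absurd (Nat.le_of_dvd (by omega) h) (by omega)
  have htu (E) (i : ℕ) (h : serreC E.1 = i * p + jIndex χ i) : t E = i := by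
    obtain ⟨hj1, hjp, -⟩ := (jIndex_spec χ i _).2 rfl
    obtain ⟨hj1', hjp', -⟩ := (jIndex_spec χ (t E) _).2 rfl
    exact (type_unique hj1' hjp'.le hj1 hjp.le ((htc E).symm.trans h)).1
  have hcard (i : ℕ) : Finite {E // t E = i} ∧ Nat.card {E // t E = i} =
      if A i then p * ((Nat.card 𝓀[F] - 1) / (p - 1) * Nat.card 𝓀[F] ^ i) else 0 := by
    split_ifs with hAi
    · obtain ⟨h1, h2⟩ := ncard_extensionsOfType_of_le (χ := χ) hw h0 hϖ ((hA i).1 hAi)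
      have hbij : Function.Bijective
          (fun E : {E // t E = i} => (⟨E.1.1, E.1.2.1, by rw [htc E.1, E.2]⟩ :
            extensionsOfType F Ω χ i (jIndex χ i))) := by
        constructor
        · intro E E' h
          have h' : E.1.1 = E'.1.1 := congrArg (fun L : extensionsOfType F Ω χ i (jIndex χ i) => L.1) h
          exact Subtype.ext (Subtype.ext h')
        · rintro ⟨E, hE, hc⟩
          exact ⟨⟨⟨E, hE, by rw [hc]; exact hndvd i⟩, htu _ i hc⟩, rfl⟩
      have : Finite (extensionsOfType F Ω χ i (jIndex χ i)) := h1
      refine ⟨Finite.of_injective _ hbij.injective, ?_⟩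
      rw [Nat.card_eq_of_bijective _ hbij, Nat.card_coe_set_eq, h2]
    · have : IsEmpty {E // t E = i} := ⟨fun E => hAi (E.2 ▸ htA E.1)⟩
      exact ⟨inferInstance, Nat.card_of_isEmpty⟩
  refine hasSum_of_card_fiber t (c := fun i => (Nat.card 𝓀[F] : ℝ) ^ (-(i * p + jIndex χ i : ℤ)))
    (fun i => by positivity) (fun i => (hcard i).1) (fun i => (hcard i).2)
    (fun E => by rw [htc E]) ?_
  refine Eq.subst (motive := fun g => HasSum g _) (funext fun i => ?_)
    (hs.mul_left ((p : ℝ) * ((Nat.card 𝓀[F] : ℝ) - 1) / (p - 1)))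
  split_ifs with hAi
  · have hp1 : ((p - 1 : ℕ) : ℝ) ≠ 0 := by
      rw [Nat.cast_ne_zero]; omega
    -- The division in ℕ is exact because p - 1 divides q - 1.
    rw [Nat.cast_mul, Nat.cast_mul, Nat.cast_div (pred_dvd_card_pred F p) hp1,
      Nat.cast_sub (by omega), Nat.cast_sub (by omega), Nat.cast_pow]
    unfold massTerm
    rw [sub_eq_add_neg (i : ℤ), zpow_add₀ hq0, zpow_natCast]
    push_cast
    ring
  · simp

/-- The mass of the très ramifiées extensions. -/
theorem hasSum_dvd [CharZero F] (hw : IsExtendedValuation F w) (h0 : ϖ ≠ 0) (hϖ : val F ϖ = 1)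
    (heq : w (p : Ω) = w (algebraMap F Ω ϖ) ^ (i + 1)) :
    HasSum (fun E : {E : IntermediateField F Ω //
        E ∈ ramifiedExtensions F Ω p ∧ HasCharacter E (1 : Character F Ω p) ∧
          (p : ℤ) ∣ serreC E} => (Nat.card 𝓀[F] : ℝ) ^ (-serreC E.1))
      ((p : ℝ) / (Nat.card 𝓀[F] : ℝ) ^ ((p - 1) * (i + 1))) := by
  have hp : p.Prime := Fact.out
  have hp2 := hp.two_le
  have hq2 := two_le_card_residueField (F := F)
  have hq0 : (Nat.card 𝓀[F] : ℝ) ≠ 0 := by positivity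
  have hwϖ0 : 0 < w (algebraMap F Ω ϖ) := by rw [zero_lt_iff]; simpa using h0
  -- Divisibility of ip + j by p with 1 ≤ j ≤ p forces j = p, and then the absolute value of p
  -- determines i. All these extensions share the same c.
  have hc (E : {E : IntermediateField F Ω // E ∈ ramifiedExtensions F Ω p ∧
      HasCharacter E (1 : Character F Ω p) ∧ (p : ℤ) ∣ serreC E}) : serreC E.1 = i * p + p := by
    obtain ⟨i', j, hj1, hjp, hc, -, -, hj⟩ :=
      exists_type_of_hasCharacter hw h0 hϖ E.2.1 E.2.2.1
    have hdvd := E.2.2.2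
    rw [hc, dvd_add_right (dvd_mul_left _ _), Int.natCast_dvd_natCast] at hdvd
    have hjeq : j = p := le_antisymm hjp (Nat.le_of_dvd (by omega) hdvd)
    have h1 := (hj hjeq).1
    rw [heq] at h1
    have h2 := pow_right_injective₀ hwϖ0 (hw.uniformizer_lt_one h0 hϖ).ne h1
    rw [hc, hjeq]
    have h3 : i' = i := by omega
    rw [h3]
  obtain ⟨h1, h2⟩ := ncard_extensionsOfType_prime (Ω := Ω) hw h0 hϖ heq
  have hbij : Function.Bijective
      (fun E : {E : IntermediateField F Ω // E ∈ ramifiedExtensions F Ω p ∧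
        HasCharacter E (1 : Character F Ω p) ∧ (p : ℤ) ∣ serreC E} =>
        (⟨E.1, ⟨E.2.1, E.2.2.1⟩, hc E⟩ : extensionsOfType F Ω (1 : Character F Ω p) i p)) := by
    constructor
    · intro E E' h
      have h' : E.1 = E'.1 :=
        congrArg (fun L : extensionsOfType F Ω (1 : Character F Ω p) i p => L.1) h
      exact Subtype.ext h'
    · rintro ⟨E, hE, hc⟩
      exact ⟨⟨E, hE.1, hE.2, by rw [hc]; exact ⟨i + 1, by ring⟩⟩, rfl⟩
  have hfin : Finite (extensionsOfType F Ω (1 : Character F Ω p) i p) := h1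
  have hfin' := Finite.of_injective _ hbij.injective
  have := Fintype.ofFinite {E : IntermediateField F Ω // E ∈ ramifiedExtensions F Ω p ∧
      HasCharacter E (1 : Character F Ω p) ∧ (p : ℤ) ∣ serreC E}
  convert hasSum_fintype _ using 1
  rw [Finset.sum_congr rfl fun E _ => by rw [hc E], Finset.sum_const, Finset.card_univ,
    ← Nat.card_eq_fintype_card, Nat.card_eq_of_bijective _ hbij, Nat.card_coe_set_eq, h2,
    nsmul_eq_mul, Nat.cast_mul, Nat.cast_pow, mul_assoc, div_eq_mul_inv, ← zpow_natCast,
    ← zpow_natCast, ← zpow_neg, ← zpow_add₀ hq0]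
  -- The remaining exponents are (i + 1) - (i + 1)p and -(p - 1)(i + 1).
  congr 2
  push_cast [Nat.cast_sub hp.one_le]
  ring

/-- As p ≥ 2, the exponent is at most -i, so a geometric series of ratio 1/q dominates. -/
theorem summable_massTerm (χ : Character F Ω p) : Summable fun i => massTerm χ i := by
  have hp : p.Prime := Fact.out
  have hq2 := two_le_card_residueField (F := F)
  have hq1 : (1 : ℝ) < Nat.card 𝓀[F] := by exact_mod_cast hq2
  refine Summable.of_nonneg_of_le (fun i => ?_) (fun i => ?_)
    (summable_geometric_of_lt_one (r := (Nat.card 𝓀[F] : ℝ)⁻¹) (by positivity)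
      (inv_lt_one_of_one_lt₀ hq1))
  · unfold massTerm
    positivity
  · unfold massTerm
    rw [← zpow_natCast, inv_zpow', zpow_le_zpow_iff_right₀ hq1]
    have h1 : (2 : ℤ) ≤ p := by exact_mod_cast hp.two_le
    have h2 : (i : ℤ) * 2 ≤ i * p := mul_le_mul_of_nonneg_left h1 (by positivity)
    omega

end Masses

/-! ### Summation over all extensions with a given character. -/

section Total

variable {F : Type*} [Field F] [ValuativeRel F] [TopologicalSpace F]
  [IsNonarchimedeanLocalField F] {Ω : Type*} [Field Ω] [Algebra F Ω]
  {w : Valuation Ω ℝ≥0} {p : ℕ} [CharP 𝓀[F] p] [Fact p.Prime] {ϖ : F}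
  [IsAlgClosure F Ω] {χ : Character F Ω p}

theorem map_prime_eq [CharZero F] (hw : IsExtendedValuation F w) (h0 : ϖ ≠ 0) (hϖ : val F ϖ = 1) :
    1 ≤ absRamificationIdx F p ∧
      w (p : Ω) = w (algebraMap F Ω ϖ) ^ absRamificationIdx F p := by
  have hp : p.Prime := Fact.out
  have hp0 : (p : F) ≠ 0 := Nat.cast_ne_zero.2 hp.ne_zero
  have hwϖ0 : 0 < w (algebraMap F Ω ϖ) := by rw [zero_lt_iff]; simpa using h0
  have h1 := hw.prime_lt_one (p := p)
  have h2 : w (p : Ω) = w (algebraMap F Ω ϖ) ^ val F (p : F) := by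
    rw [← map_natCast (algebraMap F Ω), hw.eq_zpow h0 hϖ hp0]
  have h3 : 1 ≤ val F (p : F) := by
    by_contra! h4
    rw [h2] at h1
    exact absurd h1 (not_lt.2
      (one_le_zpow_of_nonpos₀ hwϖ0 (hw.uniformizer_lt_one h0 hϖ).le (by omega)))
  unfold absRamificationIdx
  refine ⟨by omega, ?_⟩
  rw [h2, ← zpow_natCast, Int.toNat_of_nonneg (by omega)]

/-- The extensions with character `χ` are those that are très ramifiées and those that
are not. -/
theorem hasSum_of_dvd_of_not_dvd {f : IntermediateField F Ω → ℝ} {a b : ℝ}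
    (ha : HasSum (fun E : {E : IntermediateField F Ω //
      (E ∈ ramifiedExtensions F Ω p ∧ HasCharacter E χ) ∧ ¬ (p : ℤ) ∣ serreC E} => f E.1) a)
    (hb : HasSum (fun E : {E : IntermediateField F Ω //
      E ∈ ramifiedExtensions F Ω p ∧ HasCharacter E χ ∧ (p : ℤ) ∣ serreC E} => f E.1) b) :
    HasSum (fun E : {E // E ∈ ramifiedExtensions F Ω p ∧ HasCharacter E χ} => f E.1)
      (a + b) := by
  have hdisj : Disjoint {E : IntermediateField F Ω |
      (E ∈ ramifiedExtensions F Ω p ∧ HasCharacter E χ) ∧ ¬ (p : ℤ) ∣ serreC E}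
      {E | E ∈ ramifiedExtensions F Ω p ∧ HasCharacter E χ ∧ (p : ℤ) ∣ serreC E} :=
    Set.disjoint_left.2 fun E h1 h2 => h1.2 h2.2.2
  have h := HasSum.add_disjoint hdisj ha hb
  have hunion : {E : IntermediateField F Ω |
      (E ∈ ramifiedExtensions F Ω p ∧ HasCharacter E χ) ∧ ¬ (p : ℤ) ∣ serreC E} ∪
      {E | E ∈ ramifiedExtensions F Ω p ∧ HasCharacter E χ ∧ (p : ℤ) ∣ serreC E} =
      {E | E ∈ ramifiedExtensions F Ω p ∧ HasCharacter E χ} := by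
    ext E
    constructor
    · rintro (h1 | h1)
      · exact h1.1
      · exact ⟨h1.1, h1.2.1⟩
    · intro h1
      by_cases h2 : (p : ℤ) ∣ serreC E
      · exact Or.inr ⟨h1.1, h1.2, h2⟩
      · exact Or.inl ⟨h1, h2⟩
  rw [hunion] at h
  exact h

theorem hasSum_of_forall_not_dvd {f : IntermediateField F Ω → ℝ} {a : ℝ}
    (ha : HasSum (fun E : {E : IntermediateField F Ω //
      (E ∈ ramifiedExtensions F Ω p ∧ HasCharacter E χ) ∧ ¬ (p : ℤ) ∣ serreC E} => f E.1) a)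
    (h : ∀ E : IntermediateField F Ω, E ∈ ramifiedExtensions F Ω p → HasCharacter E χ →
      ¬ (p : ℤ) ∣ serreC E) :
    HasSum (fun E : {E // E ∈ ramifiedExtensions F Ω p ∧ HasCharacter E χ} => f E.1) a := by
  have : IsEmpty {E : IntermediateField F Ω //
      E ∈ ramifiedExtensions F Ω p ∧ HasCharacter E χ ∧ (p : ℤ) ∣ serreC E} :=
    ⟨fun E => h E.1 E.2.1 E.2.2.1 E.2.2.2⟩
  have h1 := hasSum_of_dvd_of_not_dvd ha hasSum_empty
  rwa [add_zero] at h1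

/-- Divisibility of c(E) by p forces j = p, which requires χ = 1 and |p| to be a power of |ϖ|. -/
theorem eq_one_and_map_prime_ne_zero_of_dvd (hw : IsExtendedValuation F w) (h0 : ϖ ≠ 0)
    (hϖ : val F ϖ = 1) {E : IntermediateField F Ω} (hE : E ∈ ramifiedExtensions F Ω p)
    (hχ : HasCharacter E χ) (hdvd : (p : ℤ) ∣ serreC E) : χ = 1 ∧ w (p : Ω) ≠ 0 := by
  have hwϖ0 : w (algebraMap F Ω ϖ) ≠ 0 := by simpa using h0
  obtain ⟨i, j, hj1, hjp, hc, -, -, hj⟩ := exists_type_of_hasCharacter hw h0 hϖ hE hχ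
  rw [hc, dvd_add_right (dvd_mul_left _ _), Int.natCast_dvd_natCast] at hdvd
  obtain ⟨h1, h2⟩ := hj (le_antisymm hjp (Nat.le_of_dvd (by omega) hdvd))
  exact ⟨h2, by rw [h1]; exact pow_ne_zero _ hwϖ0⟩

theorem hasSum_not_dvd_of_charZero [CharZero F] (χ : Character F Ω p) :
    HasSum (fun E : {E : IntermediateField F Ω //
        (E ∈ ramifiedExtensions F Ω p ∧ HasCharacter E χ) ∧ ¬ (p : ℤ) ∣ serreC E} =>
      (Nat.card 𝓀[F] : ℝ) ^ (-serreC E.1))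
      ((p : ℝ) * ((Nat.card 𝓀[F] : ℝ) - 1) / (p - 1) *
        ∑ i ∈ Finset.range (absRamificationIdx F p), massTerm χ i) := by
  have : Algebra.IsAlgebraic F Ω := IsAlgClosure.isAlgebraic
  obtain ⟨w, hw⟩ := exists_isExtendedValuation F Ω
  obtain ⟨ϖ, h0, hϖ⟩ := exists_val_eq_one F
  have hwϖ0 : 0 < w (algebraMap F Ω ϖ) := by rw [zero_lt_iff]; simpa using h0
  obtain ⟨-, he⟩ := map_prime_eq (p := p) hw h0 hϖ
  refine hasSum_not_dvd hw h0 hϖ (fun i => i < absRamificationIdx F p) (fun i => ?_) ?_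
  -- Since |p| = |ϖ|^e, the condition |p| ≤ |ϖ|^(i+1) means i < e.
  · rw [he, pow_le_pow_iff_right_of_lt_one₀ hwϖ0 (hw.uniformizer_lt_one h0 hϖ)]
    exact Nat.lt_iff_add_one_le
  · rw [← Finset.sum_congr rfl fun i hi => if_pos (Finset.mem_range.1 hi)]
    exact hasSum_sum_of_ne_finset_zero fun i hi => if_neg (by rwa [Finset.mem_range] at hi)

theorem hasSum_dvd_of_charZero [CharZero F] :
    HasSum (fun E : {E : IntermediateField F Ω //
        E ∈ ramifiedExtensions F Ω p ∧ HasCharacter E (1 : Character F Ω p) ∧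
          (p : ℤ) ∣ serreC E} => (Nat.card 𝓀[F] : ℝ) ^ (-serreC E.1))
      ((p : ℝ) / (Nat.card 𝓀[F] : ℝ) ^ ((p - 1) * absRamificationIdx F p)) := by
  have : Algebra.IsAlgebraic F Ω := IsAlgClosure.isAlgebraic
  obtain ⟨w, hw⟩ := exists_isExtendedValuation F Ω
  obtain ⟨ϖ, h0, hϖ⟩ := exists_val_eq_one F
  obtain ⟨he1, he⟩ := map_prime_eq (p := p) hw h0 hϖ
  obtain ⟨i, hi⟩ : ∃ i, absRamificationIdx F p = i + 1 := ⟨absRamificationIdx F p - 1, by omega⟩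
  rw [hi] at he ⊢
  exact hasSum_dvd hw h0 hϖ he

theorem not_dvd_of_ne_one (hχ1 : χ ≠ 1) {E : IntermediateField F Ω}
    (hE : E ∈ ramifiedExtensions F Ω p) (hχ : HasCharacter E χ) : ¬ (p : ℤ) ∣ serreC E := by
  have : Algebra.IsAlgebraic F Ω := IsAlgClosure.isAlgebraic
  obtain ⟨w, hw⟩ := exists_isExtendedValuation F Ω
  obtain ⟨ϖ, h0, hϖ⟩ := exists_val_eq_one F
  exact fun h => hχ1 (eq_one_and_map_prime_ne_zero_of_dvd hw h0 hϖ hE hχ h).1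

theorem hasSum_of_charP [CharP F p] (χ : Character F Ω p) :
    HasSum (fun E : {E // E ∈ ramifiedExtensions F Ω p ∧ HasCharacter E χ} =>
      (Nat.card 𝓀[F] : ℝ) ^ (-serreC E.1))
      ((p : ℝ) * ((Nat.card 𝓀[F] : ℝ) - 1) / (p - 1) * ∑' i : ℕ, massTerm χ i) := by
  have : Algebra.IsAlgebraic F Ω := IsAlgClosure.isAlgebraic
  obtain ⟨w, hw⟩ := exists_isExtendedValuation F Ω
  obtain ⟨ϖ, h0, hϖ⟩ := exists_val_eq_one F
  have hp0 : w (p : Ω) = 0 := by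
    rw [← map_natCast (algebraMap F Ω), CharP.cast_eq_zero, map_zero, map_zero]
  refine hasSum_of_forall_not_dvd (f := fun E => (Nat.card 𝓀[F] : ℝ) ^ (-serreC E)) ?_
    fun E hE hχ h => (eq_one_and_map_prime_ne_zero_of_dvd hw h0 hϖ hE hχ h).2 hp0
  -- In characteristic p the absolute value of p is 0, so every i occurs and the sum is infinite.
  refine hasSum_not_dvd hw h0 hϖ (fun _ => True) (fun i => ?_) ?_
  · rw [hp0]
    simp
  · simpa using (summable_massTerm χ).hasSum

end Total

end MassFormula

/-! ### The mass formula. -/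

open MassFormula in
theorem proposition1 {F : Type*} [Field F] [ValuativeRel F] [TopologicalSpace F]
    [IsNonarchimedeanLocalField F] {Ω : Type*} [Field Ω] [Algebra F Ω] [IsAlgClosure F Ω]
    (p : ℕ) [Fact p.Prime] [CharP 𝓀[F] p] (q e : ℕ)
    (hq : q = Nat.card 𝓀[F]) (he : e = absRamificationIdx F p) :
    (∀ E ∈ ramifiedExtensions F Ω p, ∃! χ : Character F Ω p, HasCharacter E χ) ∧
    ∀ χ : Character F Ω p,
      (CharZero F →
        (χ ≠ 1 →
          HasSum (fun E : {E // E ∈ ramifiedExtensions F Ω p ∧ HasCharacter E χ} =>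
              (q : ℝ) ^ (-serreC E.1))
            ((p : ℝ) * (q - 1) / (p - 1) * ∑ i ∈ Finset.range e, massTerm χ i)) ∧
        (χ = 1 →
          HasSum (fun E : {E // E ∈ ramifiedExtensions F Ω p ∧ HasCharacter E χ} =>
              (q : ℝ) ^ (-serreC E.1))
            ((p : ℝ) * (q - 1) / (p - 1) * ∑ i ∈ Finset.range e, massTerm χ i +
              (p : ℝ) / (q : ℝ) ^ ((p - 1) * e)) ∧
          HasSum (fun E : {E // E ∈ ramifiedExtensions F Ω p ∧ HasCharacter E χ ∧
                (p : ℤ) ∣ serreC E} =>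
              (q : ℝ) ^ (-serreC E.1))
            ((p : ℝ) / (q : ℝ) ^ ((p - 1) * e)))) ∧
      (CharP F p →
        Summable (fun i : ℕ => massTerm χ i) ∧
        HasSum (fun E : {E // E ∈ ramifiedExtensions F Ω p ∧ HasCharacter E χ} =>
            (q : ℝ) ^ (-serreC E.1))
          ((p : ℝ) * (q - 1) / (p - 1) * ∑' i : ℕ, massTerm χ i)) := by
  subst hq he
  refine ⟨fun E hE => existsUnique_hasCharacter hE, fun χ => ⟨fun _ => ⟨fun hχ => ?_, ?_⟩,
    fun _ => ⟨summable_massTerm χ, hasSum_of_charP χ⟩⟩⟩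
  · exact hasSum_of_forall_not_dvd (f := fun E => (Nat.card 𝓀[F] : ℝ) ^ (-serreC E))
      (hasSum_not_dvd_of_charZero χ) fun E hE h => not_dvd_of_ne_one hχ hE h
  · rintro rfl
    exact ⟨hasSum_of_dvd_of_not_dvd (f := fun E => (Nat.card 𝓀[F] : ℝ) ^ (-serreC E))
      (hasSum_not_dvd_of_charZero 1) hasSum_dvd_of_charZero, hasSum_dvd_of_charZero⟩
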